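/- Let $U:\mathbb R\to[0,\infty)$ be smooth and even, with $U>0$ on $(-1,1)$, $U(\pm1)=0$ and $U''(\pm1)=1$. Consider $$\partial_t\phi=\dot\phi,\qquad \partial_t\dot\phi=\partial_x^2\phi-U'(\phi),\qquad (t,x)\in\mathbb R\times\mathbb R. \tag{1}$$ For a pair $(\phi_0,\dot\phi_0)$ of real functions on $\mathbb R$ put $$E_p(\phi_0)=\int_{\mathbb R}\Big(\tfrac12(\partial_x\phi_0)^2+U(\phi_0)\Big)dx,\qquad E(\phi_0,\dot\phi_0)=E_p(\phi_0)+\int_{\mathbb R}\tfrac12\dot\phi_0^2\,dx .$$ For $\iota_\pm\in\{-1,1\}$ let $\mathcal E_{\iota_-,\iota_+}$ be the set of pairs with finite energy $E$ and $\phi_0(x)\to\iota_\pm$ as $x\to\pm\infty$, with the distance of $H^1(\mathbb R)\times L^2(\mathbb R)$. A *solution* is a map $\boldsymbol\phi=(\phi,\dot\phi)\in C(\mathbb R;\mathcal E_{\iota_-,\iota_+})$, for some $\iota_-,\iota_+\in\{-1,1\}$, that satisfies (1) in the sense of distributions; its energy $E(\boldsymbol\phi(t))$ does not depend on $t$ and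 is denoted $E(\boldsymbol\phi)$. Let $H:\mathbb R\to(-1,1)$ (the kink) be the inverse of the bijection $G:(-1,1)\to\mathbb R$, $G(y)=\int_0^y\frac{dz}{\sqrt{2U(z)}}$, and for $\vec a=(a_1,\dots,a_n)\in\mathbb R^n$ let $$H(\vec a)=1+\sum_{k=1}^n(-1)^k\big(H(\cdot-a_k)+1\big).$$ For $n\in\{0,1,2,\dots\}$, a solution $\boldsymbol\phi$ is a *kink $n$-cluster* if $E(\boldsymbol\phi)\le nE_p(H)$ and there are functions $x_0,\dots,x_n:\mathbb R\to\mathbb R$ with $x_0(t)\le x_1(t)\le\dots\le x_n(t)$ for all $t$ and $\lim_{t\to\infty}\phi(t,x_k(t))=(-1)^k$ for $k=0,1,\dots,n$. **Proposition.** Let $n\in\{0,1,2,\dots\}$. A solution $\boldsymbol\phi$ of (1) is a kink $n$-cluster if and only if there exist continuous functions $a_1,\dots,a_n:\mathbb R\to\mathbb R$ such that $$\lim_{t\to\infty}\Big(\|\partial_t\phi(t)\|_{L^2}^2+\|\phi(t)-H(\vec a(t))\|_{H^1}^2+\sum_{k=1}^{n-1}e^{-(a_{k+1}(t)-a_k(t))}\Big)=0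 .$$ In particular, if $\boldsymbol\phi$ is a kink $n$-cluster, then $E(\boldsymbol\phi)=nE_p(H)$. -/

import Mathlib

open MeasureTheory Filter Topology Set
open scoped ENNReal ContDiff

namespace ScalarField

/-- The self-interaction potential: a smooth, even, nonnegative function, positive on `(-1, 1)`,
vanishing at `±1`, with `U''(±1) = 1`. -/
structure IsPotential (U : ℝ → ℝ) : Prop where
  smooth : ContDiff ℝ ∞ U
  nonneg : ∀ y, 0 ≤ U y
  even : Function.Even U
  pos : ∀ y ∈ Ioo (-1 : ℝ) 1, 0 < U y
  zero_one : U 1 = 0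
  zero_neg_one : U (-1) = 0
  deriv_two_one : deriv (deriv U) 1 = 1
  deriv_two_neg_one : deriv (deriv U) (-1) = 1

/-- Potential energy `E_p(u) = ∫ (1/2) (u')² + U(u)`, with values in `[0, ∞]`. It is applied to
locally absolutely continuous `u` only, whose pointwise derivative exists almost everywhere and is
the weak derivative. -/
noncomputable def potentialEnergy (U : ℝ → ℝ) (u : ℝ → ℝ) : ℝ≥0∞ :=
  ∫⁻ x, ENNReal.ofReal (1 / 2 * deriv u x ^ 2 + U (u x))

/-- Total energy `E(u, v) = ∫ (1/2) v² + (1/2) (u')² + U(u)`, with values in `[0, ∞]`. -/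
noncomputable def energy (U : ℝ → ℝ) (u v : ℝ → ℝ) : ℝ≥0∞ :=
  ∫⁻ x, ENNReal.ofReal (1 / 2 * v x ^ 2 + 1 / 2 * deriv u x ^ 2 + U (u x))

/-- `‖v‖²` in `L²(ℝ)`, with values in `[0, ∞]`. -/
noncomputable def l2NormSq (v : ℝ → ℝ) : ℝ≥0∞ :=
  eLpNorm v 2 volume ^ 2

/-- `‖u‖²` in `H¹(ℝ)` of a locally absolutely continuous `u`, with values in `[0, ∞]`; it is `∞`
when `u` is not in `H¹(ℝ)`. -/
noncomputable def h1NormSq (u : ℝ → ℝ) : ℝ≥0∞ :=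
  l2NormSq u + l2NormSq (deriv u)

/-- The set `𝓔_{ι₋, ι₊}` of finite energy states `(u, v)` with `u → ι₋` at `-∞` and `u → ι₊` at
`+∞`. The first component is the (locally absolutely) continuous representative; the second one is
a representative of an element of `L²(ℝ)`. -/
structure InSector (U : ℝ → ℝ) (ιm ιp : ℝ) (u v : ℝ → ℝ) : Prop where
  absolutelyContinuous : ∀ b c, AbsolutelyContinuousOnInterval u b c
  aestronglyMeasurable : AEStronglyMeasurable v volume
  energy_lt_top : energy U u v < (⊤ : ℝ≥0∞)
  tendsto_atBot : Tendsto u atBot (𝓝 ιm)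
  tendsto_atTop : Tendsto u atTop (𝓝 ιp)

/-- `(φ, ψ)` (with `ψ` standing for `φ` with a dot) is a global solution, in the energy sector
`𝓔_{ι₋, ι₊}`, of the system `∂ₜφ = ψ`, `∂ₜψ = ∂ₓ²φ - U'(φ)`: it is continuous in time with values
in the sector, for the distance of `H¹ × L²`, and the system holds in the sense of distributions on
`ℝ × ℝ`. Test functions are functions of `(t, x)`; time is the first argument of `φ` and `ψ`. -/
structure IsSolutionInSector (U : ℝ → ℝ) (ιm ιp : ℝ) (φ ψ : ℝ → ℝ → ℝ) : Prop where
  inSector : ∀ t, InSector U ιm ιp (φ t) (ψ t)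
  continuous : ∀ t₀, Tendsto
    (fun t => h1NormSq (fun x => φ t x - φ t₀ x) + l2NormSq (fun x => ψ t x - ψ t₀ x))
    (𝓝 t₀) (𝓝 0)
  eq_fst : ∀ η : ℝ × ℝ → ℝ, ContDiff ℝ ∞ η → HasCompactSupport η →
    -∫ t, ∫ x, φ t x * deriv (fun s => η (s, x)) t = ∫ t, ∫ x, ψ t x * η (t, x)
  eq_snd : ∀ η : ℝ × ℝ → ℝ, ContDiff ℝ ∞ η → HasCompactSupport η →
    -∫ t, ∫ x, ψ t x * deriv (fun s => η (s, x)) t =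
      ∫ t, ∫ x, (φ t x * iteratedDeriv 2 (fun y => η (t, y)) x - deriv U (φ t x) * η (t, x))

/-- A solution in one of the four sectors `𝓔_{±1, ±1}`. -/
def IsSolution (U : ℝ → ℝ) (φ ψ : ℝ → ℝ → ℝ) : Prop :=
  ∃ ιm ιp : ℝ, (ιm = 1 ∨ ιm = -1) ∧ (ιp = 1 ∨ ιp = -1) ∧ IsSolutionInSector U ιm ιp φ ψ

/-- `G(y) = ∫₀^y dz / √(2 U(z))`, considered for `y ∈ (-1, 1)`. -/
noncomputable def kinkInverse (U : ℝ → ℝ) (y : ℝ) : ℝ :=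
  ∫ z in (0 : ℝ)..y, 1 / √(2 * U z)

/-- The kink `H`, the inverse of the bijection `G : (-1, 1) → ℝ`. -/
noncomputable def kink (U : ℝ → ℝ) : ℝ → ℝ :=
  Function.invFunOn (kinkInverse U) (Ioo (-1) 1)

/-- The multi-kink configuration `H(a) = 1 + ∑_{k=1}^n (-1)^k (H(· - a_k) + 1)`; the position
`a_{k+1}` of the mathematical notation is `a k`, `k = 0, …, n - 1`. -/
noncomputable def multiKink (U : ℝ → ℝ) {n : ℕ} (a : Fin n → ℝ) (x : ℝ) : ℝ :=
  1 + ∑ k : Fin n, (-1 : ℝ) ^ ((k : ℕ) + 1) * (kink U (x - a k) + 1)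

/-- `∑_{k=1}^{n-1} exp (-(a_{k+1} - a_k))`. -/
noncomputable def gapWeight {n : ℕ} (a : Fin n → ℝ) : ℝ :=
  ∑ k : Fin (n - 1),
    Real.exp (-(a ⟨(k : ℕ) + 1, by have := k.isLt; omega⟩ -
      a ⟨(k : ℕ), by have := k.isLt; omega⟩))

/-- The solution `(φ, ψ)` is a kink `n`-cluster. Its energy, which does not depend on time, is
read off at time `0`. -/
def IsKinkCluster (U : ℝ → ℝ) (n : ℕ) (φ ψ : ℝ → ℝ → ℝ) : Prop :=
  (∃ x : Fin (n + 1) → ℝ → ℝ,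
    (∀ t, Monotone fun k => x k t) ∧
    ∀ k : Fin (n + 1), Tendsto (fun t => φ t (x k t)) atTop (𝓝 ((-1) ^ (k : ℕ)))) ∧
  energy U (φ 0) (ψ 0) ≤ n * potentialEnergy U (kink U)

end ScalarField

/-! Everything rests on the Bogomolny trick. With `W' = √(2U)` and a sign `s`, the energy density of
`u` is `½ (u' - s √(2U(u)))² + s (W ∘ u)'`. A transition between the vacua `∓1` therefore costs at
least `2 W(1)`, which is exactly the energy of the kink, and the excess is half the squared defect
of the first-order equation `u' = s √(2U(u))` solved by `±H`.

From cluster to multi-kink: the points `x_k(t)` force `n` transitions, so the potential energy is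
asymptotically at least `2n W(1)`, while energy conservation caps the total by the same number.
Hence the energy is exactly `n E_p(H)`, the kinetic part tends to `0`, and so do the defects
(`energy_eq_and_tendsto_kinetic`, `exists_multiKink_approx`). Between consecutive points the
solution has a zero, and Gronwall makes it close to `±H` on any fixed window around this zero
(`exists_close_to_kink`). The windows carry almost all the energy; the small remainder keeps `W ∘ u`
near `W(±1)`, hence `u` near a vacuum, and the quadratic growth of `U` there turns energy into an
`L²` bound (`lintegral_sub_multiKink_le`). The windows fit between the given points for every fixed
width, so the gaps diverge.

The zeros need not depend continuously on `t`. Admissible positions for one state are close to each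
other, so their convex hull remains admissible (`exists_convexHull_close`), and a selection from
convex sets by partition of unity gives continuous positions.

Conversely, a state near a widely separated multi-kink is near alternating vacua between the kinks
and has potential energy at most `2n W(1) + o(1)` (`exists_integral_density_le`); conservation then
bounds the energy at time `0`.

Conservation must be proved for distributional solutions that are merely continuous in time in the
energy space. Along characteristics, `∂ₜφ ± ∂ₓφ` is differentiable with values in `L²` with
derivative `-U'(φ)`, and the parallelogram law recovers the energy (`hasDerivAt_characteristic`,
`hasDerivAt_kinetic`). -/

namespace ScalarField

/-! ### Locally absolutely continuous functions and the Sobolev embedding. -/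

/-- Local absolute continuity on the real line. -/
abbrev LocAC (u : ℝ → ℝ) : Prop := ∀ b c, AbsolutelyContinuousOnInterval u b c

namespace LocAC

variable {u w : ℝ → ℝ}

theorem continuous (hu : LocAC u) : Continuous u := by
  rw [continuous_iff_continuousAt]
  intro x
  have h := (hu (x - 1) (x + 1)).continuousOn
  rw [uIcc_of_le (by linarith)] at h
  exact h.continuousAt (Icc_mem_nhds (by linarith) (by linarith))

theorem ae_differentiableAt (hu : LocAC u) : ∀ᵐ x, DifferentiableAt ℝ u x := by
  have h : ∀ n : ℕ, ∀ᵐ x, x ∈ uIcc (-(n : ℝ)) n → DifferentiableAt ℝ u x :=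
    fun n => (hu _ _).ae_differentiableAt
  filter_upwards [ae_all_iff.2 h] with x hx
  obtain ⟨n, hn⟩ := exists_nat_ge |x|
  refine hx n ?_
  rw [uIcc_of_le (by linarith [abs_nonneg x])]
  exact abs_le.1 hn

theorem of_contDiff (hu : ContDiff ℝ 1 u) : LocAC u :=
  fun _ _ => hu.contDiffOn.absolutelyContinuousOnInterval

theorem sub (hu : LocAC u) (hw : LocAC w) : LocAC (fun x => u x - w x) :=
  fun b c => (hu b c).fun_sub (hw b c)

theorem mul (hu : LocAC u) (hw : LocAC w) : LocAC (fun x => u x * w x) :=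
  fun b c => (hu b c).fun_mul (hw b c)

/-- A `C¹` function is Lipschitz on the bounded range of `u` over the interval, so it multiplies the
sums in the definition of absolute continuity by at most a constant. -/
theorem comp {F : ℝ → ℝ} (hF : ContDiff ℝ 1 F) (hu : LocAC u) : LocAC (fun x => F (u x)) := by
  intro b c
  obtain ⟨R, hR⟩ := (hu b c).exists_bound
  obtain ⟨K, hK⟩ := hF.contDiffOn.exists_lipschitzOnWith (n := 1) (by decide)
    (convex_Icc (-R) R) isCompact_Icc
  have h := Tendsto.const_mul (K : ℝ) (hu b c)
  rw [mul_zero] at h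
  refine squeeze_zero' (Eventually.of_forall fun E => Finset.sum_nonneg fun i _ => dist_nonneg)
    ?_ h
  refine eventually_inf_principal.2 (Eventually.of_forall fun E hE => ?_)
  rw [Finset.mul_sum]
  refine Finset.sum_le_sum fun i hi => ?_
  have h1 := abs_le.1 (hR _ (hE.1 i hi).1)
  have h2 := abs_le.1 (hR _ (hE.1 i hi).2)
  exact hK.dist_le_mul _ h1 _ h2

theorem intervalIntegrable_deriv (hu : LocAC u) (p q : ℝ) :
    IntervalIntegrable (deriv u) volume p q :=
  (hu p q).intervalIntegrable_deriv

theorem integral_deriv (hu : LocAC u) (p q : ℝ) : ∫ x in p..q, deriv u x = u q - u p :=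
  (hu p q).integral_deriv_eq_sub

theorem deriv_comp_ae {F : ℝ → ℝ} (hF : ContDiff ℝ 1 F) (hu : LocAC u) :
    ∀ᵐ x, deriv (fun x => F (u x)) x = deriv F (u x) * deriv u x := by
  filter_upwards [hu.ae_differentiableAt] with x hx
  exact ((hF.differentiable (by decide) (u x)).hasDerivAt.comp x hx.hasDerivAt).deriv

theorem integral_deriv_comp {F : ℝ → ℝ} (hF : ContDiff ℝ 1 F) (hu : LocAC u) (p q : ℝ) :
    ∫ x in p..q, deriv F (u x) * deriv u x = F (u q) - F (u p) := by
  rw [← (hu.comp hF).integral_deriv p q]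
  refine intervalIntegral.integral_congr_ae ?_
  filter_upwards [hu.deriv_comp_ae hF] with x hx _
  exact hx.symm

theorem deriv_sub_ae (hu : LocAC u) (hw : LocAC w) :
    deriv (fun x => u x - w x) =ᵐ[volume] fun x => deriv u x - deriv w x := by
  filter_upwards [hu.ae_differentiableAt, hw.ae_differentiableAt] with x h1 h2
  exact deriv_fun_sub h1 h2

/-- If `g' ≤ h` almost everywhere, then `g` grows at most by the integral of `h`. -/
theorem sub_le_integral {h : ℝ → ℝ} (hu : LocAC u) {p q : ℝ} (hpq : p ≤ q)
    (hh : IntervalIntegrable h volume p q)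
    (hle : ∀ᵐ x, x ∈ Icc p q → deriv u x ≤ h x) : u q - u p ≤ ∫ x in p..q, h x := by
  rw [← hu.integral_deriv p q]
  refine intervalIntegral.integral_mono_ae_restrict hpq (hu.intervalIntegrable_deriv p q) hh ?_
  rw [EventuallyLE, ae_restrict_iff' measurableSet_Icc]
  exact hle

end LocAC

theorem memLp_two_of_integrable_sq {f : ℝ → ℝ} (hf : AEStronglyMeasurable f volume)
    (h : Integrable fun x => f x ^ 2) : MemLp f 2 volume :=
  (memLp_two_iff_integrable_sq hf).2 h

/-- The one-dimensional Sobolev embedding `H¹ ⊆ L^∞`. -/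
theorem sq_le_of_locAC {u : ℝ → ℝ} (hu : LocAC u) (h0 : MemLp u 2 volume)
    (h1 : MemLp (deriv u) 2 volume) (x : ℝ) :
    u x ^ 2 ≤ 2 * ((∫ y, u y ^ 2) + ∫ y, deriv u y ^ 2) := by
  have i0 := h0.integrable_sq
  have i1 := h1.integrable_sq
  have hc : Continuous fun y => u y ^ 2 := hu.continuous.pow 2
  -- The minimum of `u²` over an interval of length one is at most its mean there; `|(u²)'| ≤ u² +
  -- u'²` then controls the passage from the minimum point to `x`.
  obtain ⟨y, hy, hmin⟩ := (isCompact_Icc (a := x) (b := x + 1)).exists_isMinOn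
    ⟨x, by simp⟩ hc.continuousOn
  have hy2 : u y ^ 2 ≤ ∫ z, u z ^ 2 := by
    calc u y ^ 2 = ∫ z in x..(x + 1), u y ^ 2 := by simp
      _ ≤ ∫ z in x..(x + 1), u z ^ 2 := by
          refine intervalIntegral.integral_mono_on (by linarith) (by simp)
            (hc.intervalIntegrable _ _) fun z hz => hmin hz
      _ ≤ ∫ z, u z ^ 2 := by
          rw [intervalIntegral.integral_of_le (by linarith)]
          exact setIntegral_le_integral i0 (Eventually.of_forall fun z => sq_nonneg _)
  have hs : LocAC fun y => u y ^ 2 := hu.comp (F := fun y => y ^ 2) (by fun_prop)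
  have hd : ∀ᵐ z, deriv (fun y => u y ^ 2) z = 2 * u z * deriv u z := by
    filter_upwards [hu.ae_differentiableAt] with z hz
    simpa using (hz.hasDerivAt.fun_pow 2).deriv
  have hi : Integrable fun z => u z ^ 2 + deriv u z ^ 2 := i0.add i1
  have h3 : u x ^ 2 - u y ^ 2 ≤ ∫ z, (u z ^ 2 + deriv u z ^ 2) := by
    have : -u x ^ 2 - -u y ^ 2 ≥ -∫ z, (u z ^ 2 + deriv u z ^ 2) := by
      have hm : u y ^ 2 - u x ^ 2 = ∫ z in x..y, deriv (fun y => u y ^ 2) z :=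
        (hs.integral_deriv x y).symm
      have : ‖∫ z in x..y, deriv (fun y => u y ^ 2) z‖ ≤ ∫ z, (u z ^ 2 + deriv u z ^ 2) := by
        calc _ ≤ ∫ z in x..y, ‖deriv (fun y => u y ^ 2) z‖ :=
              intervalIntegral.norm_integral_le_integral_norm hy.1
          _ ≤ ∫ z in x..y, (u z ^ 2 + deriv u z ^ 2) := by
              refine intervalIntegral.integral_mono_ae hy.1
                (hs.intervalIntegrable_deriv x y).norm hi.intervalIntegrable ?_
              filter_upwards [hd] with z hz
              rw [hz, Real.norm_eq_abs, abs_le]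
              constructor <;> nlinarith [sq_nonneg (u z + deriv u z), sq_nonneg (u z - deriv u z)]
          _ ≤ _ := by
              rw [intervalIntegral.integral_of_le hy.1]
              exact setIntegral_le_integral hi (Eventually.of_forall fun z => by positivity)
      rw [← hm, Real.norm_eq_abs] at this
      nlinarith [neg_abs_le (u y ^ 2 - u x ^ 2), this]
    linarith
  rw [integral_add i0 i1] at h3
  have : 0 ≤ ∫ y, deriv u y ^ 2 := integral_nonneg fun _ => sq_nonneg _
  linarith

/-! ### The potential near its vacua and the superpotential. -/

/-- The primitive `W` of `√(2 U)` vanishing at `0`. -/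
noncomputable def superpotential (U : ℝ → ℝ) (y : ℝ) : ℝ := ∫ z in (0 : ℝ)..y, √(2 * U z)

theorem superpotential_zero (U : ℝ → ℝ) : superpotential U 0 = 0 := by simp [superpotential]

namespace IsPotential

variable {U : ℝ → ℝ} (hU : IsPotential U)
include hU

theorem contDiff_deriv : ContDiff ℝ ∞ (deriv U) := by
  have h : ContDiff ℝ (((⊤ : ℕ∞) : WithTop ℕ∞) + 1) U := by simpa using hU.smooth
  exact (contDiff_succ_iff_deriv.1 h).2.2

theorem continuous : Continuous U := hU.smooth.continuous

theorem hasDerivAt (y : ℝ) : HasDerivAt U (deriv U y) y :=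
  (hU.smooth.differentiable (by decide) y).hasDerivAt

theorem hasDerivAt_deriv (y : ℝ) : HasDerivAt (deriv U) (deriv (deriv U) y) y :=
  (hU.contDiff_deriv.differentiable (by decide) y).hasDerivAt

theorem continuous_deriv_two : Continuous (deriv (deriv U)) :=
  hU.contDiff_deriv.continuous_deriv (by decide)

theorem continuous_sqrt : Continuous fun y => √(2 * U y) :=
  (continuous_const.mul hU.continuous).sqrt

theorem apply_sign {s : ℝ} (hs : s = 1 ∨ s = -1) : U s = 0 := by
  rcases hs with rfl | rfl
  exacts [hU.zero_one, hU.zero_neg_one]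

theorem deriv_eq_zero {y : ℝ} (hy : U y = 0) : deriv U y = 0 :=
  IsLocalMin.deriv_eq_zero (Eventually.of_forall fun z => by rw [hy]; exact hU.nonneg z)

/-- The Lipschitz bound gives continuity in time of `U'(φ)` in `L²`; the Taylor remainder is what is
needed to differentiate `∫ U(φ)`. -/
theorem exists_quadratic_bound (R : ℝ) : ∃ C : ℝ, 1 ≤ C ∧ ∀ y ∈ Icc (-R) R, ∀ z ∈ Icc (-R) R,
    |deriv U z - deriv U y| ≤ C * |z - y| ∧
    |U z - U y - deriv U y * (z - y)| ≤ C * (z - y) ^ 2 := by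
  obtain ⟨K, hK⟩ := (hU.contDiff_deriv.of_le (m := 1) (by simp)).contDiffOn.exists_lipschitzOnWith
    (n := 1) (by decide) (convex_Icc (-R) R) isCompact_Icc
  have key : ∀ y ∈ Icc (-R) R, ∀ z ∈ Icc (-R) R,
      |deriv U z - deriv U y| ≤ (K + 1 : ℝ) * |z - y| := by
    intro y hy z hz
    have := hK.dist_le_mul z hz y hy
    rw [Real.dist_eq, Real.dist_eq] at this
    nlinarith [abs_nonneg (z - y)]
  refine ⟨K + 1, by simp, fun y hy z hz => ⟨key y hy z hz, ?_⟩⟩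
  have hsub : uIcc y z ⊆ Icc (-R) R := uIcc_subset_Icc hy hz
  have h := Convex.norm_image_sub_le_of_norm_hasDerivWithin_le (𝕜 := ℝ)
    (f := fun x => U x - deriv U y * x) (f' := fun x => deriv U x - deriv U y)
    (C := (K + 1) * |z - y|) (s := uIcc y z) (x := y) (y := z)
    (fun x _ => by
      simpa using ((hU.hasDerivAt x).fun_sub ((hasDerivAt_id x).const_mul _)).hasDerivWithinAt)
    (fun x hx => by
      refine (key y hy x (hsub hx)).trans ?_
      have : |x - y| ≤ |z - y| := by
        simpa [abs_sub_comm] using abs_sub_left_of_mem_uIcc hx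
      exact mul_le_mul_of_nonneg_left this (by positivity))
    (convex_uIcc y z) left_mem_uIcc right_mem_uIcc
  rw [Real.norm_eq_abs, Real.norm_eq_abs, mul_assoc, abs_mul_abs_self, ← sq] at h
  convert h using 2
  ring

/-- A nonnegative smooth function controls the square of its derivative. -/
theorem exists_deriv_sq_le (R : ℝ) :
    ∃ K : ℝ, 0 < K ∧ ∀ y ∈ Icc (-R) R, deriv U y ^ 2 ≤ K * U y := by
  obtain ⟨C, hC1, hC⟩ := hU.exists_quadratic_bound (R + 1)
  obtain ⟨B, hB⟩ := isCompact_Icc.exists_bound_of_continuousOn (s := Icc (-R) R)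
    hU.contDiff_deriv.continuous.continuousOn
  set D := max C B with hD
  have hD0 : 0 < D := lt_of_lt_of_le (by linarith) (le_max_left C B)
  refine ⟨4 * D, by positivity, fun y hy => ?_⟩
  -- This `h` minimises `U y + U'(y) h + D h²`, an upper bound of `U (y + h)`. Nonnegativity of the
  -- minimum is the claim. Taking `D` above the maximum of `|U'|` keeps `|h| ≤ 1`, so that `y + h`
  -- stays in the interval of radius `R + 1`.
  set h := -(deriv U y) / (2 * D) with hh
  have hle : |h| ≤ 1 := by
    rw [hh, abs_div, abs_neg, abs_of_pos (by positivity : 0 < 2 * D), div_le_one (by positivity)]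
    have := hB y hy
    rw [Real.norm_eq_abs] at this
    linarith [le_max_right C B]
  have h1 := (hC y ⟨by linarith [hy.1], by linarith [hy.2]⟩ (y + h)
    ⟨by linarith [hy.1, (abs_le.1 hle).1], by linarith [hy.2, (abs_le.1 hle).2]⟩).2
  have h2 := (abs_le.1 h1).2
  have h3 := hU.nonneg (y + h)
  have h4 : C * (y + h - y) ^ 2 ≤ D * h ^ 2 := by
    rw [add_sub_cancel_left]
    exact mul_le_mul_of_nonneg_right (le_max_left C B) (sq_nonneg h)
  rw [add_sub_cancel_left] at h2 h4
  have h5 : 0 ≤ U y + deriv U y * h + D * h ^ 2 := by linarith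
  have h6 : deriv U y * h + D * h ^ 2 = -(deriv U y ^ 2 / (4 * D)) := by
    rw [hh]; field_simp; ring
  have h7 : deriv U y ^ 2 / (4 * D) ≤ U y := by linarith
  rw [div_le_iff₀ (by positivity)] at h7
  linarith

/-- The square root may fail to be differentiable at the zeros of `U`, but `U'² ≤ K U` bounds the
derivative of `√(2U + ε)` by `√K` uniformly in `ε > 0`, and `ε` is then sent to `0`. This Lipschitz
bound drives the divergence of `G` at `±1`, the Gronwall argument and the estimates on translates of
the kink. -/
theorem exists_sqrt_lipschitz (R : ℝ) : ∃ K : ℝ, 0 < K ∧ ∀ y ∈ Icc (-R) R, ∀ z ∈ Icc (-R) R,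
    |√(2 * U z) - √(2 * U y)| ≤ K * |z - y| := by
  obtain ⟨K, hK0, hK⟩ := hU.exists_deriv_sq_le R
  refine ⟨√K, Real.sqrt_pos.2 hK0, fun y hy z hz => ?_⟩
  have main : ∀ ε : ℝ, 0 < ε → |√(2 * U z + ε) - √(2 * U y + ε)| ≤ √K * |z - y| := by
    intro ε hε
    have hp : ∀ x, 0 < 2 * U x + ε := fun x => by linarith [hU.nonneg x]
    refine Convex.norm_image_sub_le_of_norm_hasDerivWithin_le (𝕜 := ℝ)
      (f := fun x => √(2 * U x + ε)) (f' := fun x => (2 * deriv U x) / (2 * √(2 * U x + ε)))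
      (s := Icc (-R) R) (x := y) (y := z)
      (fun x _ => (((hU.hasDerivAt x).const_mul 2).add_const ε |>.sqrt (hp x).ne').hasDerivWithinAt)
      (fun x hx => ?_) (convex_Icc _ _) hy hz
    have hs : 0 < √(2 * U x + ε) := Real.sqrt_pos.2 (hp x)
    rw [Real.norm_eq_abs, mul_div_mul_left _ _ two_ne_zero, abs_div, abs_of_pos hs,
      div_le_iff₀ hs, ← Real.sqrt_mul hK0.le, ← Real.sqrt_sq_eq_abs]
    refine Real.sqrt_le_sqrt ((hK x hx).trans ?_)
    nlinarith [hU.nonneg x]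
  have ht : Tendsto (fun ε : ℝ => |√(2 * U z + ε) - √(2 * U y + ε)|) (𝓝[>] 0)
      (𝓝 |√(2 * U z) - √(2 * U y)|) := by
    have : Continuous fun ε : ℝ => |√(2 * U z + ε) - √(2 * U y + ε)| := by fun_prop
    simpa using (this.tendsto 0).mono_left nhdsWithin_le_nhds
  exact le_of_tendsto ht (eventually_mem_nhdsWithin.mono fun ε hε => main ε hε)

/-- Near `1` one has `U'' > 1/2`; integrating twice from the vacuum, where `U` and `U'` vanish,
gives `U ≥ (y - 1)² / 4` on both sides. -/
theorem exists_sq_le_aux : ∃ ρ : ℝ, 0 < ρ ∧ ρ < 1 ∧ ∀ y, |y - 1| ≤ ρ → (y - 1) ^ 2 ≤ 4 * U y := by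
  have h : ∀ᶠ y in 𝓝 (1 : ℝ), 1 / 2 < deriv (deriv U) y := by
    refine hU.continuous_deriv_two.continuousAt.eventually (lt_mem_nhds ?_)
    rw [hU.deriv_two_one]; norm_num
  obtain ⟨ρ, hρ, hb⟩ := Metric.eventually_nhds_iff.1 h
  set r := min (ρ / 2) (1 / 2)
  have hr : 0 < r := by positivity
  refine ⟨r, hr, (min_le_right _ _).trans_lt (by norm_num), fun y hy => ?_⟩
  have hd2 : ∀ z ∈ Icc (1 - r) (1 + r), 1 / 2 < deriv (deriv U) z := fun z hz => by
    refine hb ?_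
    rw [Real.dist_eq]
    have : |z - 1| ≤ r := abs_le.2 ⟨by linarith [hz.1], by linarith [hz.2]⟩
    linarith [min_le_left (ρ / 2) (1 / 2)]
  have hk : MonotoneOn (fun z => deriv U z - (z - 1) / 2) (Icc (1 - r) (1 + r)) := by
    have hdk : ∀ z, HasDerivAt (fun z => deriv U z - (z - 1) / 2) (deriv (deriv U) z - 1 / 2) z :=
      fun z => (hU.hasDerivAt_deriv z).sub (((hasDerivAt_id z).sub_const 1).div_const 2)
    refine monotoneOn_of_deriv_nonneg (convex_Icc _ _)
      (fun z _ => (hdk z).continuousAt.continuousWithinAt)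
      (fun z _ => (hdk z).differentiableAt.differentiableWithinAt) fun z hz => ?_
    rw [(hdk z).deriv]
    linarith [hd2 z (interior_subset hz)]
  have h1 : deriv U 1 = 0 := hU.deriv_eq_zero hU.zero_one
  have hdg : ∀ z, HasDerivAt (fun z => U z - (z - 1) ^ 2 / 4) (deriv U z - (z - 1) / 2) z :=
    fun z => by
      convert! (hU.hasDerivAt z).sub ((((hasDerivAt_id z).sub_const 1).fun_pow 2).div_const 4) using 1
      simp; ring
  have hmem1 : (1 : ℝ) ∈ Icc (1 - r) (1 + r) := ⟨by linarith, by linarith⟩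
  rcases le_total 1 y with h1y | h1y
  · have hm : MonotoneOn (fun z => U z - (z - 1) ^ 2 / 4) (Icc 1 (1 + r)) := by
      refine monotoneOn_of_deriv_nonneg (convex_Icc _ _)
        (fun z _ => (hdg z).continuousAt.continuousWithinAt)
        (fun z _ => (hdg z).differentiableAt.differentiableWithinAt) fun z hz => ?_
      rw [(hdg z).deriv]
      have hz' := interior_subset hz
      have := hk hmem1 ⟨by linarith [hz'.1], hz'.2⟩ hz'.1
      simp only [h1] at this
      linarith
    have := hm (a := 1) ⟨le_rfl, by linarith⟩ ⟨h1y, by linarith [(abs_le.1 hy).2]⟩ h1y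
    simp only [hU.zero_one] at this
    linarith
  · have hm : AntitoneOn (fun z => U z - (z - 1) ^ 2 / 4) (Icc (1 - r) 1) := by
      refine antitoneOn_of_deriv_nonpos (convex_Icc _ _)
        (fun z _ => (hdg z).continuousAt.continuousWithinAt)
        (fun z _ => (hdg z).differentiableAt.differentiableWithinAt) fun z hz => ?_
      rw [(hdg z).deriv]
      have hz' := interior_subset hz
      have := hk ⟨hz'.1, by linarith [hz'.2]⟩ hmem1 hz'.2
      simp only [h1] at this
      linarith
    have := hm ⟨by linarith [(abs_le.1 hy).1], h1y⟩ (b := 1) ⟨by linarith, le_rfl⟩ h1y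
    simp only [hU.zero_one] at this
    linarith

/-- Quadratic growth of the potential at the vacua. -/
theorem exists_sq_le : ∃ ρ : ℝ, 0 < ρ ∧ ρ < 1 ∧
    ∀ s : ℝ, s = 1 ∨ s = -1 → ∀ y, |y - s| ≤ ρ → (y - s) ^ 2 ≤ 4 * U y := by
  obtain ⟨ρ, h0, h1, h⟩ := hU.exists_sq_le_aux
  refine ⟨ρ, h0, h1, ?_⟩
  rintro s (rfl | rfl) y hy
  · exact h y hy
  · have := h (-y) (by rw [← abs_neg]; convert hy using 2; ring)
    rw [hU.even y] at this
    linarith [this, (by ring : (-y - 1) ^ 2 = (y - -1) ^ 2)]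

local notation "W" => superpotential U

theorem hasDerivAt_superpotential (y : ℝ) : HasDerivAt W (√(2 * U y)) y :=
  hU.continuous_sqrt.integral_hasStrictDerivAt 0 y |>.hasDerivAt

theorem deriv_superpotential : deriv W = fun y => √(2 * U y) :=
  funext fun y => (hU.hasDerivAt_superpotential y).deriv

theorem contDiff_superpotential : ContDiff ℝ 1 W := by
  rw [contDiff_one_iff_deriv, hU.deriv_superpotential]
  exact ⟨fun y => (hU.hasDerivAt_superpotential y).differentiableAt, hU.continuous_sqrt⟩

theorem superpotential_mono : Monotone W :=
  monotone_of_deriv_nonneg (hU.contDiff_superpotential.differentiable (by decide)) fun y => by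
    rw [hU.deriv_superpotential]; positivity

theorem superpotential_neg (y : ℝ) : W (-y) = -W y := by
  have h := intervalIntegral.integral_comp_neg (a := 0) (b := y) (fun z => √(2 * U z))
  simp only [hU.even _, neg_zero] at h
  rw [superpotential, superpotential, h, intervalIntegral.integral_symm]

theorem superpotential_lt {y z : ℝ} (hyz : y < z) (h : ∃ x ∈ Ioo y z, 0 < U x) : W y < W z := by
  obtain ⟨x, hx, hx0⟩ := h
  have : W z - W y = ∫ t in y..z, √(2 * U t) :=
    intervalIntegral.integral_interval_sub_left (hU.continuous_sqrt.intervalIntegrable _ _)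
      (hU.continuous_sqrt.intervalIntegrable _ _)
  have h2 : 0 < ∫ t in y..z, √(2 * U t) :=
    intervalIntegral.integral_pos hyz hU.continuous_sqrt.continuousOn
      (fun t _ => Real.sqrt_nonneg _) ⟨x, ⟨hx.1.le, hx.2.le⟩, Real.sqrt_pos.2 (by linarith)⟩
  linarith

theorem superpotential_one_pos : 0 < W 1 := by
  rw [← superpotential_zero U]
  exact hU.superpotential_lt one_pos ⟨1 / 2, by norm_num, hU.pos _ (by norm_num)⟩

/-- If `W y` is close to the value of `W` at a vacuum then `y` is close to this vacuum. -/
theorem exists_superpotential_gap {r : ℝ} (hr : 0 < r) : ∃ c : ℝ, 0 < c ∧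
    ∀ s : ℝ, s = 1 ∨ s = -1 → ∀ y, |W y - W s| < c → |y - s| < r := by
  obtain ⟨ρ, hρ0, hρ1, hρ⟩ := hU.exists_sq_le
  have hpos : ∀ x, |x - 1| ≤ ρ → x ≠ 1 → 0 < U x := fun x hx hx1 => by
    have := hρ 1 (Or.inl rfl) x hx
    have h2 : 0 < (x - 1) ^ 2 := by
      have := sub_ne_zero.2 hx1
      positivity
    linarith
  -- Beyond `1` positivity of `U` is known only within `ρ` of the vacuum, so strict growth of `W`
  -- across `[1, 1 + r]` is witnessed at a point this close to `1`.
  set d := min r ρ / 2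
  have hd : 0 < d := by positivity
  have hd1 : d < r := by
    have := min_le_left r ρ
    have : d = min r ρ / 2 := rfl
    linarith
  have hd2 : d < ρ := by
    have := min_le_right r ρ
    have : d = min r ρ / 2 := rfl
    linarith
  have hp : W 1 < W (1 + r) := hU.superpotential_lt (by linarith)
    ⟨1 + d, ⟨by linarith, by linarith⟩, hpos _ (by simp [abs_of_pos hd, hd2.le]) (by linarith)⟩
  have hm : W (1 - r) < W 1 := hU.superpotential_lt (by linarith)
    ⟨1 - d, ⟨by linarith, by linarith⟩, hpos _ (by
      rw [abs_le]; constructor <;> linarith) (by linarith)⟩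
  have key : ∀ y, |W y - W 1| < min (W (1 + r) - W 1) (W 1 - W (1 - r)) → |y - 1| < r := by
    intro y hy
    obtain ⟨h1, h2⟩ := lt_min_iff.1 hy
    rw [abs_lt]
    constructor
    · by_contra! hcon
      have := hU.superpotential_mono (show y ≤ 1 - r by linarith)
      linarith [(abs_lt.1 h2).1]
    · by_contra! hcon
      have := hU.superpotential_mono (show 1 + r ≤ y by linarith)
      linarith [(abs_lt.1 h1).2]
  refine ⟨_, lt_min (sub_pos.2 hp) (sub_pos.2 hm), ?_⟩
  rintro s (rfl | rfl) y hy
  · exact key y hy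
  · have := key (-y) (by
      rw [hU.superpotential_neg]
      rw [hU.superpotential_neg] at hy
      rw [← abs_neg]; convert hy using 2; ring)
    rw [← abs_neg]; convert this using 2; ring

end IsPotential

/-! ### The kink: first-order equation, limits, energy, dependence on translations. -/

namespace IsPotential

variable {U : ℝ → ℝ} (hU : IsPotential U)
include hU

local notation "W" => superpotential U
local notation "G" => kinkInverse U
local notation "H" => kink U

theorem sqrt_pos {y : ℝ} (hy : y ∈ Ioo (-1 : ℝ) 1) : 0 < √(2 * U y) :=
  Real.sqrt_pos.2 (by linarith [hU.pos y hy])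

theorem continuousOn_inv_sqrt : ContinuousOn (fun z => 1 / √(2 * U z)) (Ioo (-1) 1) :=
  continuousOn_const.div hU.continuous_sqrt.continuousOn fun _ hz => (hU.sqrt_pos hz).ne'

theorem hasDerivAt_kinkInverse {y : ℝ} (hy : y ∈ Ioo (-1 : ℝ) 1) :
    HasDerivAt G (1 / √(2 * U y)) y := by
  have hsub : uIcc 0 y ⊆ Ioo (-1 : ℝ) 1 :=
    (convex_Ioo (-1 : ℝ) 1).ordConnected.uIcc_subset (by norm_num) hy
  exact intervalIntegral.integral_hasDerivAt_right
    (hU.continuousOn_inv_sqrt.mono hsub).intervalIntegrable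
    (hU.continuousOn_inv_sqrt.stronglyMeasurableAtFilter isOpen_Ioo y hy)
    (hU.continuousOn_inv_sqrt.continuousAt (isOpen_Ioo.mem_nhds hy))

theorem continuousOn_kinkInverse : ContinuousOn G (Ioo (-1) 1) :=
  fun _ hy => (hU.hasDerivAt_kinkInverse hy).continuousAt.continuousWithinAt

theorem strictMonoOn_kinkInverse : StrictMonoOn G (Ioo (-1) 1) := by
  refine strictMonoOn_of_deriv_pos (convex_Ioo _ _) hU.continuousOn_kinkInverse fun y hy => ?_
  rw [interior_Ioo] at hy
  rw [(hU.hasDerivAt_kinkInverse hy).deriv]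
  exact one_div_pos.2 (hU.sqrt_pos hy)

theorem kinkInverse_neg (y : ℝ) : G (-y) = -G y := by
  have h := intervalIntegral.integral_comp_neg (a := 0) (b := y) (fun z => 1 / √(2 * U z))
  simp only [hU.even _, neg_zero] at h
  rw [kinkInverse, kinkInverse, h, intervalIntegral.integral_symm]

/-- Since `√(2U)` is Lipschitz and vanishes at `1`, it is at most `K (1 - y)`, so `G(y)` dominates
`-log(1 - y) / K`, which diverges at `1`. -/
theorem exists_le_kinkInverse (c : ℝ) : ∃ y ∈ Ioo (-1 : ℝ) 1, c ≤ G y := by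
  obtain ⟨K, hK0, hK⟩ := hU.exists_sqrt_lipschitz 1
  have hm : MonotoneOn (fun y => G y + Real.log (1 - y) / K) (Ico 0 1) := by
    have hd : ∀ y ∈ Ico (0 : ℝ) 1, HasDerivAt (fun y => G y + Real.log (1 - y) / K)
        (1 / √(2 * U y) + -1 / (1 - y) / K) y := fun y hy =>
      (hU.hasDerivAt_kinkInverse ⟨by linarith [hy.1], hy.2⟩).add
        ((((hasDerivAt_id y).const_sub 1).log (by simpa using (sub_pos.2 hy.2).ne')).div_const K)
    refine monotoneOn_of_deriv_nonneg (convex_Ico _ _)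
      (fun y hy => (hd y hy).continuousAt.continuousWithinAt)
      (fun y hy => (hd y (interior_subset hy)).differentiableAt.differentiableWithinAt)
      fun y hy => ?_
    have hy' := interior_subset hy
    rw [(hd y hy').deriv]
    have h1 : 0 < 1 - y := sub_pos.2 hy'.2
    have h2 := hK 1 (by norm_num) y ⟨by linarith [hy'.1], hy'.2.le⟩
    rw [hU.zero_one, mul_zero, Real.sqrt_zero, sub_zero, abs_of_nonneg (Real.sqrt_nonneg _),
      abs_sub_comm, abs_of_pos h1] at h2
    have h3 : 1 / (K * (1 - y)) ≤ 1 / √(2 * U y) :=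
      one_div_le_one_div_of_le (hU.sqrt_pos ⟨by linarith [hy'.1], hy'.2⟩) h2
    have h4 : -1 / (1 - y) / K = -(1 / (K * (1 - y))) := by field_simp
    rw [h4]; linarith
  -- The solution of `-log(1 - y) / K = max c 0`; the maximum puts `y` in `[0, 1)`.
  set y := 1 - Real.exp (-(K * max c 0)) with hy
  have he : Real.exp (-(K * max c 0)) ≤ 1 := Real.exp_le_one_iff.2 (by
    have : 0 ≤ K * max c 0 := by positivity
    linarith)
  have hp := Real.exp_pos (-(K * max c 0))
  refine ⟨y, ⟨by linarith, by linarith⟩, ?_⟩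
  have := hm (a := 0) ⟨le_rfl, one_pos⟩ (b := y) ⟨by linarith, by linarith⟩ (by linarith)
  simp only [hy, sub_zero, Real.log_one, zero_div, add_zero, sub_sub_cancel, Real.log_exp] at this
  rw [← hy, neg_div, mul_div_cancel_left₀ _ hK0.ne'] at this
  have h0 : G 0 = 0 := by simp [kinkInverse]
  linarith [le_max_left c 0]

theorem exists_kinkInverse_eq (x : ℝ) : ∃ y ∈ Ioo (-1 : ℝ) 1, G y = x := by
  obtain ⟨y, hy, hxy⟩ := hU.exists_le_kinkInverse x
  obtain ⟨z, hz, hxz⟩ := hU.exists_le_kinkInverse (-x)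
  have hz' : -z ∈ Ioo (-1 : ℝ) 1 := ⟨by linarith [hz.2], by linarith [hz.1]⟩
  have := (isPreconnected_Ioo.image _ hU.continuousOn_kinkInverse).ordConnected.out
    (mem_image_of_mem _ hz') (mem_image_of_mem _ hy)
  exact this ⟨by rw [hU.kinkInverse_neg]; linarith, hxy⟩

theorem kink_mem (x : ℝ) : H x ∈ Ioo (-1 : ℝ) 1 :=
  Function.invFunOn_mem (hU.exists_kinkInverse_eq x)

theorem kinkInverse_kink (x : ℝ) : G (H x) = x :=
  Function.invFunOn_eq (hU.exists_kinkInverse_eq x)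

theorem kink_kinkInverse {y : ℝ} (hy : y ∈ Ioo (-1 : ℝ) 1) : H (G y) = y :=
  hU.strictMonoOn_kinkInverse.injOn (hU.kink_mem _) hy (hU.kinkInverse_kink _)

theorem kink_strictMono : StrictMono H := by
  intro x y hxy
  rw [← hU.strictMonoOn_kinkInverse.lt_iff_lt (hU.kink_mem x) (hU.kink_mem y),
    hU.kinkInverse_kink, hU.kinkInverse_kink]
  exact hxy

theorem range_kink : range H = Ioo (-1) 1 :=
  Subset.antisymm (range_subset_iff.2 hU.kink_mem) fun _ hy => ⟨_, hU.kink_kinkInverse hy⟩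

theorem kink_neg (x : ℝ) : H (-x) = -H x := by
  have h := hU.kink_mem x
  refine hU.strictMonoOn_kinkInverse.injOn (hU.kink_mem _)
    (show -H x ∈ Ioo (-1 : ℝ) 1 from ⟨by linarith [h.2], by linarith [h.1]⟩) ?_
  rw [hU.kinkInverse_kink, hU.kinkInverse_neg, hU.kinkInverse_kink]

theorem kink_zero : H 0 = 0 := by
  have := hU.kink_neg 0
  rw [neg_zero] at this
  linarith

theorem kink_abs_lt (x : ℝ) : |H x| < 1 := abs_lt.2 (hU.kink_mem x)

theorem potential_kink_pos (x : ℝ) : 0 < U (H x) := hU.pos _ (hU.kink_mem x)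

theorem hasDerivAt_kink (x : ℝ) : HasDerivAt H (√(2 * U (H x))) x := by
  have hc : ContinuousAt H x :=
    continuousAt_of_monotoneOn_of_image_mem_nhds (s := univ) (hU.kink_strictMono.monotone.monotoneOn _)
      univ_mem (by rw [image_univ, hU.range_kink]; exact isOpen_Ioo.mem_nhds (hU.kink_mem x))
  have := HasDerivAt.of_local_left_inverse hc (hU.hasDerivAt_kinkInverse (hU.kink_mem x))
    (one_div_pos.2 (hU.sqrt_pos (hU.kink_mem x))).ne' (Eventually.of_forall hU.kinkInverse_kink)
  simpa using this

theorem deriv_kink : deriv H = fun x => √(2 * U (H x)) :=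
  funext fun x => (hU.hasDerivAt_kink x).deriv

theorem continuous_kink : Continuous H :=
  continuous_iff_continuousAt.2 fun x => (hU.hasDerivAt_kink x).continuousAt

theorem continuous_deriv_kink : Continuous (deriv H) := by
  rw [hU.deriv_kink]
  exact hU.continuous_sqrt.comp hU.continuous_kink

theorem contDiff_kink : ContDiff ℝ 1 H :=
  contDiff_one_iff_deriv.2
    ⟨fun x => (hU.hasDerivAt_kink x).differentiableAt, hU.continuous_deriv_kink⟩

theorem deriv_kink_sq (x : ℝ) : deriv H x ^ 2 = 2 * U (H x) := by
  rw [hU.deriv_kink, Real.sq_sqrt (by linarith [hU.nonneg (H x)])]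

theorem tendsto_kink_atTop : Tendsto H atTop (𝓝 1) :=
  tendsto_atTop_isLUB hU.kink_strictMono.monotone
    (by rw [hU.range_kink]; exact isLUB_Ioo (by norm_num))

theorem tendsto_kink_atBot : Tendsto H atBot (𝓝 (-1)) :=
  tendsto_atBot_isGLB hU.kink_strictMono.monotone
    (by rw [hU.range_kink]; exact isGLB_Ioo (by norm_num))

theorem potential_kink_abs (x : ℝ) : U (H |x|) = U (H x) := by
  rcases abs_choice x with h | h <;> rw [h]
  rw [hU.kink_neg, hU.even]

theorem hasDerivAt_superpotential_kink (x : ℝ) :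
    HasDerivAt (fun x => W (H x)) (2 * U (H x)) x := by
  convert! (hU.hasDerivAt_superpotential (H x)).comp x (hU.hasDerivAt_kink x) using 1
  rw [Real.mul_self_sqrt (by linarith [hU.nonneg (H x)])]

theorem continuous_superpotential : Continuous W := hU.contDiff_superpotential.continuous

theorem tendsto_superpotential_kink_atTop : Tendsto (fun x => W (H x)) atTop (𝓝 (W 1)) :=
  (hU.continuous_superpotential.tendsto 1).comp hU.tendsto_kink_atTop

theorem tendsto_superpotential_kink_atBot : Tendsto (fun x => W (H x)) atBot (𝓝 (-W 1)) := by
  rw [← hU.superpotential_neg]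
  exact (hU.continuous_superpotential.tendsto (-1)).comp hU.tendsto_kink_atBot

/-- `2U(H)` is the nonnegative derivative of `W ∘ H`, which has a finite limit at `+∞`; oddness of
`H` and evenness of `U` transfer this to the left half-line. -/
theorem integrable_potential_kink : Integrable fun x => U (H x) := by
  have h1 : IntegrableOn (fun x => 2 * U (H x)) (Ioi 0) :=
    integrableOn_Ioi_deriv_of_nonneg' (fun x _ => hU.hasDerivAt_superpotential_kink x)
      (fun x _ => by linarith [hU.nonneg (H x)]) hU.tendsto_superpotential_kink_atTop
  have h2 : IntegrableOn (fun x => 2 * U (H x)) (Iic 0) := by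
    rw [integrableOn_Iic_iff_integrableOn_Iio]
    have := h1.comp_neg
    simpa [hU.kink_neg, hU.even _] using this
  have h3 : Integrable fun x => 2 * U (H x) := by
    rw [← integrableOn_univ, ← Iic_union_Ioi (a := (0 : ℝ))]
    exact h2.union h1
  simpa using h3.const_mul (1 / 2)

theorem integral_potential_kink : ∫ x, 2 * U (H x) = 2 * W 1 := by
  rw [integral_of_hasDerivAt_of_tendsto hU.hasDerivAt_superpotential_kink
    (hU.integrable_potential_kink.const_mul 2) hU.tendsto_superpotential_kink_atBot
    hU.tendsto_superpotential_kink_atTop]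
  ring

theorem integral_potential_kink_compl {L : ℝ} (hL : 0 ≤ L) :
    ∫ x in (Ioc (-L) L)ᶜ, 2 * U (H x) = 2 * (W 1 - W (H L)) := by
  have hi := hU.integrable_potential_kink.const_mul 2
  have h := integral_add_compl (measurableSet_Ioc (a := -L) (b := L)) hi
  rw [hU.integral_potential_kink, ← intervalIntegral.integral_of_le (by linarith),
    intervalIntegral.integral_eq_sub_of_hasDerivAt
      (fun x _ => hU.hasDerivAt_superpotential_kink x) hi.intervalIntegrable, hU.kink_neg,
    hU.superpotential_neg] at h
  linarith

/-- Equipartition: `H'²/2 = U(H)`, so the energy density of the kink is `2U(H) = (W ∘ H)'`, with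
total `W(1) - W(-1)`. -/
theorem potentialEnergy_kink : potentialEnergy U H = ENNReal.ofReal (2 * W 1) := by
  rw [← hU.integral_potential_kink, ofReal_integral_eq_lintegral_ofReal
    (hU.integrable_potential_kink.const_mul 2)
    (Eventually.of_forall fun x => by simpa using hU.nonneg (H x))]
  refine lintegral_congr fun x => ?_
  rw [hU.deriv_kink_sq]
  congr 1
  ring

/-- On the range of the kink, the distance to the closest vacuum is controlled by the potential. -/
theorem exists_one_sub_sq_le : ∃ C : ℝ, 0 < C ∧ ∀ x, (1 - H |x|) ^ 2 ≤ C * U (H x) := by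
  obtain ⟨ρ, h0, h1, h⟩ := hU.exists_sq_le
  -- Within `ρ` of the vacuum quadratic growth applies. On `[0, 1 - ρ]` the potential has a positive
  -- minimum `U z`, and the constant `1 / U z` suffices because the left side is at most `1`.
  obtain ⟨z, hz, hmin⟩ := (isCompact_Icc (a := (0 : ℝ)) (b := 1 - ρ)).exists_isMinOn
    ⟨0, by simp [h1.le]⟩ hU.continuous.continuousOn
  have hz0 : 0 < U z := hU.pos z ⟨by linarith [hz.1], by linarith [hz.2]⟩
  refine ⟨4 + 1 / U z, by positivity, fun x => ?_⟩
  have hx0 : 0 ≤ H |x| := by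
    rw [← hU.kink_zero]
    exact hU.kink_strictMono.monotone (abs_nonneg x)
  have hx1 := (hU.kink_mem |x|).2
  rw [← hU.potential_kink_abs]
  have hp := hU.potential_kink_pos |x|
  rcases le_total (1 - ρ) (H |x|) with hc | hc
  · have := h 1 (Or.inl rfl) (H |x|) (by rw [abs_le]; constructor <;> linarith)
    have h2 : 0 ≤ 1 / U z * U (H |x|) := by positivity
    nlinarith
  · have h2 : U z ≤ U (H |x|) := hmin ⟨hx0, hc⟩
    have h3 : 1 ≤ 1 / U z * U (H |x|) := by
      rw [one_div, inv_mul_eq_div, one_le_div hz0]; exact h2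
    nlinarith

/-- Translates of the kink and of its derivative depend on the shift in a Lipschitz way, with a
bound by the derivative of the kink. -/
theorem exists_kink_translate_le : ∃ K : ℝ, 0 < K ∧ ∀ x h : ℝ, |h| ≤ 1 / (2 * K) →
    |H (x + h) - H x| ≤ 2 * |h| * deriv H x ∧
    |deriv H (x + h) - deriv H x| ≤ 2 * K * |h| * deriv H x := by
  obtain ⟨K, hK0, hK⟩ := hU.exists_sqrt_lipschitz 1
  have hmem : ∀ x, H x ∈ Icc (-1 : ℝ) 1 := fun x => Ioo_subset_Icc_self (hU.kink_mem x)
  have hlip : ∀ x z, |deriv H z - deriv H x| ≤ K * |H z - H x| := fun x z => by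
    rw [hU.deriv_kink]
    exact hK _ (hmem x) _ (hmem z)
  refine ⟨K, hK0, fun x h hh => ?_⟩
  have hnn : ∀ z, 0 ≤ deriv H z := fun z => by rw [hU.deriv_kink]; positivity
  obtain ⟨z, hz, hmax⟩ := (isCompact_uIcc (a := x) (b := x + h)).exists_isMaxOn
    nonempty_uIcc hU.continuous_deriv_kink.continuousOn
  have hmv : ∀ y ∈ uIcc x (x + h), |H y - H x| ≤ deriv H z * |h| := fun y hy => by
    have h1 := Convex.norm_image_sub_le_of_norm_deriv_le (𝕜 := ℝ) (f := H) (C := deriv H z)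
      (fun w _ => (hU.hasDerivAt_kink w).differentiableAt)
      (fun w hw => by rw [Real.norm_eq_abs, abs_of_nonneg (hnn w)]; exact hmax hw)
      (convex_uIcc x (x + h)) left_mem_uIcc hy
    have h2 : |y - x| ≤ |h| := by simpa using abs_sub_left_of_mem_uIcc hy
    exact h1.trans (mul_le_mul_of_nonneg_left h2 (hnn z))
  -- At the maximum point `z` of `H'` between `x` and `x + h`, the Lipschitz bound gives `H'(z) ≤
  -- H'(x) + H'(z)/2`. Absorbing the last term yields `H'(z) ≤ 2 H'(x)`, so that both bounds can be
  -- expressed through `H'(x)`.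
  have h1 := hlip x z
  have h2 := hmv z hz
  have h3 : K * (deriv H z * |h|) ≤ deriv H z / 2 := by
    have : K * |h| ≤ 1 / 2 := by
      rw [le_div_iff₀ (by positivity)] at hh
      linarith
    nlinarith [hnn z]
  have h4 : deriv H z ≤ 2 * deriv H x := by
    have := le_abs_self (deriv H z - deriv H x)
    nlinarith [mul_le_mul_of_nonneg_left h2 hK0.le]
  have h5 : |H (x + h) - H x| ≤ 2 * |h| * deriv H x := by
    refine (hmv _ right_mem_uIcc).trans ?_
    nlinarith [abs_nonneg h]
  exact ⟨h5, (hlip x (x + h)).trans (by nlinarith [mul_le_mul_of_nonneg_left h5 hK0.le])⟩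

end IsPotential

/-! ### Separated positions and pointwise estimates on multi-kinks. -/

theorem exists_splitting_index {n : ℕ} {a : Fin n → ℝ} (ha : Monotone a) (x : ℝ) :
    ∃ m : ℕ, m ≤ n ∧ (∀ j : Fin n, (j : ℕ) < m → a j ≤ x) ∧ ∀ j : Fin n, m ≤ j → x < a j := by
  classical
  have hex : ∃ m : ℕ, ∀ j : Fin n, m ≤ j → x < a j :=
    ⟨n, fun j hj => absurd j.isLt (not_lt.2 hj)⟩
  refine ⟨Nat.find hex, Nat.find_min' hex fun j hj => absurd j.isLt (not_lt.2 hj),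
    fun j hj => ?_, Nat.find_spec hex⟩
  have := Nat.find_min hex hj
  push Not at this
  obtain ⟨i, hji, hi⟩ := this
  exact (ha (Fin.le_def.2 hji)).trans hi

/-- The points `a` are separated by at least `2 L`. -/
def Separated {n : ℕ} (L : ℝ) (a : Fin n → ℝ) : Prop := ∀ i j, i < j → a i + 2 * L ≤ a j

namespace Separated

variable {n : ℕ} {L : ℝ} {a : Fin n → ℝ}

theorem monotone (h : Separated L a) (hL : 0 ≤ L) : Monotone a := fun i j hij => by
  rcases hij.eq_or_lt with rfl | hlt
  · exact le_rfl
  · linarith [h i j hlt]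

theorem away_of_mem (h : Separated L a) {x : ℝ} {k : Fin n}
    (hx : x ∈ Ioc (a k - L) (a k + L)) :
    (∀ j, j < k → a j + L ≤ x) ∧ ∀ j, k < j → x ≤ a j - L :=
  ⟨fun j hj => by linarith [h j k hj, hx.1], fun j hj => by linarith [h k j hj, hx.2]⟩

theorem away_of_notMem (h : Separated L a) (hL : 0 ≤ L) {x : ℝ}
    (hx : ∀ k, x ∉ Ioc (a k - L) (a k + L)) :
    ∃ m : ℕ, m ≤ n ∧ (∀ j : Fin n, (j : ℕ) < m → a j + L ≤ x) ∧
      ∀ j : Fin n, m ≤ j → x ≤ a j - L := by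
  obtain ⟨m, hm, h1, h2⟩ := exists_splitting_index (h.monotone hL) x
  refine ⟨m, hm, fun j hj => ?_, fun j hj => ?_⟩
  · by_contra! hcon
    exact hx j ⟨by_contra fun hn => by linarith [h1 j hj], hcon.le⟩
  · by_contra! hcon
    exact hx j ⟨hcon, by linarith [h2 j hj]⟩

/-- Each term of the sum is at most the whole, so every consecutive gap is at least `2 L`; as gaps
are then nonnegative, this extends to all pairs. -/
theorem of_gapWeight (hL : 0 ≤ L) (h : gapWeight a ≤ Real.exp (-(2 * L))) : Separated L a := by
  have step : ∀ (i : ℕ) (hi : i + 1 < n), a ⟨i, by omega⟩ + 2 * L ≤ a ⟨i + 1, hi⟩ := by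
    intro i hi
    have h1 := (Finset.single_le_sum (f := fun k : Fin (n - 1) =>
      Real.exp (-(a ⟨(k : ℕ) + 1, by have := k.isLt; omega⟩ -
        a ⟨(k : ℕ), by have := k.isLt; omega⟩))) (fun k _ => (Real.exp_pos _).le)
      (Finset.mem_univ (⟨i, by omega⟩ : Fin (n - 1)))).trans h
    rw [Real.exp_le_exp] at h1
    simp only at h1
    linarith
  have main : ∀ (d i : ℕ) (hi : i + d + 1 < n),
      a ⟨i, by omega⟩ + 2 * L ≤ a ⟨i + d + 1, hi⟩ := by
    intro d
    induction d with
    | zero => exact step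
    | succ d ih =>
      intro i hi
      have h1 := ih i (by omega)
      have h2 := step (i + d + 1) (by omega)
      have h3 : a ⟨i + (d + 1) + 1, hi⟩ = a ⟨i + d + 1 + 1, by omega⟩ := rfl
      rw [h3]
      linarith
  intro i j hij
  have hlt : (i : ℕ) < j := hij
  have := main (j - i - 1) i (by omega)
  convert this using 2
  exact Fin.ext (by simp only; omega)

theorem gapWeight_le (h : Separated L a) : gapWeight a ≤ n * Real.exp (-(2 * L)) := by
  calc gapWeight a ≤ ∑ k : Fin (n - 1), Real.exp (-(2 * L)) := by
        refine Finset.sum_le_sum fun k _ => Real.exp_le_exp.2 ?_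
        have := h ⟨k, by have := k.isLt; omega⟩ ⟨k + 1, by have := k.isLt; omega⟩
          (Fin.lt_def.2 (Nat.lt_succ_self _))
        linarith
    _ = ((n - 1 : ℕ) : ℝ) * Real.exp (-(2 * L)) := by simp
    _ ≤ _ := by
        refine mul_le_mul_of_nonneg_right ?_ (Real.exp_pos _).le
        exact_mod_cast Nat.sub_le n 1

end Separated

/-- The multi-kink with each `H(x - a_k) + 1` replaced by its limit, `2` for the first `m` kinks and
`0` for the others. It is the vacuum seen from a point lying between kinks `m` and `m + 1`. -/
theorem alternating_step (n m : ℕ) (hm : m ≤ n) :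
    1 + ∑ k : Fin n, (-1 : ℝ) ^ ((k : ℕ) + 1) * (if (k : ℕ) < m then 2 else 0) = (-1) ^ m := by
  rw [Fin.sum_univ_eq_sum_range (fun k => (-1 : ℝ) ^ (k + 1) * (if k < m then 2 else 0)) n]
  rw [← Finset.sum_subset (Finset.range_subset_range.2 hm) (fun k _ hk => by
    rw [if_neg (by simpa using hk), mul_zero])]
  rw [Finset.sum_congr rfl (g := fun k => (-1 : ℝ) ^ (k + 1) * 2) fun k hk => by
    rw [if_pos (by simpa using hk)]]
  clear hm
  induction m with
  | zero => simp
  | succ m ih => rw [Finset.sum_range_succ, ← add_assoc, ih]; ring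

theorem neg_one_pow_eq (k : ℕ) : (-1 : ℝ) ^ k = 1 ∨ (-1 : ℝ) ^ k = -1 := neg_one_pow_eq_or ℝ k

theorem abs_neg_one_pow_real (k : ℕ) : |(-1 : ℝ) ^ k| = 1 := by simp

namespace IsPotential

variable {U : ℝ → ℝ} (hU : IsPotential U)
include hU

local notation "H" => kink U

variable {n : ℕ} (a : Fin n → ℝ) (x : ℝ)

theorem abs_kink_add_one_sub_left {b : ℝ} (h : b ≤ x) :
    |H (x - b) + 1 - 2| = 1 - H |x - b| := by
  rw [abs_of_nonneg (sub_nonneg.2 h), abs_of_nonpos] <;> linarith [(hU.kink_mem (x - b)).2]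

theorem abs_kink_add_one_right {b : ℝ} (h : x ≤ b) :
    |H (x - b) + 1| = 1 - H |x - b| := by
  rw [abs_of_nonpos (sub_nonpos.2 h), hU.kink_neg, abs_of_nonneg] <;>
    linarith [(hU.kink_mem (x - b)).1]

theorem abs_multiKink_sub_sign_le {m : ℕ} (hm : m ≤ n) (h1 : ∀ j : Fin n, (j : ℕ) < m → a j ≤ x)
    (h2 : ∀ j : Fin n, m ≤ j → x ≤ a j) :
    |multiKink U a x - (-1) ^ m| ≤ ∑ j, (1 - H |x - a j|) := by
  rw [← alternating_step n m hm, multiKink, add_sub_add_left_eq_sub, ← Finset.sum_sub_distrib]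
  refine (Finset.abs_sum_le_sum_abs _ _).trans (Finset.sum_le_sum fun j _ => ?_)
  rw [← mul_sub, abs_mul, abs_neg_one_pow_real, one_mul]
  split_ifs with hj
  · exact (hU.abs_kink_add_one_sub_left x (h1 j hj)).le
  · rw [sub_zero]
    exact (hU.abs_kink_add_one_right x (h2 j (not_lt.1 hj))).le

theorem abs_multiKink_sub_kink_le (k : Fin n) (h1 : ∀ j, j < k → a j ≤ x)
    (h2 : ∀ j, k < j → x ≤ a j) :
    |multiKink U a x - (-1) ^ ((k : ℕ) + 1) * H (x - a k)| ≤
      ∑ j ∈ Finset.univ.erase k, (1 - H |x - a j|) := by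
  have h0 := alternating_step n k k.isLt.le
  have h3 : multiKink U a x - (-1) ^ ((k : ℕ) + 1) * H (x - a k) =
      ∑ j ∈ Finset.univ.erase k, (-1 : ℝ) ^ ((j : ℕ) + 1) *
        (H (x - a j) + 1 - if (j : ℕ) < k then 2 else 0) := by
    simp only [mul_sub, Finset.sum_sub_distrib]
    rw [← Finset.add_sum_erase _ _ (Finset.mem_univ k)] at h0
    rw [multiKink, ← Finset.add_sum_erase _ _ (Finset.mem_univ k)]
    simp only [lt_irrefl, if_false, mul_zero, zero_add] at h0
    rw [pow_succ]
    linarith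
  rw [h3]
  refine (Finset.abs_sum_le_sum_abs _ _).trans (Finset.sum_le_sum fun j hj => ?_)
  rw [abs_mul, abs_neg_one_pow_real, one_mul]
  have hne := Finset.ne_of_mem_erase hj
  split_ifs with hlt
  · exact (hU.abs_kink_add_one_sub_left x (h1 j hlt)).le
  · rw [sub_zero]
    exact (hU.abs_kink_add_one_right x (h2 j (lt_of_le_of_ne (not_lt.1 hlt) hne.symm))).le

theorem hasDerivAt_multiKink : HasDerivAt (multiKink U a)
    (∑ k : Fin n, (-1 : ℝ) ^ ((k : ℕ) + 1) * deriv H (x - a k)) x := by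
  refine (HasDerivAt.fun_sum (u := Finset.univ) fun k _ => ?_).const_add 1
  refine HasDerivAt.const_mul _ (HasDerivAt.add_const _ ?_)
  rw [hU.deriv_kink]
  exact (hU.hasDerivAt_kink (x - a k)).comp_sub_const x (a k)

theorem deriv_multiKink : deriv (multiKink U a) =
    fun x => ∑ k : Fin n, (-1 : ℝ) ^ ((k : ℕ) + 1) * deriv H (x - a k) :=
  funext fun x => (hU.hasDerivAt_multiKink a x).deriv

theorem contDiff_multiKink : ContDiff ℝ 1 (multiKink U a) := by
  have := hU.contDiff_kink
  unfold multiKink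
  fun_prop

theorem deriv_kink_nonneg (y : ℝ) : 0 ≤ deriv H y := by rw [hU.deriv_kink]; positivity

theorem abs_deriv_multiKink_le : |deriv (multiKink U a) x| ≤ ∑ j, deriv H (x - a j) := by
  rw [hU.deriv_multiKink]
  refine (Finset.abs_sum_le_sum_abs _ _).trans_eq (Finset.sum_congr rfl fun j _ => ?_)
  rw [abs_mul, abs_neg_one_pow_real, one_mul, abs_of_nonneg (hU.deriv_kink_nonneg _)]

theorem abs_deriv_multiKink_sub_le (k : Fin n) :
    |deriv (multiKink U a) x - (-1) ^ ((k : ℕ) + 1) * deriv H (x - a k)| ≤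
      ∑ j ∈ Finset.univ.erase k, deriv H (x - a j) := by
  rw [hU.deriv_multiKink]
  dsimp only
  rw [← Finset.add_sum_erase _ _ (Finset.mem_univ k), add_sub_cancel_left]
  refine (Finset.abs_sum_le_sum_abs _ _).trans_eq (Finset.sum_congr rfl fun j _ => ?_)
  rw [abs_mul, abs_neg_one_pow_real, one_mul, abs_of_nonneg (hU.deriv_kink_nonneg _)]

/-- Pointwise control of a multi-kink by the potential energy densities of the distant kinks. -/
theorem exists_multiKink_sq_le : ∃ C : ℝ, 0 < C ∧
    ∀ (n : ℕ) (a : Fin n → ℝ) (x : ℝ),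
    (∀ m ≤ n, (∀ j : Fin n, (j : ℕ) < m → a j ≤ x) → (∀ j : Fin n, m ≤ j → x ≤ a j) →
      (multiKink U a x - (-1) ^ m) ^ 2 ≤ C * n * ∑ j, U (kink U (x - a j))) ∧
    (deriv (multiKink U a) x ^ 2 ≤ C * n * ∑ j, U (kink U (x - a j))) ∧
    ∀ k : Fin n, (∀ j, j < k → a j ≤ x) → (∀ j, k < j → x ≤ a j) →
      (multiKink U a x - (-1) ^ ((k : ℕ) + 1) * kink U (x - a k)) ^ 2 ≤
        C * n * ∑ j ∈ Finset.univ.erase k, U (kink U (x - a j)) ∧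
      (deriv (multiKink U a) x - (-1) ^ ((k : ℕ) + 1) * deriv (kink U) (x - a k)) ^ 2 ≤
        C * n * ∑ j ∈ Finset.univ.erase k, U (kink U (x - a j)) := by
  obtain ⟨C, hC0, hC⟩ := hU.exists_one_sub_sq_le
  have hCm : 0 < max C 2 := lt_max_of_lt_left hC0
  refine ⟨max C 2, hCm, fun n a x => ?_⟩
  -- Cauchy–Schwarz over at most `n` terms, applied with `f y = 1 - H |y|` and with `f = H'`, whose
  -- squares are both dominated by `U(H)`.
  have key : ∀ (s : Finset (Fin n)) (f : ℝ → ℝ) (z : ℝ),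
      (∀ y, f y ^ 2 ≤ max C 2 * U (kink U y)) → |z| ≤ ∑ j ∈ s, f (x - a j) →
      z ^ 2 ≤ max C 2 * n * ∑ j ∈ s, U (kink U (x - a j)) := by
    intro s f z hf hz
    calc z ^ 2 = |z| ^ 2 := (sq_abs z).symm
      _ ≤ (∑ j ∈ s, f (x - a j)) ^ 2 := pow_le_pow_left₀ (abs_nonneg z) hz 2
      _ ≤ (s.card : ℝ) * ∑ j ∈ s, f (x - a j) ^ 2 := sq_sum_le_card_mul_sum_sq
      _ ≤ n * ∑ j ∈ s, max C 2 * U (kink U (x - a j)) := by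
          refine mul_le_mul ?_ (Finset.sum_le_sum fun j _ => hf _)
            (Finset.sum_nonneg fun j _ => sq_nonneg _) (Nat.cast_nonneg n)
          exact_mod_cast (Finset.card_le_univ s).trans_eq (Fintype.card_fin n)
      _ = _ := by rw [← Finset.mul_sum]; ring
  have hq : ∀ y, (1 - kink U |y|) ^ 2 ≤ max C 2 * U (kink U y) := fun y =>
    (hC y).trans (mul_le_mul_of_nonneg_right (le_max_left _ _) (hU.nonneg _))
  have hd : ∀ y, deriv (kink U) y ^ 2 ≤ max C 2 * U (kink U y) := fun y => by
    rw [hU.deriv_kink_sq]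
    exact mul_le_mul_of_nonneg_right (le_max_right _ _) (hU.nonneg _)
  exact ⟨fun m hm h1 h2 => key _ _ _ hq (hU.abs_multiKink_sub_sign_le a x hm h1 h2),
    key _ _ _ hd (hU.abs_deriv_multiKink_le a x), fun k h1 h2 =>
    ⟨key _ _ _ hq (hU.abs_multiKink_sub_kink_le a x k h1 h2),
      key _ _ _ hd (hU.abs_deriv_multiKink_sub_le a x k)⟩⟩

end IsPotential

/-! ### The Bogomolny identity and stability of the first-order equation. -/

/-- The density of the potential energy. -/
noncomputable def density (U u : ℝ → ℝ) (x : ℝ) : ℝ := 1 / 2 * deriv u x ^ 2 + U (u x)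

/-- The square of the defect of `u` in the Bogomolny equation `u' = s √(2 U(u))`. -/
noncomputable def defectSq (U u : ℝ → ℝ) (s : ℝ) (x : ℝ) : ℝ := (deriv u x - s * √(2 * U (u x))) ^ 2

theorem defectSq_nonneg (U u : ℝ → ℝ) (s x : ℝ) : 0 ≤ defectSq U u s x := sq_nonneg _

theorem sq_eq_one_of_sign {s : ℝ} (hs : s = 1 ∨ s = -1) : s ^ 2 = 1 := by
  rcases hs with rfl | rfl <;> norm_num

/-- A Gronwall inequality for absolutely continuous functions, covering both time directions
according to the sign of `σ`. -/
theorem LocAC.gronwall_sq {w v : ℝ → ℝ} {K : ℝ} (hK : 0 ≤ K) (hw : LocAC w) {p q : ℝ} (hpq : p ≤ q)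
    (hv : IntervalIntegrable (fun x => v x ^ 2) volume p q)
    (h : ∀ᵐ x, x ∈ Icc p q → |deriv w x| ≤ K * |w x| + |v x|) {σ : ℝ} (hσ : σ = 1 ∨ σ = -1) :
    σ * w q ^ 2 * Real.exp (-(σ * (2 * K + 1) * q)) -
      σ * w p ^ 2 * Real.exp (-(σ * (2 * K + 1) * p)) ≤
      ∫ x in p..q, v x ^ 2 * Real.exp (-(σ * (2 * K + 1) * x)) := by
  -- In the derivative of `w²`, the terms `2 K w²` and `2 |w| |v| ≤ w² + v²` produce the factor `2K
  -- + 1` on `w²`, which the exponential weight cancels.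
  have hF : LocAC fun x => σ * w x ^ 2 * Real.exp (-(σ * (2 * K + 1) * x)) :=
    (hw.comp (F := fun y => σ * y ^ 2) (by fun_prop)).mul (LocAC.of_contDiff (by fun_prop))
  refine hF.sub_le_integral hpq (hv.mul_continuousOn (by fun_prop)) ?_
  filter_upwards [hw.ae_differentiableAt, h] with x hx hxb hxm
  have hd : HasDerivAt (fun x => σ * w x ^ 2 * Real.exp (-(σ * (2 * K + 1) * x)))
      (σ * (2 * w x * deriv w x) * Real.exp (-(σ * (2 * K + 1) * x)) +
        σ * w x ^ 2 * (Real.exp (-(σ * (2 * K + 1) * x)) * -(σ * (2 * K + 1)))) x := by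
    have h1 : HasDerivAt (fun x => σ * w x ^ 2) (σ * (2 * w x * deriv w x)) x := by
      simpa using (hx.hasDerivAt.fun_pow 2).const_mul σ
    have h2 : HasDerivAt (fun x => -(σ * (2 * K + 1) * x)) (-(σ * (2 * K + 1))) x := by
      simpa using ((hasDerivAt_id x).const_mul (σ * (2 * K + 1))).fun_neg
    exact h1.mul h2.exp
  rw [hd.deriv]
  have hs := sq_eq_one_of_sign hσ
  have e : σ * (2 * w x * deriv w x) * Real.exp (-(σ * (2 * K + 1) * x)) +
        σ * w x ^ 2 * (Real.exp (-(σ * (2 * K + 1) * x)) * -(σ * (2 * K + 1))) =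
      (2 * (σ * w x * deriv w x) - (2 * K + 1) * w x ^ 2 * σ ^ 2) *
        Real.exp (-(σ * (2 * K + 1) * x)) := by ring
  rw [e, hs, mul_one]
  refine mul_le_mul_of_nonneg_right ?_ (Real.exp_pos _).le
  have h1 : σ * w x * deriv w x ≤ |w x| * |deriv w x| := by
    have : |σ| = 1 := by rcases hσ with rfl | rfl <;> simp
    calc σ * w x * deriv w x ≤ |σ * w x * deriv w x| := le_abs_self _
      _ = _ := by rw [abs_mul, abs_mul, this, one_mul]
  have h2 := mul_le_mul_of_nonneg_left (hxb hxm) (abs_nonneg (w x))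
  nlinarith [sq_abs (w x), sq_abs (v x), sq_nonneg (|w x| - |v x|)]

namespace IsPotential

variable {U : ℝ → ℝ} (hU : IsPotential U)
include hU

local notation "W" => superpotential U
local notation "H" => kink U

theorem density_nonneg (u : ℝ → ℝ) (x : ℝ) : 0 ≤ density U u x := by
  have := hU.nonneg (u x)
  unfold density
  positivity

theorem apply_sign_mul {s : ℝ} (hs : s = 1 ∨ s = -1) (y : ℝ) : U (s * y) = U y := by
  rcases hs with rfl | rfl
  · rw [one_mul]
  · rw [neg_one_mul, hU.even]

theorem superpotential_sign_mul {s : ℝ} (hs : s = 1 ∨ s = -1) (y : ℝ) : W (s * y) = s * W y := by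
  rcases hs with rfl | rfl
  · rw [one_mul, one_mul]
  · rw [neg_one_mul, neg_one_mul, hU.superpotential_neg]

theorem integrable_deriv_sq {u : ℝ → ℝ} (hi : Integrable (density U u)) :
    Integrable fun x => deriv u x ^ 2 := by
  refine (hi.const_mul 2).mono' ((measurable_deriv u).pow_const 2).aestronglyMeasurable
    (Eventually.of_forall fun x => ?_)
  rw [Real.norm_of_nonneg (sq_nonneg _)]
  unfold density
  linarith [hU.nonneg (u x)]

variable {u : ℝ → ℝ} (hu : LocAC u) (hi : Integrable (density U u))
include hu hi

theorem integrable_potential : Integrable fun x => U (u x) := by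
  refine hi.mono' (hU.continuous.comp hu.continuous).aestronglyMeasurable
    (Eventually.of_forall fun x => ?_)
  rw [Real.norm_of_nonneg (hU.nonneg _)]
  unfold density
  linarith [sq_nonneg (deriv u x)]

theorem integrable_defectSq {s : ℝ} (hs : s = 1 ∨ s = -1) : Integrable (defectSq U u s) := by
  refine (hi.const_mul 4).mono' ?_ (Eventually.of_forall fun x => ?_)
  · exact (((measurable_deriv u).sub ((hU.continuous_sqrt.comp hu.continuous).measurable.const_mul
      s)).pow_const 2).aestronglyMeasurable
  · rw [Real.norm_of_nonneg (defectSq_nonneg U u s x)]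
    have h1 := Real.sq_sqrt (show 0 ≤ 2 * U (u x) by linarith [hU.nonneg (u x)])
    have h2 := sq_eq_one_of_sign hs
    unfold density defectSq
    have h3 : (s * √(2 * U (u x))) ^ 2 = 2 * U (u x) := by rw [mul_pow, h1, h2, one_mul]
    nlinarith [sq_nonneg (deriv u x + s * √(2 * U (u x)))]

/-- The Bogomolny identity. -/
theorem integral_density_eq {s : ℝ} (hs : s = 1 ∨ s = -1) (p q : ℝ) :
    ∫ x in p..q, density U u x =
      1 / 2 * (∫ x in p..q, defectSq U u s x) + s * (W (u q) - W (u p)) := by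
  rw [← hu.integral_deriv_comp hU.contDiff_superpotential p q,
    ← intervalIntegral.integral_const_mul, ← intervalIntegral.integral_const_mul,
    ← intervalIntegral.integral_add]
  · refine intervalIntegral.integral_congr fun x _ => ?_
    have h1 := Real.sq_sqrt (show 0 ≤ 2 * U (u x) by linarith [hU.nonneg (u x)])
    have h2 := sq_eq_one_of_sign hs
    simp only [density, defectSq, hU.deriv_superpotential]
    linear_combination -(1 / 2) * √(2 * U (u x)) ^ 2 * h2 - (1 / 2) * h1
  · exact ((hU.integrable_defectSq hu hi hs).const_mul _).intervalIntegrable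
  · refine IntervalIntegrable.const_mul ?_ s
    refine (hu.intervalIntegrable_deriv p q).continuousOn_mul ?_
    rw [hU.deriv_superpotential]
    exact (hU.continuous_sqrt.comp hu.continuous).continuousOn

theorem sign_mul_superpotential_sub_le {s : ℝ} (hs : s = 1 ∨ s = -1) {p q : ℝ} (hpq : p ≤ q) :
    s * (W (u q) - W (u p)) ≤ ∫ x in p..q, density U u x := by
  rw [hU.integral_density_eq hu hi hs]
  have := intervalIntegral.integral_nonneg (μ := volume) hpq fun x _ => defectSq_nonneg U u s x
  linarith

/-- The two signs in the Bogomolny bound control the variation of `W ∘ u` from both sides: where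
there is little energy, `u` cannot leave the neighbourhood of a vacuum. -/
theorem abs_superpotential_sub_le (p q : ℝ) :
    |W (u q) - W (u p)| ≤ ∫ x in uIoc p q, density U u x := by
  wlog hpq : p ≤ q generalizing p q
  · rw [abs_sub_comm, uIoc_comm]
    exact this q p (le_of_not_ge hpq)
  rw [uIoc_of_le hpq, ← intervalIntegral.integral_of_le hpq, abs_le]
  have h1 := hU.sign_mul_superpotential_sub_le hu hi (Or.inl rfl) hpq
  have h2 := hU.sign_mul_superpotential_sub_le hu hi (Or.inr rfl) hpq
  constructor <;> linarith

/-- From `|u'| ≤ u'²/2 + 1`. Starting at a zero of `u`, this confines `u` to a compact interval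
depending only on the energy and the distance, which makes the Lipschitz constant of `√(2U)` uniform
over states. -/
theorem abs_sub_le_of_density {p q : ℝ} : |u q - u p| ≤ (∫ x, density U u x) + |q - p| := by
  wlog hpq : p ≤ q generalizing p q
  · rw [abs_sub_comm, abs_sub_comm q]
    exact this (le_of_not_ge hpq)
  have hint : IntervalIntegrable (fun x => density U u x + 1) volume p q :=
    hi.intervalIntegrable.add (by simp)
  calc |u q - u p| = ‖∫ x in p..q, deriv u x‖ := by rw [hu.integral_deriv, Real.norm_eq_abs]
    _ ≤ ∫ x in p..q, ‖deriv u x‖ := intervalIntegral.norm_integral_le_integral_norm hpq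
    _ ≤ ∫ x in p..q, (density U u x + 1) := by
        refine intervalIntegral.integral_mono_on hpq (hu.intervalIntegrable_deriv p q).norm hint
          fun x _ => ?_
        have := hU.nonneg (u x)
        rw [Real.norm_eq_abs, density, ← sq_abs]
        nlinarith [sq_nonneg (|deriv u x| - 1)]
    _ = (∫ x in p..q, density U u x) + (q - p) := by
        rw [intervalIntegral.integral_add hi.intervalIntegrable (by simp)]; simp
    _ ≤ _ := by
        rw [abs_of_nonneg (sub_nonneg.2 hpq), intervalIntegral.integral_of_le hpq]
        have := setIntegral_le_integral (s := Ioc p q) hi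
          (Eventually.of_forall (hU.density_nonneg u))
        linarith

end IsPotential

/-- Near one of its zeros, a state with small Bogomolny defect is close to a kink. -/
theorem IsPotential.exists_close_to_kink {U : ℝ → ℝ} (hU : IsPotential U) (E₀ L : ℝ) :
    ∃ C : ℝ, 0 < C ∧ ∀ (u : ℝ → ℝ), LocAC u → Integrable (density U u) →
      (∫ x, density U u x) ≤ E₀ → ∀ s : ℝ, s = 1 ∨ s = -1 → ∀ p b q, b ∈ Icc p q → u b = 0 →
      (∀ x ∈ Icc p q, |x - b| ≤ L →
        (u x - s * kink U (x - b)) ^ 2 ≤ C * ∫ y in p..q, defectSq U u s y) ∧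
      ∀ᵐ x, x ∈ Icc p q → |x - b| ≤ L →
        (deriv u x - s * deriv (kink U) (x - b)) ^ 2 ≤
          (C * ∫ y in p..q, defectSq U u s y) + 2 * defectSq U u s x := by
  -- The interval must contain the values `±H` and those of a state of energy at most `E₀` within
  -- distance `L` of its zero.
  obtain ⟨K, hK0, hK⟩ := hU.exists_sqrt_lipschitz (max 1 (E₀ + L))
  set κ := 2 * K + 1 with hκ
  set A := Real.exp (κ * L) with hA
  have hA0 : 0 < A := Real.exp_pos _
  refine ⟨A + 2 * K ^ 2 * A, by positivity, fun u hu hi hE s hs p b q hb hub => ?_⟩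
  have hs2 := sq_eq_one_of_sign hs
  have hsabs : |s| = 1 := by rcases hs with rfl | rfl <;> simp
  have hd := hU.integrable_defectSq hu hi hs
  have hkAC : LocAC fun x => s * kink U (x - b) :=
    LocAC.of_contDiff (by have := hU.contDiff_kink; fun_prop)
  have hkd : ∀ x, HasDerivAt (fun x => s * kink U (x - b)) (s * deriv (kink U) (x - b)) x :=
    fun x => by
      rw [hU.deriv_kink]
      exact ((hU.hasDerivAt_kink (x - b)).comp_sub_const x b).const_mul s
  set w := fun x => u x - s * kink U (x - b) with hw
  have hwAC : LocAC w := hu.sub hkAC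
  have hwb : w b = 0 := by simp [hw, hub, hU.kink_zero]
  set v := fun x => deriv u x - s * √(2 * U (u x)) with hv
  have hwd : ∀ᵐ x, |x - b| ≤ L →
      deriv w x = deriv u x - s * deriv (kink U) (x - b) ∧ |deriv w x| ≤ K * |w x| + |v x| := by
    filter_upwards [hu.ae_differentiableAt] with x hx hxL
    have h1 : deriv w x = deriv u x - s * deriv (kink U) (x - b) :=
      (hx.hasDerivAt.fun_sub (hkd x)).deriv
    refine ⟨h1, ?_⟩
    -- Both `u` and `s H(· - b)` solve `y' = s √(2U(y))`, the former up to the defect `v`, and they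
    -- agree at `b`; Gronwall applies to the difference.
    have h2 : deriv w x = s * (√(2 * U (u x)) - √(2 * U (s * kink U (x - b)))) + v x := by
      rw [h1, hv, hU.deriv_kink, hU.apply_sign_mul hs]; ring
    have hux : |u x| ≤ max 1 (E₀ + L) := by
      have := hU.abs_sub_le_of_density hu hi (p := b) (q := x)
      rw [hub, sub_zero] at this
      exact le_max_of_le_right (by linarith)
    have hkx : |s * kink U (x - b)| ≤ max 1 (E₀ + L) := by
      rw [abs_mul, hsabs, one_mul]
      exact le_max_of_le_left (hU.kink_abs_lt _).le
    rw [h2]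
    refine (abs_add_le _ _).trans (add_le_add_left ?_ _)
    rw [abs_mul, hsabs, one_mul]
    exact hK _ (abs_le.1 hkx) _ (abs_le.1 hux)
  have hsub : ∀ {y z}, p ≤ y → y ≤ z → z ≤ q →
      ∫ x in y..z, v x ^ 2 ≤ ∫ x in p..q, defectSq U u s x := fun h1 h2 h3 =>
    intervalIntegral.integral_mono_interval h1 h2 h3
      (Eventually.of_forall fun x => sq_nonneg _) hd.intervalIntegrable
  have hD0 : 0 ≤ ∫ x in p..q, defectSq U u s x :=
    intervalIntegral.integral_nonneg (hb.1.trans hb.2) fun x _ => defectSq_nonneg U u s x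
  have main : ∀ x ∈ Icc p q, |x - b| ≤ L → w x ^ 2 ≤ A * ∫ y in p..q, defectSq U u s y := by
    intro x hx hxL
    have hxL' := abs_le.1 hxL
    -- Gronwall runs away from the zero `b`, to the right with `σ = 1` and to the left with `σ =
    -- -1`.
    rcases le_total b x with hbx | hbx
    · have h1 := hwAC.gronwall_sq hK0.le hbx (v := v) hd.intervalIntegrable (by
        filter_upwards [hwd] with y hy hym
        refine (hy ?_).2
        rw [abs_le]; constructor <;> linarith [hym.1, hym.2]) (Or.inl rfl)
      have h2 : ∫ y in b..x, v y ^ 2 * Real.exp (-(1 * (2 * K + 1) * y)) ≤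
          (∫ y in p..q, defectSq U u s y) * Real.exp (-(1 * (2 * K + 1) * b)) := by
        refine le_trans ?_ (mul_le_mul_of_nonneg_right (hsub hb.1 hbx hx.2) (Real.exp_pos _).le)
        rw [← intervalIntegral.integral_mul_const]
        refine intervalIntegral.integral_mono_on hbx
          (hd.intervalIntegrable.mul_continuousOn (by fun_prop))
          (hd.intervalIntegrable.mul_const _) fun y hy => ?_
        refine mul_le_mul_of_nonneg_left (Real.exp_le_exp.2 ?_) (sq_nonneg _)
        nlinarith [hy.1]
      rw [hwb] at h1
      have h3 : w x ^ 2 * Real.exp (-(κ * x)) ≤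
          (∫ y in p..q, defectSq U u s y) * Real.exp (-(κ * b)) := by
        simp only [one_mul] at h1 h2
        linarith
      have h4 : w x ^ 2 ≤ (∫ y in p..q, defectSq U u s y) * Real.exp (κ * (x - b)) := by
        have := mul_le_mul_of_nonneg_right h3 (Real.exp_pos (κ * x)).le
        rw [mul_assoc, mul_assoc, ← Real.exp_add, ← Real.exp_add, neg_add_cancel, Real.exp_zero,
          mul_one] at this
        rwa [show -(κ * b) + κ * x = κ * (x - b) by ring] at this
      refine h4.trans ?_
      rw [mul_comm]
      refine mul_le_mul_of_nonneg_right (Real.exp_le_exp.2 ?_) hD0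
      exact mul_le_mul_of_nonneg_left hxL'.2 (by positivity)
    · have h1 := hwAC.gronwall_sq hK0.le hbx (v := v) hd.intervalIntegrable (by
        filter_upwards [hwd] with y hy hym
        refine (hy ?_).2
        rw [abs_le]; constructor <;> linarith [hym.1, hym.2]) (Or.inr rfl)
      have h2 : ∫ y in x..b, v y ^ 2 * Real.exp (-(-1 * (2 * K + 1) * y)) ≤
          (∫ y in p..q, defectSq U u s y) * Real.exp (-(-1 * (2 * K + 1) * b)) := by
        refine le_trans ?_ (mul_le_mul_of_nonneg_right (hsub hx.1 hbx hb.2) (Real.exp_pos _).le)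
        rw [← intervalIntegral.integral_mul_const]
        refine intervalIntegral.integral_mono_on hbx
          (hd.intervalIntegrable.mul_continuousOn (by fun_prop))
          (hd.intervalIntegrable.mul_const _) fun y hy => ?_
        refine mul_le_mul_of_nonneg_left (Real.exp_le_exp.2 ?_) (sq_nonneg _)
        nlinarith [hy.2]
      rw [hwb] at h1
      have h3 : w x ^ 2 * Real.exp (κ * x) ≤
          (∫ y in p..q, defectSq U u s y) * Real.exp (κ * b) := by
        simp only [neg_mul, one_mul, neg_neg] at h1 h2
        linarith
      have h4 : w x ^ 2 ≤ (∫ y in p..q, defectSq U u s y) * Real.exp (κ * (b - x)) := by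
        have := mul_le_mul_of_nonneg_right h3 (Real.exp_pos (-(κ * x))).le
        rw [mul_assoc, mul_assoc, ← Real.exp_add, ← Real.exp_add, add_neg_cancel, Real.exp_zero,
          mul_one] at this
        rwa [show κ * b + -(κ * x) = κ * (b - x) by ring] at this
      refine h4.trans ?_
      rw [mul_comm]
      refine mul_le_mul_of_nonneg_right (Real.exp_le_exp.2 ?_) hD0
      exact mul_le_mul_of_nonneg_left (by linarith [hxL'.1]) (by positivity)
  refine ⟨fun x hx hxL => (main x hx hxL).trans ?_, ?_⟩
  · refine mul_le_mul_of_nonneg_right ?_ hD0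
    have : 0 ≤ 2 * K ^ 2 * A := by positivity
    linarith
  · filter_upwards [hwd] with x hx hxm hxL
    obtain ⟨e, hle⟩ := hx hxL
    rw [← e, ← sq_abs]
    have h1 := main x hxm hxL
    have h2 : |deriv w x| ^ 2 ≤ (K * |w x| + |v x|) ^ 2 := pow_le_pow_left₀ (abs_nonneg _) hle 2
    have h3 : (K * |w x| + |v x|) ^ 2 ≤ 2 * K ^ 2 * w x ^ 2 + 2 * v x ^ 2 := by
      nlinarith [sq_nonneg (K * |w x| - |v x|), sq_abs (w x), sq_abs (v x)]
    have h4 : defectSq U u s x = v x ^ 2 := rfl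
    have h5 := mul_le_mul_of_nonneg_left h1 (by positivity : 0 ≤ 2 * K ^ 2)
    have h6 := mul_nonneg hA0.le hD0
    rw [h4]
    nlinarith

/-! ### From defects and outer energy to the distance from a multi-kink. -/

namespace IsPotential

variable {U : ℝ → ℝ} (hU : IsPotential U)
include hU

local notation "W" => superpotential U
local notation "H" => kink U

theorem integral_compl_window_potential_kink {L : ℝ} (hL : 0 ≤ L) (b : ℝ) :
    ∫ x, (Ioc (b - L) (b + L))ᶜ.indicator (fun x => U (H (x - b))) x = W 1 - W (H L) := by
  have h1 : (fun x => (Ioc (b - L) (b + L))ᶜ.indicator (fun x => U (H (x - b))) x) =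
      fun x => (Ioc (-L) L)ᶜ.indicator (fun x => U (H x)) (x - b) := by
    funext x
    by_cases hx : x ∈ Ioc (b - L) (b + L)
    · rw [indicator_of_notMem (by simpa using hx), indicator_of_notMem]
      simp only [mem_compl_iff, mem_Ioc, not_not] at hx ⊢
      constructor <;> linarith [hx.1, hx.2]
    · rw [indicator_of_mem hx, indicator_of_mem]
      intro hx'
      exact hx ⟨by linarith [hx'.1], by linarith [hx'.2]⟩
  have h2 := hU.integral_potential_kink_compl hL
  rw [integral_const_mul] at h2
  rw [h1, integral_sub_right_eq_self (fun x => (Ioc (-L) L)ᶜ.indicator (fun x => U (H x)) x) b,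
    integral_indicator measurableSet_Ioc.compl]
  linarith

theorem integrable_compl_window_potential_kink (L b : ℝ) :
    Integrable ((Ioc (b - L) (b + L))ᶜ.indicator (fun x => U (H (x - b)))) :=
  (hU.integrable_potential_kink.comp_sub_right b).indicator measurableSet_Ioc.compl

/-- The `H¹` distance of a state to a multi-kink is controlled by the Bogomolny defects near the
kinks and by the energy far from the kinks. -/
theorem lintegral_sub_multiKink_le {C₁ C₂ ρ c L D E₀ : ℝ} (hL : 0 < L) {n : ℕ}
    (hC₁ : ∀ (n : ℕ) (a : Fin n → ℝ) (x : ℝ),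
      (∀ m ≤ n, (∀ j : Fin n, (j : ℕ) < m → a j ≤ x) → (∀ j : Fin n, m ≤ j → x ≤ a j) →
        (multiKink U a x - (-1) ^ m) ^ 2 ≤ C₁ * n * ∑ j, U (H (x - a j))) ∧
      (deriv (multiKink U a) x ^ 2 ≤ C₁ * n * ∑ j, U (H (x - a j))) ∧
      ∀ k : Fin n, (∀ j, j < k → a j ≤ x) → (∀ j, k < j → x ≤ a j) →
        (multiKink U a x - (-1) ^ ((k : ℕ) + 1) * H (x - a k)) ^ 2 ≤
          C₁ * n * ∑ j ∈ Finset.univ.erase k, U (H (x - a j)) ∧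
        (deriv (multiKink U a) x - (-1) ^ ((k : ℕ) + 1) * deriv H (x - a k)) ^ 2 ≤
          C₁ * n * ∑ j ∈ Finset.univ.erase k, U (H (x - a j)))
    (hC₁0 : 0 < C₁) (hC₂0 : 0 < C₂)
    (hC₂ : ∀ (u : ℝ → ℝ), LocAC u → Integrable (density U u) →
      (∫ x, density U u x) ≤ E₀ → ∀ s : ℝ, s = 1 ∨ s = -1 → ∀ p b q, b ∈ Icc p q → u b = 0 →
      (∀ x ∈ Icc p q, |x - b| ≤ L →
        (u x - s * H (x - b)) ^ 2 ≤ C₂ * ∫ y in p..q, defectSq U u s y) ∧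
      ∀ᵐ x, x ∈ Icc p q → |x - b| ≤ L →
        (deriv u x - s * deriv H (x - b)) ^ 2 ≤
          (C₂ * ∫ y in p..q, defectSq U u s y) + 2 * defectSq U u s x)
    (hρ : ∀ s : ℝ, s = 1 ∨ s = -1 → ∀ y, |y - s| ≤ ρ → (y - s) ^ 2 ≤ 4 * U y)
    (hc : ∀ s : ℝ, s = 1 ∨ s = -1 → ∀ y, |W y - W s| < c → |y - s| < ρ)
    {u : ℝ → ℝ} (hu : LocAC u) (hi : Integrable (density U u)) (hE : (∫ x, density U u x) ≤ E₀)
    {b : Fin n → ℝ} {X : ℕ → ℝ}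
    (hwin : ∀ k : Fin n, X k ≤ b k - L ∧ b k + L ≤ X (k + 1)) (hb : ∀ k, u (b k) = 0)
    (hsep : Separated L b)
    (hout : ∀ m ≤ n, |W (u (X m)) - W ((-1) ^ m)| +
      (∫ x in (⋃ k, Ioc (b k - L) (b k + L))ᶜ, density U u x) < c)
    (hD : ∀ k : Fin n, (∫ x in X k..X (k + 1), defectSq U u ((-1) ^ ((k : ℕ) + 1)) x) ≤ D) :
    ∫⁻ x, ENNReal.ofReal ((u x - multiKink U b x) ^ 2 +
        (deriv u x - deriv (multiKink U b) x) ^ 2) ≤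
      ENNReal.ofReal (8 * (∫ x in (⋃ k, Ioc (b k - L) (b k + L))ᶜ, density U u x) +
        n * (8 * L * C₂ * D + 4 * D) + 4 * C₁ * n * (n * (W 1 - W (H L)))) := by
  set R : Fin n → Set ℝ := fun k => Ioc (b k - L) (b k + L) with hR
  set O : Set ℝ := (⋃ k, R k)ᶜ with hO
  have hRm : ∀ k, MeasurableSet (R k) := fun k => measurableSet_Ioc
  have hOm : MeasurableSet O := (MeasurableSet.iUnion hRm).compl
  set sg : Fin n → ℝ := fun k => (-1) ^ ((k : ℕ) + 1) with hsg
  have hsgn : ∀ k, sg k = 1 ∨ sg k = -1 := fun k => neg_one_pow_eq _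
  set e : Fin n → ℝ → ℝ := fun j => (R j)ᶜ.indicator fun x => U (H (x - b j)) with he
  have he0 : ∀ j x, 0 ≤ e j x := fun j x => indicator_nonneg (fun x _ => hU.nonneg _) x
  set d : Fin n → ℝ → ℝ := fun k =>
    (R k).indicator fun x => 4 * C₂ * D + 4 * defectSq U u (sg k) x with hd
  have hbmem : ∀ k : Fin n, b k ∈ Icc (X k) (X (k + 1)) := fun k =>
    ⟨by linarith [(hwin k).1], by linarith [(hwin k).2]⟩
  have hXle : ∀ k : Fin n, X k ≤ X (k + 1) := fun k => (hbmem k).1.trans (hbmem k).2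
  have hD0 : ∀ k : Fin n, 0 ≤ D := fun k =>
    (intervalIntegral.integral_nonneg (hXle k) fun x _ => defectSq_nonneg U u (sg k) x).trans (hD k)
  have hd0 : ∀ k x, 0 ≤ d k x := fun k x => indicator_nonneg (fun x _ => by
    have := defectSq_nonneg U u (sg k) x
    have := hD0 k
    positivity) x
  -- An integrable majorant of the squared distance. The constants come from `(p - q)² ≤ 2p² + 2q²`
  -- applied around a common reference: the nearest vacuum outside the windows, the signed kink
  -- inside one. The terms `e j` carry the tail of kink `j` outside its own window.
  set Φ : ℝ → ℝ := fun x => O.indicator (fun x => 8 * density U u x) x + ∑ k, d k x +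
    4 * C₁ * n * ∑ j, e j x with hΦ
  have hdi : ∀ k, Integrable (d k) := fun k => by
    rw [hd, integrable_indicator_iff (hRm k)]
    exact (integrableOn_const (by simp [hR])).add
      ((hU.integrable_defectSq hu hi (hsgn k)).const_mul 4).integrableOn
  have hei : ∀ j, Integrable (e j) := fun j => hU.integrable_compl_window_potential_kink L (b j)
  have hOi : Integrable (O.indicator fun x => 8 * density U u x) :=
    (hi.const_mul 8).indicator hOm
  have hΦi : Integrable Φ :=
    (hOi.add (integrable_finsetSum _ fun k _ => hdi k)).add
      ((integrable_finsetSum _ fun k _ => hei k).const_mul _)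
  have hIΦ : ∫ x, Φ x ≤ 8 * (∫ x in O, density U u x) + n * (8 * L * C₂ * D + 4 * D) +
      4 * C₁ * n * (n * (W 1 - W (H L))) := by
    have h1 : ∫ x, Φ x = (∫ x, O.indicator (fun x => 8 * density U u x) x) +
        ∑ k, (∫ x, d k x) + 4 * C₁ * n * ∑ j, ∫ x, e j x := by
      rw [hΦ, integral_add, integral_add hOi, integral_finsetSum _ fun k _ => hdi k,
        integral_const_mul, integral_finsetSum _ fun k _ => hei k]
      · exact integrable_finsetSum _ fun k _ => hdi k
      · exact hOi.add (integrable_finsetSum _ fun k _ => hdi k)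
      · exact (integrable_finsetSum _ fun k _ => hei k).const_mul _
    have h2 : ∀ j, ∫ x, e j x = W 1 - W (H L) := fun j =>
      hU.integral_compl_window_potential_kink hL.le (b j)
    have h3 : ∀ k, ∫ x, d k x ≤ 8 * L * C₂ * D + 4 * D := fun k => by
      have hint := hU.integrable_defectSq hu hi (hsgn k)
      rw [hd, integral_indicator (hRm k), hR, ← intervalIntegral.integral_of_le (by linarith),
        intervalIntegral.integral_add (by simp) (hint.const_mul 4).intervalIntegrable,
        intervalIntegral.integral_const, intervalIntegral.integral_const_mul, smul_eq_mul]
      have h4 : ∫ x in (b k - L)..(b k + L), defectSq U u (sg k) x ≤ D :=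
        (intervalIntegral.integral_mono_interval (hwin k).1 (by linarith) (hwin k).2
          (Eventually.of_forall fun x => defectSq_nonneg U u (sg k) x)
          hint.intervalIntegrable).trans (hD k)
      have h5 : (b k + L - (b k - L)) * (4 * C₂ * D) = 8 * L * C₂ * D := by ring
      linarith
    rw [h1, integral_indicator hOm, integral_const_mul]
    simp only [h2, Finset.sum_const, Finset.card_univ, Fintype.card_fin, nsmul_eq_mul]
    have h6 := Finset.sum_le_sum fun k (_ : k ∈ Finset.univ) => h3 k
    simp only [Finset.sum_const, Finset.card_univ, Fintype.card_fin, nsmul_eq_mul] at h6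
    linarith
  refine le_trans ?_ (ENNReal.ofReal_le_ofReal hIΦ)
  have hdens := hU.density_nonneg u
  have hΦ0 : ∀ x, 0 ≤ Φ x := fun x => by
    have h1 := Finset.sum_nonneg fun j (_ : j ∈ Finset.univ) => he0 j x
    have h2 := Finset.sum_nonneg fun j (_ : j ∈ Finset.univ) => hd0 j x
    have h3 : 0 ≤ O.indicator (fun x => 8 * density U u x) x :=
      indicator_nonneg (fun x _ => by linarith [hdens x]) x
    have h4 : 0 ≤ 4 * C₁ * n * ∑ j, e j x := by positivity
    simp only [hΦ]
    linarith
  rw [ofReal_integral_eq_lintegral_ofReal hΦi (Eventually.of_forall hΦ0)]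
  refine lintegral_mono_ae ?_
  have hclose : ∀ k : Fin n, ∀ᵐ x, x ∈ Icc (X k) (X (k + 1)) → |x - b k| ≤ L →
      (deriv u x - sg k * deriv H (x - b k)) ^ 2 ≤ (C₂ * ∫ y in X k..X (k + 1),
        defectSq U u (sg k) y) + 2 * defectSq U u (sg k) x := fun k =>
    (hC₂ u hu hi hE (sg k) (hsgn k) _ _ _ (hbmem k) (hb k)).2
  filter_upwards [ae_all_iff.2 hclose] with x hx
  refine ENNReal.ofReal_le_ofReal ?_
  obtain ⟨hA, hB, hK⟩ := hC₁ n b x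
  have hsum0 := Finset.sum_nonneg fun j (_ : j ∈ Finset.univ) => hd0 j x
  by_cases hxO : x ∈ O
  · have hxR : ∀ k, x ∉ R k := fun k hk => hxO (mem_iUnion.2 ⟨k, hk⟩)
    obtain ⟨m, hm, h1, h2⟩ := hsep.away_of_notMem hL.le hxR
    -- Both `X m` and `x` lie in the gap between windows `m - 1` and `m`, so the segment joining
    -- them meets no window. The variation of `W ∘ u` along it is bounded by the outer energy, and
    -- `u x` stays near the vacuum `(-1)^m`.
    have hsub : uIoc (X m) x ⊆ O := by
      intro y hy
      rw [hO, mem_compl_iff, mem_iUnion]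
      rintro ⟨j, hj⟩
      rcases lt_or_ge (j : ℕ) m with hjm | hjm
      · have hXm : b j + L ≤ X m := by
          have hmpos : m - 1 < n := by omega
          have h3 := (hwin ⟨m - 1, hmpos⟩).2
          have h4 : X (m - 1 + 1) = X m := by congr 1; omega
          simp only [h4] at h3
          refine le_trans (add_le_add_left (hsep.monotone hL.le ?_) L) h3
          exact Fin.le_def.2 (by simp only; omega)
        have := hy.1
        rcases min_lt_iff.1 this with h | h
        · linarith [hj.2]
        · linarith [hj.2, h1 j hjm]
      · have hXm : X m ≤ b j - L := by
          have hmn : m < n := lt_of_le_of_lt hjm j.isLt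
          have h3 := (hwin ⟨m, hmn⟩).1
          refine h3.trans (sub_le_sub_right (hsep.monotone hL.le ?_) L)
          exact Fin.le_def.2 (by simpa using hjm)
        rcases le_max_iff.1 hy.2 with h | h
        · linarith [hj.1]
        · linarith [hj.1, h2 j hjm]
    have hWx : |W (u x) - W ((-1) ^ m)| < c := by
      refine lt_of_le_of_lt ?_ (hout m hm)
      have h3 := hU.abs_superpotential_sub_le hu hi (X m) x
      have h4 : ∫ y in uIoc (X m) x, density U u y ≤ ∫ y in O, density U u y :=
        setIntegral_mono_set hi.integrableOn (Eventually.of_forall hdens)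
          (LE.le.eventuallyLE hsub)
      have h5 := abs_sub_le (W (u x)) (W (u (X m))) (W ((-1) ^ m))
      linarith
    have h3 := hρ _ (neg_one_pow_eq m) (u x) (hc _ (neg_one_pow_eq m) _ hWx).le
    have h4 := hA m hm (fun j hj => by linarith [h1 j hj]) (fun j hj => by linarith [h2 j hj])
    have h5 : ∑ j, U (H (x - b j)) = ∑ j, e j x := Finset.sum_congr rfl fun j _ => by
      exact (indicator_of_mem (s := (R j)ᶜ) (hxR j) fun x => U (H (x - b j))).symm
    rw [h5] at h4 hB
    have h6 : Φ x = 8 * density U u x + ∑ k, d k x + 4 * C₁ * n * ∑ j, e j x := by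
      simp only [hΦ, indicator_of_mem hxO]
    rw [h6, density]
    nlinarith [sq_nonneg (u x - (-1) ^ m + (multiKink U b x - (-1) ^ m)),
      sq_nonneg (deriv u x + deriv (multiKink U b) x)]
  · obtain ⟨k, hk⟩ : ∃ k, x ∈ R k := by simpa [hO] using hxO
    obtain ⟨h1, h2⟩ := hsep.away_of_mem hk
    have hxX : x ∈ Icc (X k) (X (k + 1)) :=
      ⟨by linarith [hk.1, (hwin k).1], by linarith [hk.2, (hwin k).2]⟩
    have hxL : |x - b k| ≤ L := abs_le.2 ⟨by linarith [hk.1], by linarith [hk.2]⟩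
    obtain ⟨h3, h4⟩ := hK k (fun j hj => by linarith [h1 j hj]) (fun j hj => by linarith [h2 j hj])
    have h5 := (hC₂ u hu hi hE (sg k) (hsgn k) _ _ _ (hbmem k) (hb k)).1 x hxX hxL
    have h6 := hx k hxX hxL
    have h7 : C₂ * (∫ y in X k..X (k + 1), defectSq U u (sg k) y) ≤ C₂ * D :=
      mul_le_mul_of_nonneg_left (hD k) hC₂0.le
    -- The windows are disjoint, so a point of window `k` is outside the other windows and only
    -- tails of the other kinks contribute.
    have h8 : ∑ j ∈ Finset.univ.erase k, U (H (x - b j)) ≤ ∑ j, e j x := by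
      rw [← Finset.add_sum_erase _ _ (Finset.mem_univ k)]
      have : ∑ j ∈ Finset.univ.erase k, U (H (x - b j)) =
          ∑ j ∈ Finset.univ.erase k, e j x := Finset.sum_congr rfl fun j hj => by
        refine (indicator_of_mem (s := (R j)ᶜ) (fun hxj => ?_) fun x => U (H (x - b j))).symm
        rcases lt_or_gt_of_ne (Finset.ne_of_mem_erase hj) with hlt | hlt
        · linarith [h1 j hlt, hk.1, hxj.1, hsep j k hlt, hxj.2]
        · linarith [h2 j hlt, hk.2, hxj.1]
      rw [this]
      linarith [he0 k x]
    have h9 : 4 * C₂ * D + 4 * defectSq U u (sg k) x ≤ ∑ k, d k x := by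
      refine le_trans (le_of_eq ?_)
        (Finset.single_le_sum (fun j _ => hd0 j x) (Finset.mem_univ k))
      exact (indicator_of_mem hk fun x => 4 * C₂ * D + 4 * defectSq U u (sg k) x).symm
    have h10 : Φ x = ∑ k, d k x + 4 * C₁ * n * ∑ j, e j x := by
      simp only [hΦ, indicator_of_notMem hxO, zero_add]
    have h11 : C₁ * n * ∑ j ∈ Finset.univ.erase k, U (H (x - b j)) ≤ C₁ * n * ∑ j, e j x :=
      mul_le_mul_of_nonneg_left h8 (by positivity)
    rw [h10]
    have h12 : (u x - multiKink U b x) ^ 2 ≤ 2 * (u x - sg k * H (x - b k)) ^ 2 +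
        2 * (multiKink U b x - sg k * H (x - b k)) ^ 2 := by
      nlinarith [sq_nonneg (u x - sg k * H (x - b k) + (multiKink U b x - sg k * H (x - b k)))]
    have h13 : (deriv u x - deriv (multiKink U b) x) ^ 2 ≤
        2 * (deriv u x - sg k * deriv H (x - b k)) ^ 2 +
        2 * (deriv (multiKink U b) x - sg k * deriv H (x - b k)) ^ 2 := by
      nlinarith [sq_nonneg (deriv u x - sg k * deriv H (x - b k) +
        (deriv (multiKink U b) x - sg k * deriv H (x - b k)))]
    linarith

end IsPotential

/-! ### States with `n` transitions and almost minimal energy. -/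

theorem tendsto_of_sq_sub_le {ι : Type*} {l : Filter ι} {f g : ι → ℝ} {c : ℝ}
    (h : ∀ᶠ t in l, (f t - c) ^ 2 ≤ g t) (hg : Tendsto g l (𝓝 0)) : Tendsto f l (𝓝 c) := by
  have h1 : Tendsto (fun t => (f t - c) ^ 2) l (𝓝 0) :=
    squeeze_zero' (Eventually.of_forall fun t => sq_nonneg _) h hg
  have h2 := h1.sqrt
  simp only [Real.sqrt_sq_eq_abs, Real.sqrt_zero] at h2
  exact tendsto_sub_nhds_zero_iff.1 ((tendsto_zero_iff_abs_tendsto_zero _).2 h2)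

/-- After multiplication by `(-1)^k`, the values at `X k` and `X (k + 1)` tend to `1` and `-1`, so
the intermediate value theorem gives a zero in between. The default position `0` is taken only where
such zeros may not exist. -/
theorem eventually_exists_zero {ι : Type*} {l : Filter ι} {u : ι → ℝ → ℝ} {n : ℕ} {X : ℕ → ι → ℝ}
    (hu : ∀ t, LocAC (u t)) (hX : ∀ t, Monotone fun k => X k t)
    (hlim : ∀ k ≤ n, Tendsto (fun t => u t (X k t)) l (𝓝 ((-1) ^ k))) :
    ∃ b : ι → Fin n → ℝ, ∀ᶠ t in l, ∀ k : Fin n, b t k ∈ Icc (X k t) (X (k + 1) t) ∧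
      u t (b t k) = 0 := by
  classical
  have hex : ∀ᶠ t in l, ∀ k : Fin n, ∃ z, z ∈ Icc (X k t) (X (k + 1) t) ∧ u t z = 0 := by
    refine eventually_all.2 fun k => ?_
    have hsq : (-1 : ℝ) ^ (k : ℕ) * (-1) ^ (k : ℕ) = 1 := by
      rw [← sq]; exact sq_eq_one_of_sign (neg_one_pow_eq k)
    have h1 := (hlim k k.isLt.le).const_mul ((-1) ^ (k : ℕ))
    have h2 := (hlim (k + 1) k.isLt).const_mul ((-1) ^ (k : ℕ))
    rw [hsq] at h1
    rw [pow_succ, ← mul_assoc, hsq, one_mul] at h2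
    filter_upwards [h1.eventually (lt_mem_nhds one_pos),
      h2.eventually (gt_mem_nhds (neg_one_lt_zero))] with t ht1 ht2
    have := intermediate_value_Icc' (hX t (Nat.le_succ k))
      ((hu t).continuous.const_mul ((-1 : ℝ) ^ (k : ℕ)) : Continuous _).continuousOn
    obtain ⟨z, hz, hz0⟩ := this ⟨ht2.le, ht1.le⟩
    refine ⟨z, hz, ?_⟩
    rcases mul_eq_zero.1 hz0 with h | h
    · exact absurd h (pow_ne_zero _ (by norm_num))
    · exact h
  refine ⟨fun t k => if h : ∃ z, z ∈ Icc (X k t) (X (k + 1) t) ∧ u t z = 0 then h.choose else 0,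
    hex.mono fun t ht k => ?_⟩
  simp only [dif_pos (ht k)]
  exact (ht k).choose_spec

namespace IsPotential

variable {U : ℝ → ℝ} (hU : IsPotential U)
include hU

local notation "W" => superpotential U
local notation "H" => kink U

theorem superpotential_neg_one_pow (m : ℕ) : W ((-1) ^ m) = (-1) ^ m * W 1 := by
  have := hU.superpotential_sign_mul (neg_one_pow_eq m) 1
  rwa [mul_one] at this

variable {ι : Type*} {l : Filter ι} {u : ι → ℝ → ℝ} {n : ℕ} {X : ℕ → ι → ℝ}

/-- Each transition asymptotically costs the energy of one kink. -/
theorem tendsto_gain (hlim : ∀ k ≤ n, Tendsto (fun t => u t (X k t)) l (𝓝 ((-1) ^ k)))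
    {k : ℕ} (hk : k < n) :
    Tendsto (fun t => (-1) ^ (k + 1) * (W (u t (X (k + 1) t)) - W (u t (X k t)))) l
      (𝓝 (2 * W 1)) := by
  have h1 := (hU.continuous_superpotential.tendsto _).comp (hlim (k + 1) hk)
  have h2 := (hU.continuous_superpotential.tendsto _).comp (hlim k hk.le)
  have h3 := (h1.sub h2).const_mul ((-1) ^ (k + 1))
  rw [hU.superpotential_neg_one_pow, hU.superpotential_neg_one_pow] at h3
  have h4 : (-1 : ℝ) ^ (k + 1) * ((-1) ^ (k + 1) * W 1 - (-1) ^ k * W 1) = 2 * W 1 := by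
    have : ((-1 : ℝ) ^ k) ^ 2 = 1 := sq_eq_one_of_sign (neg_one_pow_eq k)
    rw [pow_succ]
    linear_combination 2 * W 1 * this
  rwa [h4] at h3

/-- The energy of a state is at least the sum of the Bogomolny defects and of the variations of the
superpotential between consecutive points. -/
theorem sum_defect_add_gain_le {u : ℝ → ℝ} (hu : LocAC u) (hi : Integrable (density U u))
    {X : ℕ → ℝ} (hX : Monotone X) (n : ℕ) :
    ∑ k ∈ Finset.range n, (1 / 2 * (∫ x in X k..X (k + 1), defectSq U u ((-1) ^ (k + 1)) x) +
      (-1) ^ (k + 1) * (W (u (X (k + 1))) - W (u (X k)))) ≤ ∫ x, density U u x := by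
  have h1 : ∀ k, 1 / 2 * (∫ x in X k..X (k + 1), defectSq U u ((-1) ^ (k + 1)) x) +
      (-1) ^ (k + 1) * (W (u (X (k + 1))) - W (u (X k))) =
      ∫ x in X k..X (k + 1), density U u x := fun k =>
    (hU.integral_density_eq hu hi (neg_one_pow_eq (k + 1)) _ _).symm
  simp only [h1]
  rw [intervalIntegral.sum_integral_adjacent_intervals fun k _ => hi.intervalIntegrable,
    intervalIntegral.integral_of_le (hX (Nat.zero_le n))]
  exact setIntegral_le_integral hi (Eventually.of_forall (hU.density_nonneg u))

/-- The windows are disjoint and each contains at least the energy given by its variation of `W ∘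
u`; the complement gets what is left. -/
theorem integral_compl_windows_le {u : ℝ → ℝ} (hu : LocAC u) (hi : Integrable (density U u))
    {L : ℝ} (hL : 0 < L) {b : Fin n → ℝ} (hsep : Separated L b) :
    ∫ x in (⋃ k, Ioc (b k - L) (b k + L))ᶜ, density U u x ≤ (∫ x, density U u x) -
      ∑ k : Fin n, (-1) ^ ((k : ℕ) + 1) * (W (u (b k + L)) - W (u (b k - L))) := by
  have hd : Pairwise (Function.onFun Disjoint fun k => Ioc (b k - L) (b k + L)) := by
    intro i j hij
    refine disjoint_left.2 fun x hx hy => ?_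
    rcases lt_or_gt_of_ne hij with h | h
    · linarith [hsep _ _ h, hx.2, hy.1]
    · linarith [hsep _ _ h, hx.1, hy.2]
  have h1 := integral_add_compl (MeasurableSet.iUnion fun k : Fin n =>
    measurableSet_Ioc (a := b k - L) (b := b k + L)) hi
  rw [integral_iUnion_fintype (fun k => measurableSet_Ioc) hd fun k => hi.integrableOn] at h1
  have h2 : ∑ k : Fin n, (-1) ^ ((k : ℕ) + 1) * (W (u (b k + L)) - W (u (b k - L))) ≤
      ∑ k : Fin n, ∫ x in Ioc (b k - L) (b k + L), density U u x :=
    Finset.sum_le_sum fun k _ => by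
      rw [← intervalIntegral.integral_of_le (by linarith)]
      exact hU.sign_mul_superpotential_sub_le hu hi (neg_one_pow_eq _) (by linarith)
  linarith

/-- A family of states of almost minimal energy among those with `n` transitions between the vacua
is asymptotically a multi-kink with diverging distances between the kinks. -/
theorem exists_multiKink_approx (hu : ∀ t, LocAC (u t)) (hi : ∀ t, Integrable (density U (u t)))
    (hE : ∀ t, (∫ x, density U (u t) x) ≤ n * (2 * W 1)) (hX : ∀ t, Monotone fun k => X k t)
    (hlim : ∀ k ≤ n, Tendsto (fun t => u t (X k t)) l (𝓝 ((-1) ^ k))) :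
    ∃ b : ι → Fin n → ℝ, (∀ L, 0 < L → ∀ᶠ t in l, Separated L (b t)) ∧
      ∀ ε, 0 < ε → ∀ᶠ t in l, ∫⁻ x, ENNReal.ofReal ((u t x - multiKink U (b t) x) ^ 2 +
        (deriv (u t) x - deriv (multiKink U (b t)) x) ^ 2) ≤ ENNReal.ofReal ε := by
  obtain ⟨b, hb⟩ := eventually_exists_zero hu hX hlim
  set gain : ι → ℕ → ℝ := fun t k =>
    (-1) ^ (k + 1) * (W (u t (X (k + 1) t)) - W (u t (X k t))) with hgain
  -- The amount by which the `n` transitions fall short of their limiting cost; the energy budget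
  -- `2n W(1)` leaves only this much for the squared Bogomolny defects, up to the factor `2`.
  set defect : ι → ℝ := fun t => ∑ k ∈ Finset.range n, (2 * W 1 - gain t k) with hdef
  have hdef0 : Tendsto defect l (𝓝 0) := by
    have : Tendsto defect l (𝓝 (∑ k ∈ Finset.range n, (2 * W 1 - 2 * W 1))) :=
      tendsto_finsetSum _ fun k hk =>
        (hU.tendsto_gain hlim (Finset.mem_range.1 hk)).const_sub _
    simpa using this
  have hD : ∀ t, ∀ k : Fin n,
      ∫ x in X k t..X (k + 1) t, defectSq U (u t) ((-1) ^ ((k : ℕ) + 1)) x ≤ 2 * defect t := by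
    intro t k
    have h1 : (∑ k ∈ Finset.range n, 1 / 2 * ∫ x in X k t..X (k + 1) t,
        defectSq U (u t) ((-1) ^ (k + 1)) x) + ∑ k ∈ Finset.range n, gain t k ≤
        ∫ x, density U (u t) x := by
      rw [← Finset.sum_add_distrib]
      exact hU.sum_defect_add_gain_le (hu t) (hi t) (hX t) n
    have h2 : defect t = n * (2 * W 1) - ∑ k ∈ Finset.range n, gain t k := by
      simp [hdef, Finset.sum_sub_distrib]
    have h3 := Finset.single_le_sum (f := fun k => 1 / 2 * ∫ x in X k t..X (k + 1) t,
      defectSq U (u t) ((-1) ^ (k + 1)) x) (s := Finset.range n) (fun k _ => by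
        have := intervalIntegral.integral_nonneg (μ := volume) (hX t (Nat.le_succ k))
          fun x _ => defectSq_nonneg U (u t) ((-1) ^ (k + 1)) x
        simp only [Nat.succ_eq_add_one] at this
        positivity) (Finset.mem_range.2 k.isLt)
    have h4 := hE t
    linarith
  have hpoint : ∀ L, 0 < L → ∃ C : ℝ, 0 < C ∧ ∀ᶠ t in l, ∀ k : Fin n,
      ∀ x ∈ Icc (X k t) (X (k + 1) t), |x - b t k| ≤ L →
        (u t x - (-1) ^ ((k : ℕ) + 1) * H (x - b t k)) ^ 2 ≤ C * (2 * defect t) := by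
    intro L hL
    obtain ⟨C, hC0, hC⟩ := hU.exists_close_to_kink (n * (2 * W 1)) L
    refine ⟨C, hC0, hb.mono fun t ht k x hx hxL => ?_⟩
    have := (hC (u t) (hu t) (hi t) (hE t) _ (neg_one_pow_eq (k + 1)) _ _ _ (ht k).1 (ht k).2).1
      x hx hxL
    exact this.trans (mul_le_mul_of_nonneg_left (hD t k) hC0.le)
  have hwin : ∀ L, 0 < L → ∀ᶠ t in l, ∀ k : Fin n,
      X k t ≤ b t k - L ∧ b t k + L ≤ X (k + 1) t := by
    intro L hL
    obtain ⟨C, hC0, hC⟩ := hpoint L hL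
    -- If `X k` or `X (k + 1)` lay within `L` of the zero, `u` would there be `δ`-close both to a
    -- vacuum and to `±H`, forcing `H > 1 - 2δ = H L` at a distance less than `L`, contrary to
    -- monotonicity.
    set δ := (1 - H L) / 2 with hδ
    have hδ0 : 0 < δ := by have := (hU.kink_mem L).2; simp only [hδ]; linarith
    have h1 : Tendsto (fun t => C * (2 * defect t)) l (𝓝 0) := by
      simpa using (hdef0.const_mul 2).const_mul C
    have h2 : ∀ᶠ t in l, ∀ k : Fin n, |u t (X k t) - (-1) ^ (k : ℕ)| < δ ∧
        |u t (X (k + 1) t) - (-1) ^ ((k : ℕ) + 1)| < δ := eventually_all.2 fun k =>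
      ((Metric.tendsto_nhds.1 (hlim k k.isLt.le)) δ hδ0).and
        ((Metric.tendsto_nhds.1 (hlim (k + 1) k.isLt)) δ hδ0)
    filter_upwards [hC, h2, hb, h1.eventually (gt_mem_nhds (sq_pos_of_pos hδ0))]
      with t hCt h2t hbt h1t k
    have hmono := hX t (Nat.le_succ k)
    have hclose : ∀ x ∈ Icc (X k t) (X (k + 1) t), |x - b t k| ≤ L →
        |u t x - (-1) ^ ((k : ℕ) + 1) * H (x - b t k)| < δ := fun x hx hxL =>
      abs_lt_of_sq_lt_sq ((hCt k x hx hxL).trans_lt h1t) hδ0.le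
    have hbd : ∀ y s : ℝ, s = 1 ∨ s = -1 → ∀ v : ℝ, |v - s| < δ → |v - s * H y| < δ →
        H L < H y := by
      intro y s hs v hv1 hv2
      rcases hs with rfl | rfl
      · linarith [(abs_lt.1 hv1).1, (abs_lt.1 hv2).2]
      · linarith [(abs_lt.1 hv1).2, (abs_lt.1 hv2).1]
    constructor
    · by_contra! hcon
      have hle := (hbt k).1.1
      have h3 := hclose (X k t) ⟨le_rfl, hmono⟩ (abs_le.2 ⟨by linarith, by linarith⟩)
      have h4 := hbd (-(X k t - b t k)) _ (neg_one_pow_eq k) _ (h2t k).1 (by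
        rw [hU.kink_neg]; rw [pow_succ] at h3; convert h3 using 2; ring)
      linarith [hU.kink_strictMono.lt_iff_lt.1 h4]
    · by_contra! hcon
      have hle := (hbt k).1.2
      have h3 := hclose (X (k + 1) t) ⟨hmono, le_rfl⟩ (abs_le.2 ⟨by linarith, by linarith⟩)
      have h4 := hbd (X (k + 1) t - b t k) _ (neg_one_pow_eq (k + 1)) _ (h2t k).2 h3
      linarith [hU.kink_strictMono.lt_iff_lt.1 h4]
  have hsep : ∀ L, 0 < L → ∀ᶠ t in l, Separated L (b t) := by
    intro L hL
    filter_upwards [hwin L hL] with t ht i j hij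
    have h1 : X (i + 1) t ≤ X j t := hX t (Nat.succ_le_of_lt hij)
    linarith [(ht i).2, (ht j).1]
  refine ⟨b, hsep, fun ε hε => ?_⟩
  obtain ⟨ρ, hρ0, -, hρ⟩ := hU.exists_sq_le
  obtain ⟨c, hc0, hc⟩ := hU.exists_superpotential_gap hρ0
  obtain ⟨C₁, hC₁0, hC₁⟩ := hU.exists_multiKink_sq_le
  have hω : Tendsto (fun L => W 1 - W (H L)) atTop (𝓝 0) := by
    simpa using hU.tendsto_superpotential_kink_atTop.const_sub (W 1)
  -- The width is fixed before `t` varies: as `t` advances the outer energy is eventually bounded by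
  -- a quantity tending to `n · 2 (W(1) - W(H(L)))`, which has to be below the gap `c` and, with the
  -- kink tails, below `ε`.
  obtain ⟨L, hL, hLc, hLε⟩ : ∃ L : ℝ, 0 < L ∧ n * (2 * (W 1 - W (H L))) < c / 2 ∧
      8 * (n * (2 * (W 1 - W (H L)))) + 4 * C₁ * n * (n * (W 1 - W (H L))) < ε := by
    have h1 : Tendsto (fun L => n * (2 * (W 1 - W (H L)))) atTop (𝓝 0) := by
      simpa using (hω.const_mul 2).const_mul (n : ℝ)
    have h2 : Tendsto (fun L => 8 * (n * (2 * (W 1 - W (H L)))) +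
        4 * C₁ * n * (n * (W 1 - W (H L)))) atTop (𝓝 0) := by
      simpa using (h1.const_mul 8).add ((hω.const_mul (n : ℝ)).const_mul (4 * C₁ * n))
    exact ((eventually_gt_atTop 0).and ((h1.eventually (gt_mem_nhds (half_pos hc0))).and
      (h2.eventually (gt_mem_nhds hε)))).exists
  obtain ⟨C₂, hC₂0, hC₂⟩ := hU.exists_close_to_kink (n * (2 * W 1)) L
  set out : ι → ℝ := fun t => n * (2 * W 1) -
    ∑ k : Fin n, (-1) ^ ((k : ℕ) + 1) * (W (u t (b t k + L)) - W (u t (b t k - L))) with hout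
  have houtlim : Tendsto out l (𝓝 (n * (2 * (W 1 - W (H L))))) := by
    have h0 : Tendsto (fun t => C₂ * (2 * defect t)) l (𝓝 0) := by
      simpa using (hdef0.const_mul 2).const_mul C₂
    have h1 : ∀ k : Fin n, Tendsto (fun t => (-1) ^ ((k : ℕ) + 1) *
        (W (u t (b t k + L)) - W (u t (b t k - L)))) l (𝓝 (2 * W (H L))) := by
      intro k
      have hs := neg_one_pow_eq ((k : ℕ) + 1)
      -- At the ends of the window `u` converges to `±H(L)`, so the energy captured there tends to
      -- at least `2 W(H(L))`.
      have key : ∀ y, |y| ≤ L → Tendsto (fun t => u t (b t k + y)) l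
          (𝓝 ((-1) ^ ((k : ℕ) + 1) * H y)) := fun y hy => by
        refine tendsto_of_sq_sub_le (g := fun t => C₂ * (2 * defect t)) ?_ h0
        filter_upwards [hwin L hL, hb] with t ht hbt
        have hy' := abs_le.1 hy
        have h2 := (hC₂ (u t) (hu t) (hi t) (hE t) _ hs _ _ _ (hbt k).1 (hbt k).2).1 (b t k + y)
          ⟨by linarith [(ht k).1], by linarith [(ht k).2]⟩ (by rwa [add_sub_cancel_left])
        rw [add_sub_cancel_left] at h2
        exact h2.trans (mul_le_mul_of_nonneg_left (hD t k) hC₂0.le)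
      have h2 := (hU.continuous_superpotential.tendsto _).comp (key L (abs_of_pos hL).le)
      have h3 := (hU.continuous_superpotential.tendsto _).comp
        (key (-L) (by rw [abs_neg]; exact (abs_of_pos hL).le))
      have h4 := (h2.sub h3).const_mul ((-1 : ℝ) ^ ((k : ℕ) + 1))
      rw [hU.kink_neg, hU.superpotential_sign_mul hs, hU.superpotential_sign_mul hs,
        hU.superpotential_neg] at h4
      have h5 : (-1 : ℝ) ^ ((k : ℕ) + 1) * ((-1) ^ ((k : ℕ) + 1) * W (H L) -
          (-1) ^ ((k : ℕ) + 1) * -W (H L)) = 2 * W (H L) := by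
        linear_combination 2 * W (H L) * sq_eq_one_of_sign hs
      rwa [h5] at h4
    have h2 := (tendsto_finsetSum Finset.univ fun k _ => h1 k).const_sub (n * (2 * W 1))
    have h3 : (n : ℝ) * (2 * W 1) - ∑ k : Fin n, 2 * W (H L) = n * (2 * (W 1 - W (H L))) := by
      simp; ring
    rwa [h3] at h2
  have hbound : Tendsto (fun t => 8 * out t + n * (8 * L * C₂ * (2 * defect t) + 4 * (2 * defect t)) +
      4 * C₁ * n * (n * (W 1 - W (H L)))) l
      (𝓝 (8 * (n * (2 * (W 1 - W (H L)))) + 4 * C₁ * n * (n * (W 1 - W (H L))))) := by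
    have h1 : Tendsto (fun t => n * (8 * L * C₂ * (2 * defect t) + 4 * (2 * defect t))) l (𝓝 0) := by
      simpa using (((hdef0.const_mul 2).const_mul (8 * L * C₂)).add
        ((hdef0.const_mul 2).const_mul 4)).const_mul (n : ℝ)
    simpa using ((houtlim.const_mul 8).add h1).add_const (4 * C₁ * n * (n * (W 1 - W (H L))))
  have hXW : ∀ᶠ t in l, ∀ m ∈ Finset.range (n + 1),
      |W (u t (X m t)) - W ((-1) ^ m)| < c / 2 := by
    refine (Finset.eventually_all _).2 fun m hm => ?_
    have h1 := (hU.continuous_superpotential.tendsto _).comp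
      (hlim m (Nat.lt_succ_iff.1 (Finset.mem_range.1 hm)))
    exact (Metric.tendsto_nhds.1 h1) (c / 2) (half_pos hc0)
  filter_upwards [hwin L hL, hsep L hL, hb, hXW, houtlim.eventually (gt_mem_nhds hLc),
    hbound.eventually (gt_mem_nhds hLε)] with t h1 h2 h3 h4 h5 h6
  have hO : ∫ x in (⋃ k, Ioc (b t k - L) (b t k + L))ᶜ, density U (u t) x ≤ out t :=
    (hU.integral_compl_windows_le (hu t) (hi t) hL h2).trans (sub_le_sub_right (hE t) _)
  refine (hU.lintegral_sub_multiKink_le (X := fun k => X k t) (ρ := ρ) (c := c) (D := 2 * defect t)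
    hL hC₁ hC₁0 hC₂0 hC₂ hρ hc (hu t) (hi t) (hE t) h1 (fun k => (h3 k).2) h2 (fun m hm => ?_)
    (hD t)).trans (ENNReal.ofReal_le_ofReal ?_)
  · linarith [h4 m (Finset.mem_range.2 (Nat.lt_succ_iff.2 hm))]
  · linarith

end IsPotential

/-! ### Weak derivatives of scalar functions and of curves in `L²`. -/

/-- Integration by parts against a compactly supported function. -/
theorem LocAC.integral_mul_deriv {u g : ℝ → ℝ} (hu : LocAC u) (hg : ContDiff ℝ 1 g)
    (hgc : HasCompactSupport g) : ∫ x, u x * deriv g x = -∫ x, deriv u x * g x := by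
  obtain ⟨R, hR⟩ := hgc.isCompact.isBounded.subset_closedBall 0
  rw [Real.closedBall_eq_Icc, zero_sub, zero_add] at hR
  have hsupp : ∀ x, x ∉ Ioc (-(|R| + 1)) (|R| + 1) → x ∉ tsupport g := fun x hx hxt => by
    have := hR hxt
    exact hx ⟨by linarith [this.1, le_abs_self R], by linarith [this.2, le_abs_self R]⟩
  have hg0 : ∀ x, x ∉ tsupport g → g x = 0 := fun x hx => image_eq_zero_of_notMem_tsupport hx
  have hd0 : ∀ x, x ∉ tsupport g → deriv g x = 0 := fun x hx => by
    by_contra hne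
    exact hx (support_deriv_subset (Function.mem_support.2 hne))
  have hend : ∀ x, |R| + 1 ≤ |x| → g x = 0 := fun x hx => hg0 x fun hxt => by
    have h1 := hR hxt
    have h2 : |x| ≤ R := abs_le.2 ⟨h1.1, h1.2⟩
    linarith [le_abs_self R]
  have h := (hu (-(|R| + 1)) (|R| + 1)).integral_mul_deriv_eq_deriv_mul
    (LocAC.of_contDiff hg (-(|R| + 1)) (|R| + 1))
  have hR0 : |(|R| + 1)| = |R| + 1 := abs_of_nonneg (by positivity)
  rw [hend (|R| + 1) hR0.ge, hend (-(|R| + 1)) (by rw [abs_neg]; exact hR0.ge), mul_zero, mul_zero,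
    sub_zero, zero_sub,
    intervalIntegral.integral_eq_integral_of_support_subset fun x hx => by
      by_contra hn; exact hx (by simp only [hd0 x (hsupp x hn), mul_zero]),
    intervalIntegral.integral_eq_integral_of_support_subset fun x hx => by
      by_contra hn; exact hx (by simp only [hg0 x (hsupp x hn), mul_zero])] at h
  exact h

/-- The primitive started to the left of the support vanishes again on its right because the total
integral is zero. -/
theorem exists_primitive_hasCompactSupport {h : ℝ → ℝ} (hh : ContDiff ℝ ∞ h)
    (hc : HasCompactSupport h) (h0 : ∫ x, h x = 0) :
    ∃ θ : ℝ → ℝ, ContDiff ℝ ∞ θ ∧ HasCompactSupport θ ∧ deriv θ = h := by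
  obtain ⟨R, hR⟩ := hc.isCompact.isBounded.subset_closedBall 0
  rw [Real.closedBall_eq_Icc, zero_sub, zero_add] at hR
  have hz : ∀ x, x ∉ Icc (-R) R → h x = 0 := fun x hx =>
    image_eq_zero_of_notMem_tsupport fun hxt => hx (hR hxt)
  have hd : ∀ x, HasDerivAt (fun x => ∫ y in (-(|R| + 1))..x, h y) (h x) x := fun x =>
    (hh.continuous.integral_hasStrictDerivAt _ x).hasDerivAt
  have hderiv : deriv (fun x => ∫ y in (-(|R| + 1))..x, h y) = h := funext fun x => (hd x).deriv
  refine ⟨fun x => ∫ y in (-(|R| + 1))..x, h y, ?_, ?_, hderiv⟩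
  · rw [contDiff_infty_iff_deriv, hderiv]
    exact ⟨fun x => (hd x).differentiableAt, hh⟩
  · refine HasCompactSupport.intro (isCompact_Icc (a := -(|R| + 1)) (b := |R| + 1)) fun x hx => ?_
    have hle := le_abs_self R
    rcases lt_or_ge x (-(|R| + 1)) with hlt | hge
    · refine intervalIntegral.integral_zero_ae (Eventually.of_forall fun y hy => hz y fun hy' => ?_)
      rw [uIoc_of_ge hlt.le] at hy
      linarith [hy.2, hy'.1]
    · have hgt : |R| + 1 < x := by
        by_contra hn
        exact hx ⟨hge, not_lt.1 hn⟩
      rw [intervalIntegral.integral_eq_integral_of_support_subset, h0]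
      intro y hy
      by_contra hn
      exact hy (hz y fun hy' => hn ⟨by linarith [hy'.1], by linarith [hy'.2]⟩)

theorem integrable_mul_of_continuous {p g : ℝ → ℝ} (hp : Continuous p) (hg : Continuous g)
    (hc : HasCompactSupport g) : Integrable fun x => p x * g x :=
  (hp.mul hg).integrable_of_hasCompactSupport hc.mul_left

/-- For a bump `r` of integral one, every test function `g` differs from `(∫ g) r` by a function of
mean zero, hence by the derivative of a test function. So `p` acts on `g` as the constant `∫ p r`.
-/
theorem eq_const_of_integral_mul_deriv_eq_zero {p : ℝ → ℝ} (hp : Continuous p)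
    (h : ∀ θ : ℝ → ℝ, ContDiff ℝ ∞ θ → HasCompactSupport θ → ∫ x, p x * deriv θ x = 0) :
    ∃ c, ∀ x, p x = c := by
  let B : ContDiffBump (0 : ℝ) := ⟨1, 2, one_pos, one_lt_two⟩
  set r : ℝ → ℝ := B.normed volume
  have hr : ContDiff ℝ ∞ r := B.contDiff_normed
  have hrc : HasCompactSupport r := B.hasCompactSupport_normed
  have hr1 : ∫ x, r x = 1 := B.integral_normed
  set c := ∫ x, p x * r x with hcdef
  refine ⟨c, ?_⟩
  have hae : ∀ᵐ x, p x - c = 0 := by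
    refine ae_eq_zero_of_integral_contDiff_smul_eq_zero
      (hp.sub continuous_const).locallyIntegrable fun g hg hgc => ?_
    have hgi := hg.continuous.integrable_of_hasCompactSupport (μ := volume) hgc
    have hri := hr.continuous.integrable_of_hasCompactSupport (μ := volume) hrc
    obtain ⟨θ, hθ, hθc, hθd⟩ := exists_primitive_hasCompactSupport
      (h := fun x => g x - (∫ y, g y) * r x) (hg.sub (contDiff_const.mul hr))
      (hgc.sub hrc.mul_left)
      (by rw [integral_sub hgi (hri.const_mul _), integral_const_mul, hr1]; ring)
    have h1 := h θ hθ hθc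
    rw [hθd] at h1
    have h2 : (fun x => p x * (g x - (∫ y, g y) * r x)) =
        fun x => p x * g x - (∫ y, g y) * (p x * r x) := by funext x; ring
    have hpg := integrable_mul_of_continuous hp hg.continuous hgc
    rw [h2, integral_sub hpg
      ((integrable_mul_of_continuous hp hr.continuous hrc).const_mul _), integral_const_mul,
      ← hcdef] at h1
    have h3 : (fun x => g x • (p x - c)) = fun x => p x * g x - g x * c := by
      funext x; simp only [smul_eq_mul]; ring
    rw [h3, integral_sub hpg (hgi.mul_const c), integral_mul_const]
    exact h1
  have := Continuous.ae_eq_iff_eq volume hp (continuous_const (y := c)) |>.1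
    (hae.mono fun x hx => sub_eq_zero.1 hx)
  exact fun x => congrFun this x

/-- The du Bois-Reymond lemma: a continuous weak derivative is a derivative. -/
theorem sub_eq_integral_of_weak_deriv {p q : ℝ → ℝ} (hp : Continuous p) (hq : Continuous q)
    (h : ∀ θ : ℝ → ℝ, ContDiff ℝ ∞ θ → HasCompactSupport θ →
      -∫ t, p t * deriv θ t = ∫ t, q t * θ t) (t : ℝ) :
    p t - p 0 = ∫ r in (0 : ℝ)..t, q r := by
  have hd : ∀ t, HasDerivAt (fun t => ∫ r in (0 : ℝ)..t, q r) (q t) t := fun t =>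
    (hq.integral_hasStrictDerivAt 0 t).hasDerivAt
  have hderiv : deriv (fun t => ∫ r in (0 : ℝ)..t, q r) = q := funext fun t => (hd t).deriv
  have hQ : ContDiff ℝ 1 fun t => ∫ r in (0 : ℝ)..t, q r := by
    rw [contDiff_one_iff_deriv, hderiv]
    exact ⟨fun t => (hd t).differentiableAt, hq⟩
  obtain ⟨c, hc⟩ := eq_const_of_integral_mul_deriv_eq_zero (hp.sub hQ.continuous) fun θ hθ hθc => by
    have hθ1 : ContDiff ℝ 1 θ := hθ.of_le (by simp)
    have h1 := (LocAC.of_contDiff hQ).integral_mul_deriv hθ1 hθc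
    rw [hderiv, ← h θ hθ hθc, neg_neg] at h1
    have hc' : Continuous (deriv θ) := hθ1.continuous_deriv le_rfl
    simp only [Pi.sub_apply, sub_mul]
    rw [integral_sub (integrable_mul_of_continuous hp hc' hθc.deriv)
      (integrable_mul_of_continuous hQ.continuous hc' hθc.deriv), h1, sub_self]
  have h1 := hc t
  have h2 := hc 0
  simp only [Pi.sub_apply, intervalIntegral.integral_same, sub_zero] at h1 h2
  linarith

local notation "L2R" => Lp ℝ 2 (volume : Measure ℝ)

/-- A continuous curve in `L²` with a continuous weak derivative is differentiable. -/
theorem hasDerivAt_of_weak_deriv {A B : ℝ → L2R} (hA : Continuous A) (hB : Continuous B)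
    (h : ∀ (θ χ : ℝ → ℝ), ContDiff ℝ ∞ θ → HasCompactSupport θ → ContDiff ℝ ∞ χ →
      HasCompactSupport χ → -∫ t, (∫ x, A t x * χ x) * deriv θ t =
        ∫ t, (∫ x, B t x * χ x) * θ t) (t : ℝ) :
    HasDerivAt A (B t) t := by
  have hint : ∀ s t, IntervalIntegrable B volume s t := fun s t => hB.intervalIntegrable s t
  have key : ∀ t, A t = A 0 + ∫ r in (0 : ℝ)..t, B r := by
    intro t
    -- Pairing with a fixed test function in `x` reduces the claim to the scalar du Bois-Reymond
    -- lemma in `t`; smooth compactly supported functions detect `g = 0`.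
    set g : L2R := A t - A 0 - ∫ r in (0 : ℝ)..t, B r with hg
    suffices hg0 : g = 0 by rw [hg, sub_sub, sub_eq_zero] at hg0; exact hg0
    have hgae : ∀ᵐ x, g x = 0 := by
      refine ae_eq_zero_of_integral_contDiff_smul_eq_zero
        ((Lp.memLp g).locallyIntegrable (by norm_num)) fun χ hχ hχc => ?_
      have hχ2 : MemLp χ 2 (volume : Measure ℝ) := hχ.continuous.memLp_of_hasCompactSupport hχc
      set X : L2R := hχ2.toLp χ with hX
      have hinner : ∀ f : L2R, inner ℝ X f = ∫ x, f x * χ x := fun f => by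
        rw [L2.inner_def]
        refine integral_congr_ae ?_
        filter_upwards [hχ2.coeFn_toLp] with x hx
        rw [hX, hx]; simp
      have h1 := sub_eq_integral_of_weak_deriv (p := fun t => inner ℝ X (A t))
        (q := fun t => inner ℝ X (B t)) (continuous_const.inner hA) (continuous_const.inner hB)
        (fun θ hθ hθc => by simpa only [hinner] using h θ χ hθ hθc hχ hχc) t
      have h2 : ∫ r in (0 : ℝ)..t, inner ℝ X (B r) = inner ℝ X (∫ r in (0 : ℝ)..t, B r) :=
        (innerSL ℝ X).intervalIntegral_comp_comm (hint 0 t)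
      have h3 : inner ℝ X g = 0 := by
        rw [hg, inner_sub_right, inner_sub_right, ← h2, h1, sub_self]
      rw [hinner] at h3
      simpa [mul_comm] using h3
    exact (Lp.eq_zero_iff_ae_eq_zero).2 hgae
  have hd : HasDerivAt (fun t => A 0 + ∫ r in (0 : ℝ)..t, B r) (B t) t :=
    ((hB.integral_hasStrictDerivAt 0 t).hasDerivAt).const_add _
  exact hd.congr_of_eventuallyEq (Eventually.of_forall key)

/-! ### Translations in `L²` and integrability properties of finite energy states. -/

/-- Translation in `L²`: `translate c f` is `f (· - c)`. -/
noncomputable def translate (c : ℝ) (f : L2R) : L2R := DomAddAct.mk (-c) +ᵥ f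

theorem translate_coeFn (c : ℝ) (f : L2R) : translate c f =ᵐ[volume] fun x => f (x - c) := by
  filter_upwards [DomAddAct.vadd_Lp_ae_eq (DomAddAct.mk (-c)) f] with x hx
  rw [translate, hx]
  simp [sub_eq_neg_add]

theorem norm_translate (c : ℝ) (f : L2R) : ‖translate c f‖ = ‖f‖ := DomAddAct.norm_vadd_Lp _ _

theorem translate_add (c : ℝ) (f g : L2R) :
    translate c (f + g) = translate c f + translate c g := DomAddAct.vadd_Lp_add _ _ _

theorem continuous_translate {c : ℝ → ℝ} {f : ℝ → L2R} (hc : Continuous c) (hf : Continuous f) :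
    Continuous fun t => translate (c t) (f t) := by
  have : Fact ((2 : ℝ≥0∞) ≠ ⊤) := ⟨ENNReal.ofNat_ne_top⟩
  exact (DomAddAct.continuous_mk.comp hc.neg).vadd hf

theorem inner_translate (c : ℝ) (f g : L2R) :
    inner ℝ (translate c f) (translate c g) = inner ℝ f g := by
  rw [real_inner_eq_norm_add_mul_self_sub_norm_mul_self_sub_norm_mul_self_div_two,
    real_inner_eq_norm_add_mul_self_sub_norm_mul_self_sub_norm_mul_self_div_two,
    ← translate_add, norm_translate, norm_translate, norm_translate]

theorem integral_translate_mul (c : ℝ) (f : L2R) (χ : ℝ → ℝ) :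
    ∫ x, translate c f x * χ x = ∫ x, f x * χ (x + c) := by
  rw [← integral_sub_right_eq_self (fun x => f x * χ (x + c)) c]
  refine integral_congr_ae ?_
  filter_upwards [translate_coeFn c f] with x hx
  rw [hx, sub_add_cancel]

theorem l2NormSq_eq_lintegral (v : ℝ → ℝ) : l2NormSq v = ∫⁻ x, ENNReal.ofReal (v x ^ 2) := by
  rw [l2NormSq, eLpNorm_eq_lintegral_rpow_enorm_toReal two_ne_zero ENNReal.ofNat_ne_top,
    ← ENNReal.rpow_natCast, ← ENNReal.rpow_mul]
  norm_num
  refine lintegral_congr fun x => ?_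
  rw [← ofReal_norm, ← ENNReal.ofReal_pow (norm_nonneg _), Real.norm_eq_abs, sq_abs]

theorem memLp_of_l2NormSq_lt_top {v : ℝ → ℝ} (hv : AEStronglyMeasurable v volume)
    (h : l2NormSq v < ⊤) : MemLp v 2 volume := by
  refine ⟨hv, ?_⟩
  by_contra hcon
  rw [l2NormSq, not_lt_top_iff.1 hcon] at h
  simp at h

theorem l2NormSq_eq_ofReal {v : ℝ → ℝ} (hv : MemLp v 2 volume) :
    l2NormSq v = ENNReal.ofReal (∫ x, v x ^ 2) := by
  rw [l2NormSq_eq_lintegral, ofReal_integral_eq_lintegral_ofReal hv.integrable_sq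
    (Eventually.of_forall fun x => sq_nonneg _)]

theorem LocAC.sq_le_of_h1NormSq_le {w : ℝ → ℝ} (hw : LocAC w) {ε : ℝ} (hε : 0 ≤ ε)
    (h : h1NormSq w ≤ ENNReal.ofReal ε) (x : ℝ) : w x ^ 2 ≤ 2 * ε := by
  have h0 : MemLp w 2 volume := memLp_of_l2NormSq_lt_top hw.continuous.aestronglyMeasurable
    ((le_self_add.trans h).trans_lt ENNReal.ofReal_lt_top)
  have h1 : MemLp (deriv w) 2 volume := memLp_of_l2NormSq_lt_top
    (measurable_deriv w).aestronglyMeasurable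
    ((le_add_self.trans h).trans_lt ENNReal.ofReal_lt_top)
  rw [h1NormSq, l2NormSq_eq_ofReal h0, l2NormSq_eq_ofReal h1, ← ENNReal.ofReal_add
    (integral_nonneg fun _ => sq_nonneg _) (integral_nonneg fun _ => sq_nonneg _),
    ENNReal.ofReal_le_ofReal_iff hε] at h
  linarith [sq_le_of_locAC hw h0 h1 x]

theorem exists_bound_of_tendsto {u : ℝ → ℝ} (hu : Continuous u) {a b : ℝ}
    (ha : Tendsto u atBot (𝓝 a)) (hb : Tendsto u atTop (𝓝 b)) : ∃ R, ∀ x, |u x| ≤ R := by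
  obtain ⟨p, hp⟩ := eventually_atBot.1 (ha.abs.eventually (gt_mem_nhds (lt_add_one |a|)))
  obtain ⟨q, hq⟩ := eventually_atTop.1 (hb.abs.eventually (gt_mem_nhds (lt_add_one |b|)))
  obtain ⟨C, hC⟩ := isCompact_Icc.exists_bound_of_continuousOn (s := Icc p q) hu.continuousOn
  refine ⟨max C (max (|a| + 1) (|b| + 1)), fun x => ?_⟩
  rcases le_total x p with h | h
  · exact (hp x h).le.trans ((le_max_left _ _).trans (le_max_right _ _))
  rcases le_total q x with h' | h'
  · exact (hq x h').le.trans ((le_max_right _ _).trans (le_max_right _ _))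
  · exact (hC x ⟨h, h'⟩).trans (le_max_left _ _)

namespace InSector

variable {U : ℝ → ℝ} {ιm ιp : ℝ} {u v : ℝ → ℝ}

theorem integrable_energy (hU : IsPotential U) (h : InSector U ιm ιp u v) :
    Integrable fun x => 1 / 2 * v x ^ 2 + 1 / 2 * deriv u x ^ 2 + U (u x) := by
  have hc : Continuous u := LocAC.continuous h.absolutelyContinuous
  have hm : AEStronglyMeasurable (fun x => 1 / 2 * v x ^ 2 + 1 / 2 * deriv u x ^ 2 + U (u x))
      volume :=
    (((h.aestronglyMeasurable.pow 2).const_mul _).add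
      (((measurable_deriv u).aestronglyMeasurable.pow 2).const_mul _)).add
      (hU.continuous.comp hc).aestronglyMeasurable
  refine (lintegral_ofReal_ne_top_iff_integrable hm (Eventually.of_forall fun x => ?_)).1
    h.energy_lt_top.ne
  have := hU.nonneg (u x)
  simp only [Pi.zero_apply]
  positivity

theorem integrable_density (hU : IsPotential U) (h : InSector U ιm ιp u v) :
    Integrable (density U u) := by
  have hc : Continuous u := LocAC.continuous h.absolutelyContinuous
  refine (h.integrable_energy hU).mono'
    (((measurable_deriv u).aestronglyMeasurable.pow 2).const_mul _ |>.add
      (hU.continuous.comp hc).aestronglyMeasurable) (Eventually.of_forall fun x => ?_)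
  rw [Real.norm_of_nonneg (hU.density_nonneg u x), density]
  linarith [sq_nonneg (v x)]

theorem memLp_snd (hU : IsPotential U) (h : InSector U ιm ιp u v) : MemLp v 2 volume := by
  refine memLp_two_of_integrable_sq h.aestronglyMeasurable
    (((h.integrable_energy hU).const_mul 2).mono' (h.aestronglyMeasurable.pow 2)
      (Eventually.of_forall fun x => ?_))
  rw [Real.norm_of_nonneg (sq_nonneg _)]
  linarith [sq_nonneg (deriv u x), hU.nonneg (u x)]

theorem memLp_deriv (hU : IsPotential U) (h : InSector U ιm ιp u v) : MemLp (deriv u) 2 volume :=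
  memLp_two_of_integrable_sq (measurable_deriv u).aestronglyMeasurable
    (hU.integrable_deriv_sq (h.integrable_density hU))

theorem energy_eq (hU : IsPotential U) (h : InSector U ιm ιp u v) :
    energy U u v = ENNReal.ofReal (1 / 2 * (∫ x, v x ^ 2) + ∫ x, density U u x) := by
  have h1 := (h.memLp_snd hU).integrable_sq.const_mul (1 / 2)
  have h2 : Integrable fun x => 1 / 2 * v x ^ 2 + density U u x :=
    h1.add (h.integrable_density hU)
  rw [← integral_const_mul, ← integral_add h1 (h.integrable_density hU),
    ofReal_integral_eq_lintegral_ofReal h2 (Eventually.of_forall fun x => ?_)]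
  · refine lintegral_congr fun x => ?_
    rw [density, add_assoc]
  · have := hU.density_nonneg u x
    simp only [Pi.zero_apply]
    positivity

theorem exists_bound (h : InSector U ιm ιp u v) : ∃ R, ∀ x, |u x| ≤ R :=
  exists_bound_of_tendsto (LocAC.continuous h.absolutelyContinuous) h.tendsto_atBot
    h.tendsto_atTop

/-- On the bounded range of `u` one has `U'² ≤ K U`, and `U(u)` is integrable. -/
theorem memLp_deriv_potential (hU : IsPotential U) (h : InSector U ιm ιp u v) :
    MemLp (fun x => deriv U (u x)) 2 volume := by
  obtain ⟨R, hR⟩ := h.exists_bound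
  obtain ⟨K, hK0, hK⟩ := hU.exists_deriv_sq_le R
  have hc : Continuous u := LocAC.continuous h.absolutelyContinuous
  have hm : AEStronglyMeasurable (fun x => deriv U (u x)) volume :=
    (hU.contDiff_deriv.continuous.comp hc).aestronglyMeasurable
  refine memLp_two_of_integrable_sq hm (((hU.integrable_potential h.absolutelyContinuous
    (h.integrable_density hU)).const_mul K).mono' (hm.pow 2) (Eventually.of_forall fun x => ?_))
  rw [Real.norm_of_nonneg (sq_nonneg _)]
  exact hK _ (abs_le.1 (hR x))

/-- Neither state is in `L²`, but near each end both approach the same vacuum `s`, where `(u - w)² ≤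
2 (u - s)² + 2 (w - s)² ≤ 8 (U(u) + U(w))`. -/
theorem memLp_sub (hU : IsPotential U) (hm : ιm = 1 ∨ ιm = -1) (hp : ιp = 1 ∨ ιp = -1)
    {w z : ℝ → ℝ} (h : InSector U ιm ιp u v) (h' : InSector U ιm ιp w z) :
    MemLp (fun x => u x - w x) 2 volume := by
  have hc : Continuous u := LocAC.continuous h.absolutelyContinuous
  have hc' : Continuous w := LocAC.continuous h'.absolutelyContinuous
  obtain ⟨ρ, hρ0, -, hρ⟩ := hU.exists_sq_le
  have hi : Integrable fun x => 8 * (U (u x) + U (w x)) :=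
    ((hU.integrable_potential h.absolutelyContinuous (h.integrable_density hU)).add
      (hU.integrable_potential h'.absolutelyContinuous (h'.integrable_density hU))).const_mul 8
  have key : ∀ (l : Filter ℝ) (s : ℝ), s = 1 ∨ s = -1 → Tendsto u l (𝓝 s) → Tendsto w l (𝓝 s) →
      (fun x => (u x - w x) ^ 2) =O[l] fun x => 8 * (U (u x) + U (w x)) := by
    intro l s hs h1 h2
    refine Asymptotics.IsBigO.of_bound 1 ?_
    filter_upwards [(Metric.tendsto_nhds.1 h1) ρ hρ0, (Metric.tendsto_nhds.1 h2) ρ hρ0]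
      with x hx1 hx2
    have e1 := hρ s hs (u x) hx1.le
    have e2 := hρ s hs (w x) hx2.le
    rw [Real.norm_of_nonneg (sq_nonneg _), Real.norm_of_nonneg
      (by linarith [hU.nonneg (u x), hU.nonneg (w x)]), one_mul]
    nlinarith [sq_nonneg (u x - s + (w x - s))]
  refine memLp_two_of_integrable_sq (hc.sub hc').aestronglyMeasurable ?_
  have hcc : Continuous fun x => (u x - w x) ^ 2 := (hc.sub hc').pow 2
  exact hcc.locallyIntegrable.integrable_of_isBigO_atBot_atTop
    (key _ _ hm h.tendsto_atBot h'.tendsto_atBot) (hi.integrableAtFilter _)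
    (key _ _ hp h.tendsto_atTop h'.tendsto_atTop) (hi.integrableAtFilter _)

end InSector

theorem continuous_toLp {g : ℝ → ℝ → ℝ} (hg : ∀ t, MemLp (g t) 2 volume)
    (hc : ∀ t₀, Tendsto (fun t => l2NormSq fun x => g t x - g t₀ x) (𝓝 t₀) (𝓝 0)) :
    Continuous fun t => ((hg t).toLp (g t) : L2R) := by
  rw [continuous_iff_continuousAt]
  intro t₀
  refine (Lp.tendsto_Lp_iff_tendsto_eLpNorm'' _ hg _ (hg t₀)).2 ?_
  have h2 := (ENNReal.continuous_rpow_const (y := (1 / 2 : ℝ))).tendsto 0 |>.comp (hc t₀)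
  rw [ENNReal.zero_rpow_of_pos (by norm_num)] at h2
  refine h2.congr fun t => ?_
  simp only [Function.comp, l2NormSq]
  rw [← ENNReal.rpow_natCast, ← ENNReal.rpow_mul]
  norm_num
  rfl

theorem integral_toLp_mul {g : ℝ → ℝ} (hg : MemLp g 2 volume) (χ : ℝ → ℝ) :
    ∫ x, (hg.toLp g : L2R) x * χ x = ∫ x, g x * χ x := by
  refine integral_congr_ae ?_
  filter_upwards [hg.coeFn_toLp] with x hx
  rw [hx]

theorem inner_toLp {f g : ℝ → ℝ} (hf : MemLp f 2 volume) (hg : MemLp g 2 volume) :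
    inner ℝ (hf.toLp f : L2R) (hg.toLp g) = ∫ x, f x * g x := by
  rw [L2.inner_def]
  refine integral_congr_ae ?_
  filter_upwards [hf.coeFn_toLp, hg.coeFn_toLp] with x hx hx'
  rw [hx, hx']
  simp [mul_comm]

theorem norm_toLp_sq {f : ℝ → ℝ} (hf : MemLp f 2 volume) :
    ‖(hf.toLp f : L2R)‖ ^ 2 = ∫ x, f x ^ 2 := by
  rw [← real_inner_self_eq_norm_sq, inner_toLp]
  simp only [sq]

/-! ### The equation along characteristics and conservation of energy. -/

/-- Test functions carried along the lines `x + σ t = const`. Their support is contained in the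
image of a compact product under a shear. -/
theorem hasCompactSupport_traveling {θ χ : ℝ → ℝ} (hθ : HasCompactSupport θ)
    (hχ : HasCompactSupport χ) (σ : ℝ) :
    HasCompactSupport fun z : ℝ × ℝ => θ z.1 * χ (z.2 + σ * z.1) := by
  refine HasCompactSupport.intro ((hθ.isCompact.prod hχ.isCompact).image
    (f := fun z : ℝ × ℝ => (z.1, z.2 - σ * z.1)) (by fun_prop)) fun z hz => ?_
  by_contra hne
  refine hz ⟨(z.1, z.2 + σ * z.1), ⟨subset_tsupport _ ?_, subset_tsupport _ ?_⟩, by simp⟩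
  · exact left_ne_zero_of_mul hne
  · exact right_ne_zero_of_mul hne

namespace IsSolutionInSector

variable {U : ℝ → ℝ} {ιm ιp : ℝ} {φ ψ : ℝ → ℝ → ℝ} (h : IsSolutionInSector U ιm ιp φ ψ)
include h

variable {θ χ : ℝ → ℝ} (hθ : ContDiff ℝ ∞ θ) (hθc : HasCompactSupport θ) (hχ : ContDiff ℝ ∞ χ)
  (hχc : HasCompactSupport χ) (σ : ℝ)
include hθ hθc hχ hχc

theorem eq_fst_traveling :
    -∫ t, ∫ x, φ t x * (deriv θ t * χ (x + σ * t) + θ t * (σ * deriv χ (x + σ * t))) =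
      ∫ t, ∫ x, ψ t x * (θ t * χ (x + σ * t)) := by
  rw [← h.eq_fst (fun z : ℝ × ℝ => θ z.1 * χ (z.2 + σ * z.1)) (by fun_prop)
    (hasCompactSupport_traveling hθc hχc σ)]
  refine congrArg _ (integral_congr_ae (Eventually.of_forall fun t =>
    integral_congr_ae (Eventually.of_forall fun x => ?_)))
  have h1 := (hθ.differentiable (by decide) t).hasDerivAt
  have h2 : HasDerivAt (fun s => x + σ * s) σ t := by
    simpa using ((hasDerivAt_id t).const_mul σ).const_add x
  have h3 := ((hχ.differentiable (by decide) (x + σ * t)).hasDerivAt).comp t h2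
  have h4 : deriv (fun s => θ s * χ (x + σ * s)) t = _ := (h1.mul h3).deriv
  simp only [h4, Function.comp]
  ring

theorem eq_snd_traveling :
    -∫ t, ∫ x, ψ t x * (deriv θ t * χ (x + σ * t) + θ t * (σ * deriv χ (x + σ * t))) =
      ∫ t, ∫ x, (φ t x * (θ t * deriv (deriv χ) (x + σ * t)) -
        deriv U (φ t x) * (θ t * χ (x + σ * t))) := by
  have h0 := h.eq_snd (fun z : ℝ × ℝ => θ z.1 * χ (z.2 + σ * z.1)) (by fun_prop)
    (hasCompactSupport_traveling hθc hχc σ)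
  convert! h0 using 1
  · refine congrArg _ (integral_congr_ae (Eventually.of_forall fun t =>
      integral_congr_ae (Eventually.of_forall fun x => ?_)))
    have h1 := (hθ.differentiable (by decide) t).hasDerivAt
    have h2 : HasDerivAt (fun s => x + σ * s) σ t := by
      simpa using ((hasDerivAt_id t).const_mul σ).const_add x
    have h3 := ((hχ.differentiable (by decide) (x + σ * t)).hasDerivAt).comp t h2
    have h4 : deriv (fun s => θ s * χ (x + σ * s)) t = _ := (h1.mul h3).deriv
    simp only [h4, Function.comp]
    ring
  · refine integral_congr_ae (Eventually.of_forall fun t =>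
      integral_congr_ae (Eventually.of_forall fun x => ?_))
    have h1 : deriv (fun y => θ t * χ (y + σ * t)) = fun y => θ t * deriv χ (y + σ * t) := by
      funext y
      rw [deriv_const_mul_field, deriv_comp_add_const]
    have h2 : deriv (fun y => θ t * deriv χ (y + σ * t)) =
        fun y => θ t * deriv (deriv χ) (y + σ * t) := by
      funext y
      rw [deriv_const_mul_field, deriv_comp_add_const]
    simp only [iteratedDeriv_succ, iteratedDeriv_zero, h1, h2]

end IsSolutionInSector

theorem integrable_Lp_mul (f : L2R) {χ : ℝ → ℝ} (hχ : Continuous χ) (hχc : HasCompactSupport χ) :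
    Integrable fun x => f x * χ x :=
  (Lp.memLp f).integrable_mul (hχ.memLp_of_hasCompactSupport hχc : MemLp χ 2 volume)

theorem continuous_integral_Lp_mul {G : ℝ → L2R} (hG : Continuous G) {χ : ℝ → ℝ}
    (hχ : Continuous χ) (hχc : HasCompactSupport χ) : Continuous fun t => ∫ x, G t x * χ x := by
  have hχ2 : MemLp χ 2 (volume : Measure ℝ) := hχ.memLp_of_hasCompactSupport hχc
  have h : ∀ f : L2R, inner ℝ (hχ2.toLp χ : L2R) f = ∫ x, f x * χ x := fun f => by
    rw [L2.inner_def]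
    refine integral_congr_ae ?_
    filter_upwards [hχ2.coeFn_toLp] with x hx
    rw [hx]; simp
  simp only [← h]
  exact continuous_const.inner hG

theorem continuous_integral_traveling {g : ℝ → ℝ → ℝ} (hg : ∀ t, MemLp (g t) 2 volume)
    (hG : Continuous fun t => ((hg t).toLp (g t) : L2R)) {χ : ℝ → ℝ} (hχ : Continuous χ)
    (hχc : HasCompactSupport χ) (σ : ℝ) : Continuous fun t => ∫ x, g t x * χ (x + σ * t) := by
  have h := continuous_integral_Lp_mul
    (continuous_translate (c := fun t => σ * t) (by fun_prop) hG) hχ hχc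
  simpa only [integral_translate_mul, integral_toLp_mul] using h

theorem hasCompactSupport_shift {χ : ℝ → ℝ} (hχc : HasCompactSupport χ) (c : ℝ) :
    HasCompactSupport fun x => χ (x + c) :=
  hχc.comp_homeomorph (Homeomorph.addRight c)

namespace IsSolutionInSector

variable {U : ℝ → ℝ} {ιm ιp : ℝ} {φ ψ : ℝ → ℝ → ℝ} (h : IsSolutionInSector U ιm ιp φ ψ)
include h

theorem tendsto_h1NormSq_sub (t₀ : ℝ) :
    Tendsto (fun t => h1NormSq fun x => φ t x - φ t₀ x) (𝓝 t₀) (𝓝 0) :=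
  tendsto_of_tendsto_of_tendsto_of_le_of_le tendsto_const_nhds (h.continuous t₀)
    (fun _ => zero_le) fun _ => le_self_add

/-- Locally in time, the solution takes values in a bounded set. -/
theorem exists_bound_nhds (t₀ : ℝ) :
    ∃ R, (∀ x, φ t₀ x ∈ Icc (-R) R) ∧ ∀ᶠ t in 𝓝 t₀, ∀ x, φ t x ∈ Icc (-R) R := by
  obtain ⟨R, hR⟩ := (h.inSector t₀).exists_bound
  refine ⟨R + 2, fun x => ?_, ?_⟩
  · have := abs_le.1 (hR x)
    exact ⟨by linarith, by linarith⟩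
  · filter_upwards [(h.tendsto_h1NormSq_sub t₀).eventually (gt_mem_nhds one_pos)] with t ht x
    have h1 := (LocAC.sub (h.inSector t).absolutelyContinuous
      (h.inSector t₀).absolutelyContinuous).sq_le_of_h1NormSq_le zero_le_one
      (by simpa using ht.le) x
    have h2 := abs_le.1 (hR x)
    have h3 : |φ t x - φ t₀ x| ≤ 2 := abs_le_of_sq_le_sq (by linarith) (by norm_num)
    have h4 := abs_le.1 h3
    exact ⟨by linarith, by linarith⟩

variable (hU : IsPotential U)
include hU

theorem continuous_snd :
    Continuous fun t => (((h.inSector t).memLp_snd hU).toLp (ψ t) : L2R) :=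
  continuous_toLp _ fun t₀ => tendsto_of_tendsto_of_tendsto_of_le_of_le tendsto_const_nhds
    (h.continuous t₀) (fun _ => zero_le) fun _ => le_add_self

theorem continuous_deriv :
    Continuous fun t => (((h.inSector t).memLp_deriv hU).toLp (deriv (φ t)) : L2R) :=
  continuous_toLp _ fun t₀ => by
    refine tendsto_of_tendsto_of_tendsto_of_le_of_le tendsto_const_nhds
      (h.tendsto_h1NormSq_sub t₀) (fun _ => zero_le) fun t => ?_
    rw [h1NormSq]
    refine le_trans (le_of_eq ?_) le_add_self
    rw [l2NormSq_eq_lintegral, l2NormSq_eq_lintegral]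
    refine lintegral_congr_ae ?_
    filter_upwards [LocAC.deriv_sub_ae (h.inSector t).absolutelyContinuous
      (h.inSector t₀).absolutelyContinuous] with x hx
    rw [hx]

theorem continuous_deriv_potential :
    Continuous fun t => (((h.inSector t).memLp_deriv_potential hU).toLp
      (fun x => deriv U (φ t x)) : L2R) :=
  continuous_toLp _ fun t₀ => by
    obtain ⟨R, hR, hRt⟩ := h.exists_bound_nhds t₀
    obtain ⟨C, hC1, hC⟩ := hU.exists_quadratic_bound R
    have h0 : Tendsto (fun t => ENNReal.ofReal (C ^ 2) * h1NormSq fun x => φ t x - φ t₀ x) (𝓝 t₀)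
        (𝓝 0) := by
      simpa using ENNReal.Tendsto.const_mul (h.tendsto_h1NormSq_sub t₀)
        (Or.inr ENNReal.ofReal_ne_top)
    refine tendsto_of_tendsto_of_tendsto_of_le_of_le' tendsto_const_nhds h0
      (Eventually.of_forall fun _ => zero_le) ?_
    filter_upwards [hRt] with t ht
    refine le_trans ?_ (mul_le_mul_right (le_self_add : l2NormSq _ ≤ h1NormSq _) _)
    rw [l2NormSq_eq_lintegral, l2NormSq_eq_lintegral, ← lintegral_const_mul' _ _
      ENNReal.ofReal_ne_top]
    refine lintegral_mono fun x => ?_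
    rw [← ENNReal.ofReal_mul (sq_nonneg _)]
    refine ENNReal.ofReal_le_ofReal ?_
    have h1 := (hC _ (hR x) _ (ht x)).1
    rw [← sq_abs, ← sq_abs (φ t x - φ t₀ x), ← mul_pow]
    exact pow_le_pow_left₀ (abs_nonneg _) h1 2

/-- Along characteristics, `∂ₜφ ± ∂ₓφ` is differentiable in time with values in `L²`. -/
theorem hasDerivAt_characteristic {σ : ℝ} (hσ : σ = 1 ∨ σ = -1) (t : ℝ) :
    HasDerivAt (fun t => translate (σ * t) (((h.inSector t).memLp_snd hU).toLp (ψ t) +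
        σ • ((h.inSector t).memLp_deriv hU).toLp (deriv (φ t))))
      (translate (σ * t) (-((h.inSector t).memLp_deriv_potential hU).toLp
        (fun x => deriv U (φ t x)))) t := by
  have cψ := h.continuous_snd hU
  have cφ := h.continuous_deriv hU
  have cf := h.continuous_deriv_potential hU
  have hσ2 := sq_eq_one_of_sign hσ
  refine hasDerivAt_of_weak_deriv
    (A := fun t => translate (σ * t) (((h.inSector t).memLp_snd hU).toLp (ψ t) +
      σ • ((h.inSector t).memLp_deriv hU).toLp (deriv (φ t))))
    (B := fun t => translate (σ * t) (-((h.inSector t).memLp_deriv_potential hU).toLp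
        (fun x => deriv U (φ t x))))
    (continuous_translate (by fun_prop) (cψ.add (cφ.const_smul σ)))
    (continuous_translate (by fun_prop) cf.neg) ?_ t
  intro θ χ hθ hθc hχ hχc
  have hχ1 : ContDiff ℝ ∞ (deriv χ) := (contDiff_infty_iff_deriv.1 hχ).2
  have hχ2 : ContDiff ℝ ∞ (deriv (deriv χ)) := (contDiff_infty_iff_deriv.1 hχ1).2
  have hχc1 : HasCompactSupport (deriv χ) := hχc.deriv
  have hχc2 : HasCompactSupport (deriv (deriv χ)) := hχc1.deriv
  have hθ1 : Continuous (deriv θ) := (contDiff_infty_iff_deriv.1 hθ).2.continuous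
  have hθc1 : HasCompactSupport (deriv θ) := hθc.deriv
  have mψ := fun t => (h.inSector t).memLp_snd hU
  have mφ := fun t => (h.inSector t).memLp_deriv hU
  have mf := fun t => (h.inSector t).memLp_deriv_potential hU
  -- The pairings of `∂ₜφ`, `∂ₓφ` and `U'(φ)` with the travelling `χ` and `χ'`, all continuous in
  -- `t`, so that every time integral below converges.
  set I₁ : ℝ → ℝ := fun t => ∫ x, ψ t x * χ (x + σ * t) with hI₁
  set I₂ : ℝ → ℝ := fun t => ∫ x, ψ t x * deriv χ (x + σ * t) with hI₂
  set J₁ : ℝ → ℝ := fun t => ∫ x, deriv (φ t) x * χ (x + σ * t) with hJ₁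
  set J₂ : ℝ → ℝ := fun t => ∫ x, deriv (φ t) x * deriv χ (x + σ * t) with hJ₂
  set N : ℝ → ℝ := fun t => ∫ x, deriv U (φ t x) * χ (x + σ * t) with hN
  have cI₁ : Continuous I₁ := continuous_integral_traveling mψ cψ hχ.continuous hχc σ
  have cI₂ : Continuous I₂ := continuous_integral_traveling mψ cψ hχ1.continuous hχc1 σ
  have cJ₁ : Continuous J₁ := continuous_integral_traveling mφ cφ hχ.continuous hχc σ
  have cJ₂ : Continuous J₂ := continuous_integral_traveling mφ cφ hχ1.continuous hχc1 σ
  have cN : Continuous N := continuous_integral_traveling mf cf hχ.continuous hχc σ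
  have sh : ∀ {η : ℝ → ℝ}, HasCompactSupport η → ∀ t, HasCompactSupport fun x => η (x + σ * t) :=
    fun hη t => hasCompactSupport_shift hη (σ * t)
  have iψ : ∀ {η : ℝ → ℝ}, Continuous η → HasCompactSupport η → ∀ t,
      Integrable fun x => ψ t x * η (x + σ * t) := fun hη hηc t =>
    (mψ t).integrable_mul ((hη.comp (by fun_prop)).memLp_of_hasCompactSupport (sh hηc t) :
      MemLp _ 2 volume)
  have iφ : ∀ {η : ℝ → ℝ}, Continuous η → HasCompactSupport η → ∀ t,
      Integrable fun x => φ t x * η (x + σ * t) := fun hη hηc t =>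
    integrable_mul_of_continuous (LocAC.continuous (h.inSector t).absolutelyContinuous)
      (hη.comp (by fun_prop)) (sh hηc t)
  have if' : ∀ t, Integrable fun x => deriv U (φ t x) * χ (x + σ * t) := fun t =>
    (mf t).integrable_mul ((hχ.continuous.comp (by fun_prop)).memLp_of_hasCompactSupport
      (sh hχc t) : MemLp (fun x => χ (x + σ * t)) 2 volume)
  have parts : ∀ {η : ℝ → ℝ}, ContDiff ℝ ∞ η → HasCompactSupport η → ∀ t,
      ∫ x, φ t x * deriv η (x + σ * t) = -∫ x, deriv (φ t) x * η (x + σ * t) := by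
    intro η hη hηc t
    rw [← LocAC.integral_mul_deriv (h.inSector t).absolutelyContinuous
      (g := fun x => η (x + σ * t)) ((hη.of_le (by simp)).comp (by fun_prop)) (sh hηc t)]
    refine integral_congr_ae (Eventually.of_forall fun x => ?_)
    simp only [deriv_comp_add_const]
  have iθ : ∀ {p : ℝ → ℝ}, Continuous p → Integrable fun t => p t * θ t := fun hp =>
    integrable_mul_of_continuous hp hθ.continuous hθc
  have iθ1 : ∀ {p : ℝ → ℝ}, Continuous p → Integrable fun t => p t * deriv θ t := fun hp =>
    integrable_mul_of_continuous hp hθ1 hθc1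
  -- The second equation tested against `χ`, with one space derivative moved back onto `φ`.
  have e1 : -((∫ t, I₁ t * deriv θ t) + σ * ∫ t, I₂ t * θ t) =
      -(∫ t, J₂ t * θ t) - ∫ t, N t * θ t := by
    have h0 := h.eq_snd_traveling hθ hθc hχ hχc σ
    have h1 : ∀ t, ∫ x, ψ t x * (deriv θ t * χ (x + σ * t) + θ t * (σ * deriv χ (x + σ * t))) =
        I₁ t * deriv θ t + σ * (I₂ t * θ t) := fun t => by
      rw [hI₁, hI₂, ← integral_mul_const, ← integral_mul_const, ← integral_const_mul,
        ← integral_add ((iψ hχ.continuous hχc t).mul_const _)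
          (((iψ hχ1.continuous hχc1 t).mul_const _).const_mul _)]
      refine integral_congr_ae (Eventually.of_forall fun x => ?_)
      ring
    have h2 : ∀ t, ∫ x, (φ t x * (θ t * deriv (deriv χ) (x + σ * t)) -
        deriv U (φ t x) * (θ t * χ (x + σ * t))) = -(J₂ t * θ t) - N t * θ t := fun t => by
      rw [hJ₂, hN, ← neg_mul, ← parts hχ1 hχc1 t, ← integral_mul_const, ← integral_mul_const,
        ← integral_sub ((iφ hχ2.continuous hχc2 t).mul_const _) ((if' t).mul_const _)]
      refine integral_congr_ae (Eventually.of_forall fun x => ?_)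
      ring
    simp only [h1, h2] at h0
    have i1 : Integrable fun t => -(J₂ t * θ t) := (iθ cJ₂).neg
    rwa [integral_add (iθ1 cI₁) ((iθ cI₂).const_mul σ), integral_const_mul,
      integral_sub i1 (iθ cN), integral_neg] at h0
  -- The first equation tested against `χ'`, which is the equation for `∂ₓφ` after integration by
  -- parts.
  have e2 : (∫ t, J₁ t * deriv θ t) + σ * ∫ t, J₂ t * θ t = ∫ t, I₂ t * θ t := by
    have h0 := h.eq_fst_traveling hθ hθc hχ1 hχc1 σ
    have h1 : ∀ t, ∫ x, φ t x * (deriv θ t * deriv χ (x + σ * t) +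
        θ t * (σ * deriv (deriv χ) (x + σ * t))) =
        -(J₁ t * deriv θ t) + -(σ * (J₂ t * θ t)) := fun t => by
      rw [hJ₁, hJ₂, ← neg_mul, ← parts hχ hχc t, ← mul_neg, ← neg_mul, ← parts hχ1 hχc1 t,
        ← integral_mul_const, ← integral_mul_const, ← integral_const_mul,
        ← integral_add ((iφ hχ1.continuous hχc1 t).mul_const _)
          (((iφ hχ2.continuous hχc2 t).mul_const _).const_mul _)]
      refine integral_congr_ae (Eventually.of_forall fun x => ?_)
      ring
    have h2 : ∀ t, ∫ x, ψ t x * (θ t * deriv χ (x + σ * t)) = I₂ t * θ t := fun t => by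
      rw [hI₂, ← integral_mul_const]
      refine integral_congr_ae (Eventually.of_forall fun x => ?_)
      ring
    simp only [h1, h2] at h0
    have i1 : Integrable fun t => -(J₁ t * deriv θ t) := (iθ1 cJ₁).neg
    have i2 : Integrable fun t => -(σ * (J₂ t * θ t)) := ((iθ cJ₂).const_mul σ).neg
    rw [integral_add i1 i2, integral_neg, integral_neg,
      integral_const_mul] at h0
    linarith
  have e3 : ∀ t, ∫ x, translate (σ * t) ((mψ t).toLp (ψ t) + σ • (mφ t).toLp (deriv (φ t))) x *
      χ x = I₁ t + σ * J₁ t := fun t => by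
    rw [integral_translate_mul, hI₁, hJ₁]
    simp only
    have i1 : ∀ f : L2R, Integrable fun x => f x * χ (x + σ * t) := fun f =>
      integrable_Lp_mul f (χ := fun x => χ (x + σ * t)) (hχ.continuous.comp (by fun_prop))
        (sh hχc t)
    rw [← integral_toLp_mul (mψ t), ← integral_toLp_mul (mφ t), ← integral_const_mul,
      ← integral_add (i1 _) ((i1 _).const_mul σ)]
    refine integral_congr_ae ?_
    filter_upwards [Lp.coeFn_add ((mψ t).toLp (ψ t)) (σ • (mφ t).toLp (deriv (φ t))),
      Lp.coeFn_smul σ ((mφ t).toLp (deriv (φ t)))] with x h1 h2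
    rw [h1, Pi.add_apply, h2, Pi.smul_apply, smul_eq_mul]
    ring
  have e4 : ∀ t, ∫ x, translate (σ * t) (-(mf t).toLp (fun x => deriv U (φ t x))) x * χ x =
      -N t := fun t => by
    rw [integral_translate_mul, hN]
    simp only
    rw [← integral_toLp_mul (mf t), ← integral_neg]
    refine integral_congr_ae ?_
    filter_upwards [Lp.coeFn_neg ((mf t).toLp (fun x => deriv U (φ t x)))] with x h1
    rw [h1, Pi.neg_apply, neg_mul]
  have e5 : ∀ t, (I₁ t + σ * J₁ t) * deriv θ t = I₁ t * deriv θ t + σ * (J₁ t * deriv θ t) :=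
    fun t => by ring
  simp only [e3, e4, e5, neg_mul]
  rw [integral_add (iθ1 cI₁) ((iθ1 cJ₁).const_mul σ), integral_const_mul, integral_neg]
  -- The `I₂` terms cancel, and the `J₂` terms cancel because `σ² = 1`: this is the factorisation of
  -- the wave operator.
  linear_combination e1 - σ * e2 - hσ2 * -(∫ t, J₂ t * θ t)

/-- `φ t` is not in `L²`, so `φ 0` is subtracted. This contributes a pairing constant in time, which
disappears since `∫ θ' = 0`. The test functions are the travelling ones with `σ = 0`. -/
theorem hasDerivAt_fst_sub (hm : ιm = 1 ∨ ιm = -1) (hp : ιp = 1 ∨ ιp = -1) (t : ℝ) :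
    HasDerivAt (fun t => (((h.inSector t).memLp_sub hU hm hp (h.inSector 0)).toLp
        (fun x => φ t x - φ 0 x) : L2R))
      (((h.inSector t).memLp_snd hU).toLp (ψ t)) t := by
  have cψ := h.continuous_snd hU
  have mψ := fun t => (h.inSector t).memLp_snd hU
  have mΔ := fun t => (h.inSector t).memLp_sub hU hm hp (h.inSector 0)
  have cΔ : Continuous fun t => ((mΔ t).toLp (fun x => φ t x - φ 0 x) : L2R) :=
    continuous_toLp _ fun t₀ => by
      refine tendsto_of_tendsto_of_tendsto_of_le_of_le tendsto_const_nhds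
        (h.tendsto_h1NormSq_sub t₀) (fun _ => zero_le) fun t => ?_
      simp only [sub_sub_sub_cancel_right]
      exact le_self_add
  refine hasDerivAt_of_weak_deriv cΔ cψ (fun θ χ hθ hθc hχ hχc => ?_) t
  have h0 := h.eq_fst_traveling hθ hθc hχ hχc 0
  simp only [zero_mul, add_zero, mul_zero, integral_toLp_mul] at h0 ⊢
  have cφ : ∀ t, Continuous (φ t) := fun t => LocAC.continuous (h.inSector t).absolutelyContinuous
  have h1 : ∀ t, ∫ x, φ t x * (deriv θ t * χ x) =
      (∫ x, (φ t x - φ 0 x) * χ x) * deriv θ t + (∫ x, φ 0 x * χ x) * deriv θ t := fun t => by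
    rw [← add_mul, ← integral_add
      (integrable_mul_of_continuous (p := fun x => φ t x - φ 0 x) ((cφ t).sub (cφ 0))
        hχ.continuous hχc)
      (integrable_mul_of_continuous (cφ 0) hχ.continuous hχc), ← integral_mul_const]
    refine integral_congr_ae (Eventually.of_forall fun x => ?_)
    ring
  have h2 : ∀ t, ∫ x, ψ t x * (θ t * χ x) = (∫ x, ψ t x * χ x) * θ t := fun t => by
    rw [← integral_mul_const]
    refine integral_congr_ae (Eventually.of_forall fun x => ?_)
    ring
  simp only [h1, h2] at h0
  have hθ1 : Continuous (deriv θ) := (contDiff_infty_iff_deriv.1 hθ).2.continuous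
  have c1 : Continuous fun t => ∫ x, (φ t x - φ 0 x) * χ x := by
    simpa only [integral_toLp_mul] using continuous_integral_Lp_mul cΔ hχ.continuous hχc
  have h3 : ∫ t, deriv θ t = 0 := by
    have := (LocAC.of_contDiff (u := fun _ => (1 : ℝ)) (by fun_prop)).integral_mul_deriv
      (hθ.of_le (by simp)) hθc
    simpa using this
  rw [integral_add (integrable_mul_of_continuous c1 hθ1 hθc.deriv)
    ((hθ1.integrable_of_hasCompactSupport hθc.deriv).const_mul _), integral_const_mul, h3,
    mul_zero, add_zero] at h0
  exact h0

/-- The two terms cannot be differentiated separately, since `∂ₓ²φ` need not be in `L²`. But `‖∂ₜφ ±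
∂ₓφ‖²` are differentiable, translations being isometries, and by the parallelogram law their sum is
four times the quantity here. -/
theorem hasDerivAt_kinetic (t : ℝ) :
    HasDerivAt (fun t => 1 / 2 * (∫ x, ψ t x ^ 2) + 1 / 2 * ∫ x, deriv (φ t) x ^ 2)
      (-∫ x, deriv U (φ t x) * ψ t x) t := by
  have mψ := fun t => (h.inSector t).memLp_snd hU
  have mφ := fun t => (h.inSector t).memLp_deriv hU
  have mf := fun t => (h.inSector t).memLp_deriv_potential hU
  have key : ∀ σ : ℝ, σ = 1 ∨ σ = -1 → HasDerivAt (fun t => ‖((mψ t).toLp (ψ t) : L2R) +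
      σ • (mφ t).toLp (deriv (φ t))‖ ^ 2) (2 * inner ℝ (((mψ t).toLp (ψ t) : L2R) +
      σ • (mφ t).toLp (deriv (φ t))) (-(mf t).toLp (fun x => deriv U (φ t x)))) t := by
    intro σ hσ
    have h1 := (h.hasDerivAt_characteristic hU hσ t).norm_sq
    simpa only [norm_translate, inner_translate] using h1
  have h1 := ((key 1 (Or.inl rfl)).add (key (-1) (Or.inr rfl))).const_mul (1 / 4)
  convert! h1 using 1
  · funext s
    have hpar := parallelogram_law_with_norm ℝ ((mψ s).toLp (ψ s) : L2R)
      ((mφ s).toLp (deriv (φ s)))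
    simp only [Pi.add_apply, one_smul, neg_smul, ← sub_eq_add_neg]
    rw [← norm_toLp_sq (mψ s), ← norm_toLp_sq (mφ s)]
    linarith
  · rw [inner_add_left, inner_add_left, inner_smul_left, inner_smul_left, inner_neg_right,
      inner_toLp, ← integral_congr_ae (f := fun x => ψ t x * deriv U (φ t x))
      (Eventually.of_forall fun x => mul_comm _ _)]
    simp
    ring

/-- The linear part `⟨U'(φ t), φ s - φ t⟩` is differentiated by `hasDerivAt_fst_sub`. The Taylor
remainder is at most `C ‖φ s - φ t‖²`, which is `o(s - t)` because the curve is differentiable in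
`L²`. -/
theorem hasDerivAt_integral_potential (hm : ιm = 1 ∨ ιm = -1) (hp : ιp = 1 ∨ ιp = -1) (t : ℝ) :
    HasDerivAt (fun t => ∫ x, U (φ t x)) (∫ x, deriv U (φ t x) * ψ t x) t := by
  have mψ := fun t => (h.inSector t).memLp_snd hU
  have mf := fun t => (h.inSector t).memLp_deriv_potential hU
  have mΔ := fun t => (h.inSector t).memLp_sub hU hm hp (h.inSector 0)
  have iU : ∀ t, Integrable fun x => U (φ t x) := fun t =>
    hU.integrable_potential (h.inSector t).absolutelyContinuous ((h.inSector t).integrable_density hU)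
  obtain ⟨R, hR, hRt⟩ := h.exists_bound_nhds t
  obtain ⟨C, hC1, hC⟩ := hU.exists_quadratic_bound R
  have hΔ := h.hasDerivAt_fst_sub hU hm hp t
  have h1 : HasDerivAt (fun s => inner ℝ ((mf t).toLp (fun x => deriv U (φ t x)) : L2R)
      ((mΔ s).toLp (fun x => φ s x - φ 0 x))) (∫ x, deriv U (φ t x) * ψ t x) t := by
    have := (hasDerivAt_const t ((mf t).toLp (fun x => deriv U (φ t x)) : L2R)).inner ℝ hΔ
    simpa [inner_toLp] using this
  have h2 : HasDerivAt (fun s => (∫ x, U (φ s x)) -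
      inner ℝ ((mf t).toLp (fun x => deriv U (φ t x)) : L2R)
        ((mΔ s).toLp (fun x => φ s x - φ 0 x))) 0 t := by
    rw [hasDerivAt_iff_isLittleO]
    have hO : (fun s => ‖((mΔ s).toLp (fun x => φ s x - φ 0 x) : L2R) -
        (mΔ t).toLp (fun x => φ t x - φ 0 x)‖ ^ 2) =o[𝓝 t] fun s => s - t :=
      ((hΔ.isBigO_sub.norm_left.norm_right).pow 2).trans_isLittleO
        (Asymptotics.isLittleO_pow_sub_sub t one_lt_two)
    refine Asymptotics.IsBigO.trans_isLittleO (Asymptotics.IsBigO.of_bound C ?_) hO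
    filter_upwards [hRt] with s hs
    have e1 : ‖((mΔ s).toLp (fun x => φ s x - φ 0 x) : L2R) -
        (mΔ t).toLp (fun x => φ t x - φ 0 x)‖ ^ 2 = ∫ x, (φ s x - φ t x) ^ 2 := by
      rw [← MemLp.toLp_sub, norm_toLp_sq]
      refine integral_congr_ae (Eventually.of_forall fun x => ?_)
      simp
    have e2 : inner ℝ ((mf t).toLp (fun x => deriv U (φ t x)) : L2R)
        ((mΔ s).toLp (fun x => φ s x - φ 0 x)) -
        inner ℝ ((mf t).toLp (fun x => deriv U (φ t x)) : L2R)
          ((mΔ t).toLp (fun x => φ t x - φ 0 x)) =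
        ∫ x, deriv U (φ t x) * (φ s x - φ t x) := by
      rw [← inner_sub_right, ← MemLp.toLp_sub, inner_toLp]
      refine integral_congr_ae (Eventually.of_forall fun x => ?_)
      simp
    have mst := (h.inSector s).memLp_sub hU hm hp (h.inSector t)
    have i1 : Integrable fun x => deriv U (φ t x) * (φ s x - φ t x) := (mf t).integrable_mul mst
    have i2 : Integrable fun x => U (φ s x) - U (φ t x) := (iU s).sub (iU t)
    rw [smul_zero, sub_zero, e1, Real.norm_of_nonneg (integral_nonneg fun x => sq_nonneg _)]
    rw [show ∀ a b c d : ℝ, a - b - (c - d) = a - c - (b - d) from fun a b c d => by ring, e2,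
      ← integral_sub (iU s) (iU t), ← integral_sub i2 i1, ← integral_const_mul]
    refine (norm_integral_le_integral_norm _).trans
      (integral_mono (i2.sub i1).norm (mst.integrable_sq.const_mul C) fun x => ?_)
    exact (hC _ (hR x) _ (hs x)).2
  simpa using h2.fun_add h1

/-- Conservation of energy. -/
theorem energy_eq (hm : ιm = 1 ∨ ιm = -1) (hp : ιp = 1 ∨ ιp = -1) (t : ℝ) :
    energy U (φ t) (ψ t) = energy U (φ 0) (ψ 0) := by
  have hd : ∀ t, HasDerivAt (fun t => (1 / 2 * (∫ x, ψ t x ^ 2) +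
      1 / 2 * ∫ x, deriv (φ t) x ^ 2) + ∫ x, U (φ t x)) 0 t := fun t => by
    simpa using (h.hasDerivAt_kinetic hU t).fun_add (h.hasDerivAt_integral_potential hU hm hp t)
  have hconst := is_const_of_deriv_eq_zero (fun t => (hd t).differentiableAt)
    (fun t => (hd t).deriv) t 0
  have hsplit : ∀ t, 1 / 2 * (∫ x, ψ t x ^ 2) + ∫ x, density U (φ t) x =
      (1 / 2 * (∫ x, ψ t x ^ 2) + 1 / 2 * ∫ x, deriv (φ t) x ^ 2) + ∫ x, U (φ t x) := fun t => by
    have hi := (h.inSector t).integrable_density hU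
    have e : (fun x => density U (φ t) x) = fun x => 1 / 2 * deriv (φ t) x ^ 2 + U (φ t x) := rfl
    rw [e, integral_add ((hU.integrable_deriv_sq hi).const_mul _)
      (hU.integrable_potential (h.inSector t).absolutelyContinuous hi), integral_const_mul]
    ring
  rw [(h.inSector t).energy_eq hU, (h.inSector 0).energy_eq hU, hsplit, hsplit, hconst]

end IsSolutionInSector

/-! ### Continuous choice of the kink positions. -/

theorem LocAC.h1NormSq_sub_eq {u w : ℝ → ℝ} (hu : LocAC u) (hw : LocAC w) :
    h1NormSq (fun x => u x - w x) =
      ∫⁻ x, ENNReal.ofReal ((u x - w x) ^ 2 + (deriv u x - deriv w x) ^ 2) := by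
  have hm : Measurable fun x => ENNReal.ofReal ((u x - w x) ^ 2) :=
    (((hu.continuous.sub hw.continuous).pow 2).measurable).ennreal_ofReal
  rw [h1NormSq, l2NormSq_eq_lintegral, l2NormSq_eq_lintegral, ← lintegral_add_left hm]
  refine lintegral_congr_ae ?_
  filter_upwards [hu.deriv_sub_ae hw] with x hx
  rw [hx, ENNReal.ofReal_add (sq_nonneg _) (sq_nonneg _)]

theorem LocAC.h1NormSq_sub_comm {u w : ℝ → ℝ} (hu : LocAC u) (hw : LocAC w) :
    h1NormSq (fun x => u x - w x) = h1NormSq (fun x => w x - u x) := by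
  rw [hu.h1NormSq_sub_eq hw, hw.h1NormSq_sub_eq hu]
  refine lintegral_congr fun x => ?_
  congr 1
  ring

theorem LocAC.h1NormSq_sub_le {u v w : ℝ → ℝ} (hu : LocAC u) (hv : LocAC v) (hw : LocAC w) :
    h1NormSq (fun x => u x - w x) ≤
      2 * h1NormSq (fun x => u x - v x) + 2 * h1NormSq (fun x => v x - w x) := by
  have hm : Measurable fun x =>
      2 * ENNReal.ofReal ((u x - v x) ^ 2 + (deriv u x - deriv v x) ^ 2) :=
    ((((hu.continuous.sub hv.continuous).pow 2).measurable.add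
      (((measurable_deriv u).sub (measurable_deriv v)).pow_const 2)).ennreal_ofReal).const_mul 2
  rw [hu.h1NormSq_sub_eq hw, hu.h1NormSq_sub_eq hv, hv.h1NormSq_sub_eq hw,
    ← lintegral_const_mul' _ _ ENNReal.ofNat_ne_top, ← lintegral_const_mul' _ _
      ENNReal.ofNat_ne_top, ← lintegral_add_left hm]
  refine lintegral_mono fun x => ?_
  rw [← ENNReal.ofReal_ofNat, ← ENNReal.ofReal_mul (by norm_num),
    ← ENNReal.ofReal_mul (by norm_num), ← ENNReal.ofReal_add (by positivity) (by positivity)]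
  refine ENNReal.ofReal_le_ofReal ?_
  nlinarith [sq_nonneg ((u x - v x) - (v x - w x)),
    sq_nonneg ((deriv u x - deriv v x) - (deriv v x - deriv w x))]

theorem LocAC.h1NormSq_sub_le_ofReal {u v w : ℝ → ℝ} (hu : LocAC u) (hv : LocAC v) (hw : LocAC w)
    {p q : ℝ} (hp : 0 ≤ p) (hq : 0 ≤ q) (h1 : h1NormSq (fun x => u x - v x) ≤ ENNReal.ofReal p)
    (h2 : h1NormSq (fun x => v x - w x) ≤ ENNReal.ofReal q) :
    h1NormSq (fun x => u x - w x) ≤ ENNReal.ofReal (2 * p + 2 * q) := by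
  refine (hu.h1NormSq_sub_le hv hw).trans ?_
  rw [ENNReal.ofReal_add (by positivity) (by positivity), ENNReal.ofReal_mul (by norm_num),
    ENNReal.ofReal_mul (by norm_num), ENNReal.ofReal_ofNat]
  gcongr

theorem Separated.convex {n : ℕ} (L : ℝ) : Convex ℝ {a : Fin n → ℝ | Separated L a} := by
  intro a ha b hb p q hp hq hpq i j hij
  have h1 := ha i j hij
  have h2 := hb i j hij
  simp only [Pi.add_apply, Pi.smul_apply, smul_eq_mul]
  nlinarith [mul_le_mul_of_nonneg_left h1 hp, mul_le_mul_of_nonneg_left h2 hq,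
    congrArg (· * (2 * L)) hpq]

theorem Separated.mono {n : ℕ} {L L' : ℝ} {a : Fin n → ℝ} (h : Separated L a) (hL : L' ≤ L) :
    Separated L' a := fun i j hij => by linarith [h i j hij]

namespace IsPotential

variable {U : ℝ → ℝ} (hU : IsPotential U)
include hU

local notation "W" => superpotential U
local notation "H" => kink U

theorem locAC_multiKink {n : ℕ} (a : Fin n → ℝ) : LocAC (multiKink U a) :=
  LocAC.of_contDiff (hU.contDiff_multiKink a)

/-- Shifting one kink by at most `η` changes `H` by at most `2η H'` and `H'` by at most `2Kη H'`. As
`H'² = 2U(H)` and `∫ U(H) = W(1)`, each kink contributes `(8 + 8K²) η² W(1)`; one factor `n` counts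
the kinks and the other comes from Cauchy–Schwarz. -/
theorem exists_h1NormSq_multiKink_sub_le : ∃ C η₀ : ℝ, 0 < C ∧ 0 < η₀ ∧
    ∀ (n : ℕ) (a b : Fin n → ℝ) (η : ℝ), η ≤ η₀ → (∀ k, |a k - b k| ≤ η) →
      h1NormSq (fun x => multiKink U a x - multiKink U b x) ≤
        ENNReal.ofReal (C * n ^ 2 * η ^ 2) := by
  obtain ⟨K, hK, hKink⟩ := hU.exists_kink_translate_le
  have hW := hU.superpotential_one_pos
  refine ⟨(8 + 8 * K ^ 2) * W 1, 1 / (2 * K), by positivity, by positivity,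
    fun n a b η hη hab => ?_⟩
  rw [(hU.locAC_multiKink a).h1NormSq_sub_eq (hU.locAC_multiKink b)]
  have hpt : ∀ x, (multiKink U a x - multiKink U b x) ^ 2 +
      (deriv (multiKink U a) x - deriv (multiKink U b) x) ^ 2 ≤
      ∑ k : Fin n, n * ((8 + 8 * K ^ 2) * η ^ 2) * U (H (x - b k)) := by
    intro x
    have e1 : multiKink U a x - multiKink U b x =
        ∑ k : Fin n, (-1 : ℝ) ^ ((k : ℕ) + 1) * (H (x - a k) - H (x - b k)) := by
      rw [multiKink, multiKink, add_sub_add_left_eq_sub, ← Finset.sum_sub_distrib]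
      exact Finset.sum_congr rfl fun k _ => by ring
    have e2 : deriv (multiKink U a) x - deriv (multiKink U b) x =
        ∑ k : Fin n, (-1 : ℝ) ^ ((k : ℕ) + 1) * (deriv H (x - a k) - deriv H (x - b k)) := by
      rw [hU.deriv_multiKink, hU.deriv_multiKink, ← Finset.sum_sub_distrib]
      exact Finset.sum_congr rfl fun k _ => by ring
    have c1 := sq_sum_le_card_mul_sum_sq (s := (Finset.univ : Finset (Fin n)))
      (f := fun k => (-1 : ℝ) ^ ((k : ℕ) + 1) * (H (x - a k) - H (x - b k)))
    have c2 := sq_sum_le_card_mul_sum_sq (s := (Finset.univ : Finset (Fin n)))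
      (f := fun k => (-1 : ℝ) ^ ((k : ℕ) + 1) * (deriv H (x - a k) - deriv H (x - b k)))
    rw [e1, e2]
    refine (add_le_add c1 c2).trans ?_
    rw [Finset.card_univ, Fintype.card_fin, ← mul_add, ← Finset.sum_add_distrib, Finset.mul_sum]
    refine Finset.sum_le_sum fun k _ => ?_
    rw [mul_assoc]
    refine mul_le_mul_of_nonneg_left ?_ (Nat.cast_nonneg n)
    have hs : ((-1 : ℝ) ^ ((k : ℕ) + 1)) ^ 2 = 1 := sq_eq_one_of_sign (neg_one_pow_eq _)
    have hd : |b k - a k| ≤ η := by rw [abs_sub_comm]; exact hab k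
    obtain ⟨k1, k2⟩ := hKink (x - b k) (b k - a k) (hd.trans hη)
    rw [show x - b k + (b k - a k) = x - a k by ring] at k1 k2
    have hη0 : 0 ≤ η := (abs_nonneg _).trans hd
    have hH' := hU.deriv_kink_nonneg (x - b k)
    have q1 : (H (x - a k) - H (x - b k)) ^ 2 ≤ (2 * η * deriv H (x - b k)) ^ 2 := by
      rw [← sq_abs]
      exact pow_le_pow_left₀ (abs_nonneg _) (k1.trans (by gcongr)) 2
    have q2 : (deriv H (x - a k) - deriv H (x - b k)) ^ 2 ≤
        (2 * K * η * deriv H (x - b k)) ^ 2 := by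
      rw [← sq_abs]
      exact pow_le_pow_left₀ (abs_nonneg _) (k2.trans (by gcongr)) 2
    have hsq := hU.deriv_kink_sq (x - b k)
    simp only [mul_pow, hs, one_mul] at q1 q2 ⊢
    rw [hsq] at q1 q2
    linarith
  refine (lintegral_mono fun x => ENNReal.ofReal_le_ofReal (hpt x)).trans ?_
  have hint : ∀ k, Integrable fun x => (n : ℝ) * ((8 + 8 * K ^ 2) * η ^ 2) * U (H (x - b k)) :=
    fun k => (hU.integrable_potential_kink.comp_sub_right (b k)).const_mul _
  rw [← ofReal_integral_eq_lintegral_ofReal (integrable_finsetSum _ fun k _ => hint k)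
    (Eventually.of_forall fun x => Finset.sum_nonneg fun k _ =>
      mul_nonneg (by positivity) (hU.nonneg _)), integral_finsetSum _ fun k _ => hint k]
  refine ENNReal.ofReal_le_ofReal (le_of_eq ?_)
  have hI : ∀ k, ∫ x, (n : ℝ) * ((8 + 8 * K ^ 2) * η ^ 2) * U (H (x - b k)) =
      n * ((8 + 8 * K ^ 2) * η ^ 2) * W 1 := fun k => by
    have h2 := hU.integral_potential_kink
    rw [integral_const_mul] at h2
    rw [integral_const_mul, integral_sub_right_eq_self (fun x => U (H x)) (b k)]
    congr 1
    linarith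
  simp only [hI, Finset.sum_const, Finset.card_univ, Fintype.card_fin, nsmul_eq_mul]
  ring

variable {n : ℕ} {L : ℝ} {a : Fin n → ℝ}

theorem one_sub_kink_nonneg (x : ℝ) : 0 ≤ 1 - H x := by
  linarith [(hU.kink_mem x).2]

theorem one_sub_kink_abs_le {y : ℝ} (hy : L ≤ |y|) : 1 - H |y| ≤ 1 - H L := by
  linarith [hU.kink_strictMono.monotone hy]

/-- At `a k` the `k`-th kink vanishes and the others have almost reached their limits. -/
theorem abs_multiKink_apply_le (ha : Separated L a) (hL : 0 ≤ L) (k : Fin n) :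
    |multiKink U a (a k)| ≤ n * (1 - H L) := by
  have h := hU.abs_multiKink_sub_kink_le a (a k) k (fun j hj => ha.monotone hL hj.le)
    (fun j hj => ha.monotone hL hj.le)
  rw [sub_self, hU.kink_zero, mul_zero, sub_zero] at h
  refine h.trans ((Finset.sum_le_card_nsmul _ _ (1 - H L) fun j hj => ?_).trans ?_)
  · refine hU.one_sub_kink_abs_le ?_
    rcases lt_or_gt_of_ne (Finset.ne_of_mem_erase hj) with h1 | h1
    · exact le_abs.2 (Or.inl (by linarith [ha j k h1]))
    · exact le_abs.2 (Or.inr (by linarith [ha k j h1]))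
  · rw [nsmul_eq_mul]
    refine mul_le_mul_of_nonneg_right ?_ (hU.one_sub_kink_nonneg L)
    exact_mod_cast (Finset.card_le_univ _).trans_eq (Fintype.card_fin n)

theorem abs_multiKink_sub_sign_le_of_away {x : ℝ} (hL : 0 ≤ L) {m : ℕ} (hm : m ≤ n)
    (h1 : ∀ j : Fin n, (j : ℕ) < m → a j + L ≤ x) (h2 : ∀ j : Fin n, m ≤ j → x ≤ a j - L) :
    |multiKink U a x - (-1) ^ m| ≤ n * (1 - H L) := by
  refine (hU.abs_multiKink_sub_sign_le a x hm (fun j hj => by linarith [h1 j hj])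
    fun j hj => by linarith [h2 j hj]).trans
    ((Finset.sum_le_card_nsmul _ _ (1 - H L) fun j _ => ?_).trans_eq (by simp))
  refine hU.one_sub_kink_abs_le ?_
  rcases lt_or_ge (j : ℕ) m with h | h
  · exact le_abs.2 (Or.inl (by linarith [h1 j h]))
  · exact le_abs.2 (Or.inr (by linarith [h2 j h]))

/-- A multi-kink vanishes only near the positions of its kinks. -/
theorem le_abs_multiKink (ha : Separated L a) (hL : 0 ≤ L) {η x : ℝ}
    (hx : ∀ k, η ≤ |x - a k|) : H η - n * (1 - H L) ≤ |multiKink U a x| := by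
  by_cases hmem : ∃ k, x ∈ Ioc (a k - L) (a k + L)
  · obtain ⟨k, hk⟩ := hmem
    obtain ⟨h1, h2⟩ := ha.away_of_mem hk
    have h := hU.abs_multiKink_sub_kink_le a x k (fun j hj => by linarith [h1 j hj])
      (fun j hj => by linarith [h2 j hj])
    have h3 : ∑ j ∈ Finset.univ.erase k, (1 - H |x - a j|) ≤ n * (1 - H L) := by
      refine (Finset.sum_le_card_nsmul _ _ (1 - H L) fun j hj => ?_).trans ?_
      · refine hU.one_sub_kink_abs_le ?_
        rcases lt_or_gt_of_ne (Finset.ne_of_mem_erase hj) with h4 | h4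
        · exact le_abs.2 (Or.inl (by linarith [h1 j h4]))
        · exact le_abs.2 (Or.inr (by linarith [h2 j h4]))
      · rw [nsmul_eq_mul]
        refine mul_le_mul_of_nonneg_right ?_ (hU.one_sub_kink_nonneg L)
        exact_mod_cast (Finset.card_le_univ _).trans_eq (Fintype.card_fin n)
    have h4 : H η ≤ |(-1) ^ ((k : ℕ) + 1) * H (x - a k)| := by
      rw [abs_mul, abs_neg_one_pow_real, one_mul]
      have h5 := hU.kink_strictMono.monotone (hx k)
      rcases abs_cases (x - a k) with ⟨h6, -⟩ | ⟨h6, -⟩ <;> rw [h6] at h5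
      · exact h5.trans (le_abs_self _)
      · rw [hU.kink_neg] at h5
        exact h5.trans (neg_le_abs _)
    have h5 := abs_sub_abs_le_abs_sub ((-1) ^ ((k : ℕ) + 1) * H (x - a k)) (multiKink U a x)
    rw [abs_sub_comm] at h5
    linarith
  · push Not at hmem
    obtain ⟨m, hm, h1, h2⟩ := ha.away_of_notMem hL hmem
    have h3 := hU.abs_multiKink_sub_sign_le_of_away hL hm h1 h2
    have h4 := abs_sub_abs_le_abs_sub ((-1 : ℝ) ^ m) (multiKink U a x)
    rw [abs_sub_comm, abs_neg_one_pow_real] at h4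
    linarith [(hU.kink_mem η).2]

/-- Two separated multi-kinks that are uniformly close have close kink positions. -/
theorem abs_sub_le_of_abs_multiKink_sub_le {b : Fin n → ℝ} (ha : Separated L a)
    (hb : Separated L b) (hL : 0 ≤ L) {η δ : ℝ} (hηL : η < L)
    (hδ : δ + 2 * (n * (1 - H L)) < H η)
    (hab : ∀ x, |multiKink U a x - multiKink U b x| ≤ δ) (k : Fin n) : |a k - b k| ≤ η := by
  -- The first multi-kink almost vanishes at `a k`, so the second is small there; by
  -- `le_abs_multiKink` this is possible only near one of its kinks.
  have hex : ∀ k, ∃ j, |a k - b j| < η := by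
    intro k
    by_contra! hcon
    have h1 := hU.le_abs_multiKink hb hL hcon
    have h2 := hU.abs_multiKink_apply_le ha hL k
    have h3 := abs_sub_abs_le_abs_sub (multiKink U b (a k)) (multiKink U a (a k))
    rw [abs_sub_comm] at h3
    linarith [hab (a k)]
  choose σ hσ using hex
  -- Distinct positions are at least `2L > 2η` apart, so the matching preserves the strict order; a
  -- strictly increasing self-map of `Fin n` is the identity.
  have hmono : StrictMono σ := by
    intro i j hij
    by_contra! hcon
    have h1 := hb.monotone hL hcon
    have h2 := abs_lt.1 (hσ i)
    have h3 := abs_lt.1 (hσ j)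
    linarith [ha i j hij]
  have hid : σ k = k := by
    have hs : Function.Surjective σ := Finite.surjective_of_injective hmono.injective
    have := hmono.range_inj (g := id) strictMono_id
    rw [hs.range_eq, range_id] at this
    exact congrFun (this.1 rfl) k
  have := hσ k
  rw [hid] at this
  exact this.le

/-- All widely separated positions that fit the same `u` lie within `η` of each other, hence so does
their convex hull, and moving the kinks by `η` costs little in `H¹`. This convexity is what permits
a continuous selection. -/
theorem exists_convexHull_close (n : ℕ) (ε₀ L₀ : ℝ) (hε₀ : 0 < ε₀) : ∃ ε L : ℝ, 0 < ε ∧ 0 < L ∧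
    ∀ u : ℝ → ℝ, LocAC u → ∀ a ∈ convexHull ℝ {b : Fin n → ℝ | Separated L b ∧
      h1NormSq (fun x => u x - multiKink U b x) ≤ ENNReal.ofReal ε},
      Separated L₀ a ∧ h1NormSq (fun x => u x - multiKink U a x) ≤ ENNReal.ofReal ε₀ := by
  obtain ⟨C, η₀, hC, hη₀, hpert⟩ := hU.exists_h1NormSq_multiKink_sub_le
  obtain ⟨η, hη, hη1, hηC⟩ : ∃ η : ℝ, 0 < η ∧ η ≤ η₀ ∧ C * n ^ 2 * η ^ 2 ≤ ε₀ / 4 := by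
    have ht : Tendsto (fun η : ℝ => C * n ^ 2 * η ^ 2) (𝓝[>] 0) (𝓝 0) := by
      have : Tendsto (fun η : ℝ => C * n ^ 2 * η ^ 2) (𝓝 0) (𝓝 (C * n ^ 2 * 0 ^ 2)) :=
        Continuous.tendsto (by fun_prop) 0
      simpa using this.mono_left nhdsWithin_le_nhds
    obtain ⟨η, h1, h2, h3⟩ := ((ht.eventually (ge_mem_nhds (show 0 < ε₀ / 4 by positivity))).and
      ((Ioc_mem_nhdsGT hη₀ : ∀ᶠ η in 𝓝[>] (0 : ℝ), η ∈ Ioc 0 η₀))).exists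
    exact ⟨η, h2, h3, h1⟩
  have hHη : 0 < H η := by
    have := hU.kink_strictMono hη
    rwa [hU.kink_zero] at this
  obtain ⟨L, hLL, hLη, hL0⟩ : ∃ L : ℝ, 2 * (n * (1 - H L)) < H η / 2 ∧ max η L₀ < L ∧ 0 < L := by
    have ht : Tendsto (fun L : ℝ => 2 * (n * (1 - H L))) atTop (𝓝 0) := by
      simpa using ((hU.tendsto_kink_atTop.const_sub 1).const_mul (n : ℝ)).const_mul 2
    exact ((ht.eventually (gt_mem_nhds (half_pos hHη))).and
      ((eventually_gt_atTop _).and (eventually_gt_atTop 0))).exists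
  -- Two admissible multi-kinks differ by at most `4ε` in squared `H¹` norm, hence by `8ε` in
  -- squared sup norm, which must be below `(H η / 4)²`. The bound `ε₀ / 4` leaves room for the
  -- final triangle inequality.
  obtain ⟨ε, hε, hε1, hε2⟩ : ∃ ε : ℝ, 0 < ε ∧ ε ≤ ε₀ / 4 ∧ 8 * ε ≤ (H η / 4) ^ 2 :=
    ⟨min (ε₀ / 4) ((H η / 4) ^ 2 / 8), by positivity, min_le_left _ _, by
      linarith [min_le_right (ε₀ / 4) ((H η / 4) ^ 2 / 8)]⟩
  refine ⟨ε, L, hε, hL0, fun u hu a ha => ?_⟩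
  have hsep : Separated L a := convexHull_min (fun b hb => hb.1) (Separated.convex L) ha
  refine ⟨hsep.mono ((le_max_right _ _).trans hLη.le), ?_⟩
  obtain ⟨b, hb⟩ := convexHull_nonempty_iff.1 ⟨a, ha⟩
  have hclose : ∀ k, |a k - b k| ≤ η := by
    have hsub : {c : Fin n → ℝ | Separated L c ∧
        h1NormSq (fun x => u x - multiKink U c x) ≤ ENNReal.ofReal ε} ⊆
        univ.pi fun k => Metric.closedBall (b k) η := by
      intro c hc k _
      rw [Metric.mem_closedBall, Real.dist_eq]
      refine hU.abs_sub_le_of_abs_multiKink_sub_le hc.1 hb.1 hL0.le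
        ((le_max_left _ _).trans_lt hLη) (δ := H η / 4) (by linarith) (fun x => ?_) k
      have h1 : h1NormSq (fun x => multiKink U c x - multiKink U b x) ≤
          ENNReal.ofReal (2 * ε + 2 * ε) :=
        (hU.locAC_multiKink c).h1NormSq_sub_le_ofReal hu (hU.locAC_multiKink b) hε.le hε.le
          (by rw [(hU.locAC_multiKink c).h1NormSq_sub_comm hu]; exact hc.2) hb.2
      have h2 := ((hU.locAC_multiKink c).sub (hU.locAC_multiKink b)).sq_le_of_h1NormSq_le
        (by positivity) h1 x
      exact abs_le_of_sq_le_sq (by linarith) (by positivity)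
    have := convexHull_min hsub (convex_pi fun k _ => convex_closedBall (b k) η) ha
    intro k
    have h1 := this k (mem_univ k)
    rwa [Metric.mem_closedBall, Real.dist_eq] at h1
  have h1 := hpert n a b η hη1 hclose
  rw [(hU.locAC_multiKink a).h1NormSq_sub_comm (hU.locAC_multiKink b)] at h1
  refine (hu.h1NormSq_sub_le_ofReal (hU.locAC_multiKink b) (hU.locAC_multiKink a) hε.le
    (by positivity) hb.2 h1).trans (ENNReal.ofReal_le_ofReal ?_)
  linarith

/-- The modulation parameters of a curve of approximate multi-kinks can be chosen continuously. -/
theorem exists_continuous_parameters {φ : ℝ → ℝ → ℝ} (hφ : ∀ t, LocAC (φ t))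
    (hc : ∀ t₀, Tendsto (fun t => h1NormSq fun x => φ t x - φ t₀ x) (𝓝 t₀) (𝓝 0))
    {b : ℝ → Fin n → ℝ} (hsep : ∀ L, 0 < L → ∀ᶠ t in atTop, Separated L (b t))
    (hb : ∀ ε, 0 < ε → ∀ᶠ t in atTop,
      h1NormSq (fun x => φ t x - multiKink U (b t) x) ≤ ENNReal.ofReal ε) :
    ∃ a : ℝ → Fin n → ℝ, Continuous a ∧ (∀ L, ∀ᶠ t in atTop, Separated L (a t)) ∧
      ∀ ε, 0 < ε → ∀ᶠ t in atTop,
        h1NormSq (fun x => φ t x - multiKink U (a t) x) ≤ ENNReal.ofReal ε := by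
  -- Selection from a family of convex sets, for which it suffices that each `b t₀` belong to the
  -- sets at all `t` near `t₀`. The condition `t - 1 < s` sends the reference times to infinity with
  -- `t`, and `exp (-t)` makes the reference states asymptotically equal to `φ t`.
  obtain ⟨a, ha⟩ := exists_continuous_forall_mem_convex_of_local_const
    (t := fun t => convexHull ℝ {c : Fin n → ℝ | ∃ s, t - 1 < s ∧ c = b s ∧
      h1NormSq (fun x => φ t x - φ s x) < ENNReal.ofReal (Real.exp (-t))})
    (fun t => convex_convexHull ℝ _) (fun t₀ => ⟨b t₀, by
      have h1 : Tendsto (fun t => ENNReal.ofReal (Real.exp (-t))) (𝓝 t₀)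
          (𝓝 (ENNReal.ofReal (Real.exp (-t₀)))) :=
        ENNReal.tendsto_ofReal (Continuous.tendsto (by fun_prop) t₀)
      have h2 := (hc t₀).eventually_lt h1 (ENNReal.ofReal_pos.2 (Real.exp_pos _))
      filter_upwards [h2, gt_mem_nhds (lt_add_one t₀)] with t ht ht1
      exact subset_convexHull ℝ _ ⟨t₀, by linarith, rfl, ht⟩⟩)
  have key : ∀ ε₀ L₀ : ℝ, 0 < ε₀ → ∀ᶠ t in atTop, Separated L₀ (a t) ∧
      h1NormSq (fun x => φ t x - multiKink U (a t) x) ≤ ENNReal.ofReal ε₀ := by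
    intro ε₀ L₀ hε₀
    obtain ⟨ε, L, hε, hL, hull⟩ := hU.exists_convexHull_close n ε₀ L₀ hε₀
    obtain ⟨T, hT⟩ := eventually_atTop.1 ((hsep L hL).and (hb (ε / 4) (by positivity)))
    have hexp : Tendsto (fun t : ℝ => Real.exp (-t)) atTop (𝓝 0) :=
      Real.tendsto_exp_neg_atTop_nhds_zero
    filter_upwards [eventually_ge_atTop (T + 1),
      hexp.eventually (ge_mem_nhds (show 0 < ε / 4 by positivity))] with t ht hte
    refine hull (φ t) (hφ t) (a t) (convexHull_mono ?_ (ha t))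
    rintro c ⟨s, hs, rfl, hts⟩
    obtain ⟨h1, h2⟩ := hT s (by linarith)
    refine ⟨h1, ((hφ t).h1NormSq_sub_le_ofReal (hφ s) (hU.locAC_multiKink _) (p := ε / 4)
      (q := ε / 4) (by positivity) (by positivity)
      (hts.le.trans (ENNReal.ofReal_le_ofReal hte)) h2).trans (ENNReal.ofReal_le_ofReal ?_)⟩
    linarith
  exact ⟨a, a.continuous, fun L => (key 1 L one_pos).mono fun t h => h.1,
    fun ε hε => (key ε 0 hε).mono fun t h => h.2⟩

end IsPotential

/-! ### Upper bound for the energy near a multi-kink. -/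

theorem LocAC.integrable_of_h1NormSq_sub_le {u w : ℝ → ℝ} (hu : LocAC u) (hw : LocAC w) {ε : ℝ}
    (hε : 0 ≤ ε) (h : h1NormSq (fun x => u x - w x) ≤ ENNReal.ofReal ε) :
    Integrable (fun x => (u x - w x) ^ 2 + (deriv u x - deriv w x) ^ 2) ∧
      ∫ x, ((u x - w x) ^ 2 + (deriv u x - deriv w x) ^ 2) ≤ ε := by
  rw [hu.h1NormSq_sub_eq hw] at h
  have h0 : ∀ x, 0 ≤ (u x - w x) ^ 2 + (deriv u x - deriv w x) ^ 2 := fun x => by positivity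
  have hm : Measurable fun x => (u x - w x) ^ 2 + (deriv u x - deriv w x) ^ 2 :=
    ((hu.continuous.sub hw.continuous).pow 2).measurable.add
      (((measurable_deriv u).sub (measurable_deriv w)).pow_const 2)
  have hi : Integrable (fun x => (u x - w x) ^ 2 + (deriv u x - deriv w x) ^ 2) :=
    (lintegral_ofReal_ne_top_iff_integrable hm.aestronglyMeasurable
      (Eventually.of_forall h0)).1 (h.trans_lt ENNReal.ofReal_lt_top).ne
  refine ⟨hi, ?_⟩
  rwa [← ofReal_integral_eq_lintegral_ofReal hi (Eventually.of_forall h0),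
    ENNReal.ofReal_le_ofReal_iff hε] at h

/-- The coefficient of the main term can be brought arbitrarily close to `1`, as needed for an
energy bound without loss in the limit. -/
theorem sq_le_young {θ : ℝ} (hθ : 0 < θ) (p q : ℝ) :
    p ^ 2 ≤ (1 + θ) * q ^ 2 + (1 + 1 / θ) * (p - q) ^ 2 := by
  have h : (1 + θ) * q ^ 2 + (1 + 1 / θ) * (p - q) ^ 2 - p ^ 2 = (θ * q - (p - q)) ^ 2 / θ := by
    field_simp
    ring
  have : 0 ≤ (θ * q - (p - q)) ^ 2 / θ := by positivity
  linarith

/-- Points interlacing with the kinks, at distance at least `L` of them. -/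
theorem Separated.exists_interlacing {n : ℕ} {L : ℝ} {b : Fin n → ℝ} (h : Separated L b)
    (hL : 0 ≤ L) : ∃ x : Fin (n + 1) → ℝ, Monotone x ∧
      ∀ k : Fin (n + 1), (∀ j : Fin n, (j : ℕ) < k → b j + L ≤ x k) ∧
        ∀ j : Fin n, (k : ℕ) ≤ j → x k ≤ b j - L := by
  rcases Nat.eq_zero_or_pos n with rfl | hn
  · exact ⟨fun _ => 0, fun _ _ _ => le_rfl, fun k => ⟨fun j => j.elim0, fun j => j.elim0⟩⟩
  -- The point number `k < n` sits at distance `L` before the next kink; the last one, `k = n`, at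
  -- distance `L` after the last kink.
  have hx : ∀ k : Fin (n + 1), (∀ j : Fin n, (j : ℕ) < k →
      b j + L ≤ if hk : (k : ℕ) < n then b ⟨k, hk⟩ - L else b ⟨n - 1, by omega⟩ + L) ∧
      ∀ j : Fin n, (k : ℕ) ≤ j →
        (if hk : (k : ℕ) < n then b ⟨k, hk⟩ - L else b ⟨n - 1, by omega⟩ + L) ≤ b j - L := by
    intro k
    split_ifs with hk
    · refine ⟨fun j hj => ?_, fun j hj => ?_⟩
      · linarith [h j ⟨k, hk⟩ (Fin.lt_def.2 hj)]
      · linarith [h.monotone hL (show (⟨k, hk⟩ : Fin n) ≤ j from Fin.le_def.2 hj)]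
    · refine ⟨fun j hj => ?_, fun j hj => absurd (hj.trans_lt j.isLt) hk⟩
      linarith [h.monotone hL (show j ≤ (⟨n - 1, by omega⟩ : Fin n) from
        Fin.le_def.2 (by simp only; omega))]
  refine ⟨_, Fin.monotone_iff_le_succ.2 fun i => ?_, hx⟩
  have h1 := (hx i.castSucc).2 i (by simp)
  have h2 := (hx i.succ).1 i (by simp)
  linarith

namespace IsPotential

variable {U : ℝ → ℝ} (hU : IsPotential U)
include hU

local notation "W" => superpotential U
local notation "H" => kink U

theorem abs_multiKink_le {n : ℕ} (a : Fin n → ℝ) (x : ℝ) : |multiKink U a x| ≤ 1 + 2 * n := by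
  rw [multiKink]
  refine (abs_add_le _ _).trans (add_le_add (by simp) ((Finset.abs_sum_le_sum_abs _ _).trans
    ((Finset.sum_le_card_nsmul _ _ 2 fun k _ => ?_).trans_eq (by simp [mul_comm]))))
  have := hU.kink_mem (x - a k)
  rw [abs_mul, abs_neg_one_pow_real, one_mul, abs_of_nonneg (by linarith [this.1])]
  linarith [this.2]

/-- The state is compared pointwise with a single signed kink inside its window and with a vacuum
elsewhere. The error consists of the distance to the multi-kink and of the tails of the kinks
outside their windows. -/
theorem exists_density_le (n : ℕ) : ∃ C : ℝ, 0 < C ∧ ∀ (u : ℝ → ℝ) (b : Fin n → ℝ) (L θ : ℝ),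
    0 ≤ L → 0 < θ → Separated L b → (∀ x, |u x - multiKink U b x| ≤ 1) → ∀ x,
      density U u x ≤ (1 + θ) * (∑ k, 2 * U (H (x - b k))) + (1 + 1 / θ) * (C *
        (((u x - multiKink U b x) ^ 2 + (deriv u x - deriv (multiKink U b) x) ^ 2) +
          ∑ k, (Ioc (b k - L) (b k + L))ᶜ.indicator (fun x => U (H (x - b k))) x)) := by
  obtain ⟨C₁, hC₁, hmk⟩ := hU.exists_multiKink_sq_le
  obtain ⟨K, hK, hlip⟩ := hU.exists_sqrt_lipschitz (2 + 2 * n)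
  refine ⟨(K ^ 2 + 1) * (1 + C₁ * n), by positivity, fun u b L θ hL hθ hsep hclose x => ?_⟩
  have hI : ∀ k, 0 ≤ (Ioc (b k - L) (b k + L))ᶜ.indicator (fun x => U (H (x - b k))) x := fun k =>
    indicator_nonneg (fun _ _ => hU.nonneg _) _
  -- `β` and `β'` are the value and slope of the local reference, `T` bounds its energy density and
  -- `S` the tails. Using the Lipschitz function `√(2U)` makes the potential a square, so that
  -- Young's inequality treats it like the gradient.
  have step : ∀ β β' S T : ℝ, |β| ≤ 1 → (multiKink U b x - β) ^ 2 ≤ C₁ * n * S →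
      (deriv (multiKink U b) x - β') ^ 2 ≤ C₁ * n * S → 1 / 2 * β' ^ 2 + U β ≤ T → 0 ≤ S →
      density U u x ≤ (1 + θ) * T + (1 + 1 / θ) * ((K ^ 2 + 1) * (1 + C₁ * n) *
        (((u x - multiKink U b x) ^ 2 + (deriv u x - deriv (multiKink U b) x) ^ 2) + S)) := by
    intro β β' S T hβ h1 h2 hT hS
    have hu : u x ∈ Icc (-(2 + 2 * n : ℝ)) (2 + 2 * n) := by
      have e1 := abs_le.1 (hclose x)
      have e2 := abs_le.1 (hU.abs_multiKink_le b x)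
      exact ⟨by linarith, by linarith⟩
    have hβ' : β ∈ Icc (-(2 + 2 * n : ℝ)) (2 + 2 * n) := by
      have e1 := abs_le.1 hβ
      have : (0 : ℝ) ≤ n := Nat.cast_nonneg n
      exact ⟨by linarith, by linarith⟩
    have y1 := sq_le_young hθ (√(2 * U (u x))) (√(2 * U β))
    have y2 := sq_le_young hθ (deriv u x) β'
    rw [Real.sq_sqrt (by linarith [hU.nonneg (u x)]),
      Real.sq_sqrt (by linarith [hU.nonneg β])] at y1
    have l1 : (√(2 * U (u x)) - √(2 * U β)) ^ 2 ≤ K ^ 2 * (u x - β) ^ 2 := by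
      rw [← sq_abs, ← sq_abs (u x - β), ← mul_pow]
      exact pow_le_pow_left₀ (abs_nonneg _) (hlip _ hβ' _ hu) 2
    have q1 : (u x - β) ^ 2 ≤ 2 * (u x - multiKink U b x) ^ 2 + 2 * (C₁ * n * S) := by
      nlinarith [sq_nonneg ((u x - multiKink U b x) - (multiKink U b x - β))]
    have q2 : (deriv u x - β') ^ 2 ≤ 2 * (deriv u x - deriv (multiKink U b) x) ^ 2 +
        2 * (C₁ * n * S) := by
      nlinarith [sq_nonneg ((deriv u x - deriv (multiKink U b) x) -
        (deriv (multiKink U b) x - β'))]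
    set A := (u x - multiKink U b x) ^ 2 with hA
    set B := (deriv u x - deriv (multiKink U b) x) ^ 2 with hB
    have hA0 : 0 ≤ A := sq_nonneg _
    have hB0 : 0 ≤ B := sq_nonneg _
    have key : 1 / 2 * ((√(2 * U (u x)) - √(2 * U β)) ^ 2 + (deriv u x - β') ^ 2) ≤
        (K ^ 2 + 1) * (1 + C₁ * n) * ((A + B) + S) := by
      have e1 : K ^ 2 * (u x - β) ^ 2 ≤ K ^ 2 * (2 * A + 2 * (C₁ * n * S)) :=
        mul_le_mul_of_nonneg_left q1 (sq_nonneg K)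
      have e2 : 0 ≤ K ^ 2 * B + K ^ 2 * S + A + S + (K ^ 2 + 1) * (C₁ * n * (A + B)) := by
        positivity
      nlinarith
    have hθ1 : 0 ≤ 1 + 1 / θ := by positivity
    have k1 := mul_le_mul_of_nonneg_left key hθ1
    have k2 := mul_le_mul_of_nonneg_left hT (show 0 ≤ 1 + θ by positivity)
    unfold density
    linarith
  by_cases hmem : ∃ k, x ∈ Ioc (b k - L) (b k + L)
  · obtain ⟨k, hk⟩ := hmem
    obtain ⟨h1, h2⟩ := hsep.away_of_mem hk
    obtain ⟨m1, m2⟩ := (hmk n b x).2.2 k (fun j hj => by linarith [h1 j hj])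
      (fun j hj => by linarith [h2 j hj])
    have hS : ∑ j ∈ Finset.univ.erase k, U (H (x - b j)) ≤
        ∑ k, (Ioc (b k - L) (b k + L))ᶜ.indicator (fun x => U (H (x - b k))) x := by
      refine (Finset.sum_le_sum fun j hj => ?_).trans
        (Finset.sum_le_sum_of_subset_of_nonneg (Finset.erase_subset k Finset.univ)
          fun j _ _ => hI j)
      rw [indicator_of_mem]
      intro hj'
      rcases lt_or_gt_of_ne (Finset.ne_of_mem_erase hj) with h3 | h3
      · linarith [hsep j k h3, hk.1, hj'.2]
      · linarith [hsep k j h3, hk.2, hj'.1]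
    have hc := mul_le_mul_of_nonneg_left hS (show 0 ≤ C₁ * n by positivity)
    refine step ((-1) ^ ((k : ℕ) + 1) * H (x - b k)) ((-1) ^ ((k : ℕ) + 1) * deriv H (x - b k)) _ _
      ?_ (m1.trans hc) (m2.trans hc) ?_ (Finset.sum_nonneg fun k _ => hI k)
    · rw [abs_mul, abs_neg_one_pow_real, one_mul]
      exact (hU.kink_abs_lt _).le
    · rw [hU.apply_sign_mul (neg_one_pow_eq _), mul_pow, sq_eq_one_of_sign (neg_one_pow_eq _),
        hU.deriv_kink_sq]
      have := Finset.single_le_sum (f := fun k => 2 * U (H (x - b k)))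
        (fun j _ => mul_nonneg two_pos.le (hU.nonneg _)) (Finset.mem_univ k)
      linarith
  · push Not at hmem
    obtain ⟨m, hm, h1, h2⟩ := hsep.away_of_notMem hL hmem
    have hS : ∑ j, U (H (x - b j)) =
        ∑ k, (Ioc (b k - L) (b k + L))ᶜ.indicator (fun x => U (H (x - b k))) x :=
      Finset.sum_congr rfl fun j _ => (indicator_of_mem (s := (Ioc (b j - L) (b j + L))ᶜ)
        (hmem j) (fun x => U (H (x - b j)))).symm
    obtain ⟨m1, m2, -⟩ := hmk n b x
    rw [hS] at m1 m2
    refine step ((-1) ^ m) 0 _ _ (abs_neg_one_pow_real m).le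
      (m1 m hm (fun j hj => by linarith [h1 j hj]) fun j hj => by linarith [h2 j hj])
      (by rwa [sub_zero]) ?_ (Finset.sum_nonneg fun k _ => hI k)
    rw [hU.apply_sign (neg_one_pow_eq m)]
    have : 0 ≤ ∑ k, 2 * U (H (x - b k)) :=
      Finset.sum_nonneg fun k _ => mul_nonneg two_pos.le (hU.nonneg _)
    linarith

/-- The potential energy of a state close to a multi-kink is almost at most that of `n` kinks. -/
theorem exists_integral_density_le (n : ℕ) : ∃ C : ℝ, 0 < C ∧
    ∀ (u : ℝ → ℝ) (b : Fin n → ℝ) (L θ ε : ℝ), LocAC u → 0 ≤ L → 0 < θ → 0 ≤ ε → ε ≤ 1 / 2 →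
      Separated L b → h1NormSq (fun x => u x - multiKink U b x) ≤ ENNReal.ofReal ε →
      ∫ x, density U u x ≤
        (1 + θ) * (n * (2 * W 1)) + (1 + 1 / θ) * (C * (ε + n * (W 1 - W (H L)))) := by
  obtain ⟨C, hC, hd⟩ := hU.exists_density_le n
  refine ⟨C, hC, fun u b L θ ε hu hL hθ hε hε1 hsep hclose => ?_⟩
  obtain ⟨i1, j1⟩ := hu.integrable_of_h1NormSq_sub_le (hU.locAC_multiKink b) hε hclose
  have i2 : ∀ k, Integrable fun x => 2 * U (H (x - b k)) := fun k =>
    (hU.integrable_potential_kink.comp_sub_right (b k)).const_mul 2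
  have i3 := fun k => hU.integrable_compl_window_potential_kink L (b k)
  have i2s := integrable_finsetSum Finset.univ fun k _ => i2 k
  have i3s := integrable_finsetSum Finset.univ fun k _ => i3 k
  have hpt := hd u b L θ hL hθ hsep fun x => by
    have := (hu.sub (hU.locAC_multiKink b)).sq_le_of_h1NormSq_le hε hclose x
    exact abs_le_of_sq_le_sq (by linarith) one_pos.le
  refine (integral_mono_of_nonneg (Eventually.of_forall fun x => hU.density_nonneg u x)
    ((i2s.const_mul _).fun_add (((i1.fun_add i3s).const_mul C).const_mul _))
    (Eventually.of_forall hpt)).trans ?_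
  have e2 : ∀ k, ∫ x, 2 * U (H (x - b k)) = 2 * W 1 := fun k => by
    rw [integral_sub_right_eq_self (fun x => 2 * U (H x)) (b k), hU.integral_potential_kink]
  have e3 := fun k => hU.integral_compl_window_potential_kink hL (b k)
  rw [integral_add (i2s.const_mul _) (((i1.fun_add i3s).const_mul C).const_mul _),
    integral_const_mul, integral_const_mul, integral_const_mul, integral_add i1 i3s,
    integral_finsetSum _ fun k _ => i2 k, integral_finsetSum _ fun k _ => i3 k]
  simp only [e2, e3, Finset.sum_const, Finset.card_univ, Fintype.card_fin, nsmul_eq_mul]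
  gcongr

end IsPotential

/-! ### The two implications. -/

theorem gapWeight_nonneg {n : ℕ} (a : Fin n → ℝ) : 0 ≤ gapWeight a :=
  Finset.sum_nonneg fun _ _ => (Real.exp_pos _).le

theorem integral_sq_nonneg (v : ℝ → ℝ) : 0 ≤ ∫ x, v x ^ 2 := integral_nonneg fun _ => sq_nonneg _

namespace IsSolutionInSector

variable {U : ℝ → ℝ} {ιm ιp : ℝ} {φ ψ : ℝ → ℝ → ℝ} (h : IsSolutionInSector U ιm ιp φ ψ)
include h

theorem locAC (t : ℝ) : LocAC (φ t) := (h.inSector t).absolutelyContinuous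

variable (hU : IsPotential U) (hm : ιm = 1 ∨ ιm = -1) (hp : ιp = 1 ∨ ιp = -1)
include hU

local notation "W" => superpotential U
local notation "H" => kink U

include hm hp in
theorem integral_energy_eq (t : ℝ) :
    1 / 2 * (∫ x, ψ t x ^ 2) + ∫ x, density U (φ t) x =
      1 / 2 * (∫ x, ψ 0 x ^ 2) + ∫ x, density U (φ 0) x := by
  have h1 := h.energy_eq hU hm hp t
  have p0 := fun t => integral_sq_nonneg (ψ t)
  have p1 : ∀ t, 0 ≤ ∫ x, density U (φ t) x := fun t =>
    integral_nonneg fun x => hU.density_nonneg (φ t) x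
  rw [(h.inSector t).energy_eq hU, (h.inSector 0).energy_eq hU, ENNReal.ofReal_eq_ofReal_iff] at h1
  · exact h1
  · linarith [p0 t, p1 t]
  · linarith [p0 0, p1 0]

theorem energy_le_iff (n : ℕ) : energy U (φ 0) (ψ 0) ≤ n * potentialEnergy U H ↔
    1 / 2 * (∫ x, ψ 0 x ^ 2) + (∫ x, density U (φ 0) x) ≤ n * (2 * W 1) := by
  have hW := hU.superpotential_one_pos
  rw [(h.inSector 0).energy_eq hU, hU.potentialEnergy_kink, ← ENNReal.ofReal_natCast,
    ← ENNReal.ofReal_mul (by positivity), ENNReal.ofReal_le_ofReal_iff (by positivity)]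

include hm hp in
/-- The energy of a cluster is that of its kinks, and its kinetic energy vanishes. -/
theorem energy_eq_and_tendsto_kinetic {n : ℕ} {X : ℕ → ℝ → ℝ}
    (hX : ∀ t, Monotone fun k => X k t)
    (hlim : ∀ k ≤ n, Tendsto (fun t => φ t (X k t)) atTop (𝓝 ((-1) ^ k)))
    (hE : 1 / 2 * (∫ x, ψ 0 x ^ 2) + (∫ x, density U (φ 0) x) ≤ n * (2 * W 1)) :
    1 / 2 * (∫ x, ψ 0 x ^ 2) + (∫ x, density U (φ 0) x) = n * (2 * W 1) ∧
      Tendsto (fun t => ∫ x, ψ t x ^ 2) atTop (𝓝 0) := by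
  have hgain : Tendsto (fun t => ∑ k ∈ Finset.range n,
      (-1) ^ (k + 1) * (W (φ t (X (k + 1) t)) - W (φ t (X k t)))) atTop (𝓝 (n * (2 * W 1))) := by
    have := tendsto_finsetSum (Finset.range n) fun k hk =>
      hU.tendsto_gain hlim (Finset.mem_range.1 hk)
    simpa using this
  have hlow : ∀ t, ∑ k ∈ Finset.range n,
      (-1) ^ (k + 1) * (W (φ t (X (k + 1) t)) - W (φ t (X k t))) ≤ ∫ x, density U (φ t) x := by
    intro t
    refine le_trans (Finset.sum_le_sum fun k _ => le_add_of_nonneg_left ?_)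
      (hU.sum_defect_add_gain_le (h.locAC t) ((h.inSector t).integrable_density hU) (hX t) n)
    exact mul_nonneg (by norm_num) (intervalIntegral.integral_nonneg (hX t (Nat.le_succ k))
      fun x _ => defectSq_nonneg U (φ t) _ x)
  have hbal := h.integral_energy_eq hU hm hp
  have hk := fun t => integral_sq_nonneg (ψ t)
  -- The Bogomolny lower bound holds at every time and tends to the upper bound `2n W(1)`, while the
  -- total energy is constant; this forces equality and leaves nothing for the kinetic part.
  refine ⟨le_antisymm hE (le_of_tendsto' hgain fun t => ?_), ?_⟩
  · linarith [hlow t, hbal t, hk t]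
  · have h0 : Tendsto (fun t => 2 * (n * (2 * W 1) - ∑ k ∈ Finset.range n,
        (-1) ^ (k + 1) * (W (φ t (X (k + 1) t)) - W (φ t (X k t))))) atTop (𝓝 0) := by
      simpa using (hgain.const_sub (n * (2 * W 1))).const_mul 2
    exact squeeze_zero hk (fun t => by linarith [hlow t, hbal t]) h0

include hm hp in
theorem exists_parameters_of_isKinkCluster {n : ℕ} (hc : IsKinkCluster U n φ ψ) :
    (∀ t, energy U (φ t) (ψ t) = n * potentialEnergy U H) ∧
    ∃ a : Fin n → ℝ → ℝ, (∀ k, Continuous (a k)) ∧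
      Tendsto (fun t => l2NormSq (ψ t) + h1NormSq (fun x => φ t x - multiKink U (fun k => a k t) x) +
        ENNReal.ofReal (gapWeight fun k => a k t)) atTop (𝓝 0) := by
  obtain ⟨⟨x, hx, hlim⟩, hE⟩ := hc
  -- The finite family is continued as a constant beyond `n`, which keeps it monotone.
  set X : ℕ → ℝ → ℝ := fun k t => x ⟨min k n, by omega⟩ t with hXdef
  have hX : ∀ t, Monotone fun k => X k t := fun t i j hij =>
    hx t (Fin.le_def.2 (min_le_min_right n hij))
  have hlimX : ∀ k ≤ n, Tendsto (fun t => φ t (X k t)) atTop (𝓝 ((-1) ^ k)) := fun k hk => by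
    have := hlim ⟨min k n, by omega⟩
    simpa only [hXdef, min_eq_left hk] using this
  obtain ⟨hEq, hkin⟩ := h.energy_eq_and_tendsto_kinetic hU hm hp hX hlimX
    ((h.energy_le_iff hU n).1 hE)
  have hbal := h.integral_energy_eq hU hm hp
  refine ⟨fun t => ?_, ?_⟩
  · rw [(h.inSector t).energy_eq hU, hbal t, hEq, hU.potentialEnergy_kink,
      ENNReal.ofReal_mul (Nat.cast_nonneg n), ENNReal.ofReal_natCast]
  obtain ⟨b, hsep, hb⟩ := hU.exists_multiKink_approx (l := atTop) (h.locAC)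
    (fun t => (h.inSector t).integrable_density hU)
    (fun t => by linarith [hbal t, integral_sq_nonneg (ψ t)]) hX hlimX
  obtain ⟨a, ha, hasep, hah⟩ := hU.exists_continuous_parameters (h.locAC)
    h.tendsto_h1NormSq_sub hsep (fun ε hε => (hb ε hε).mono fun t ht => by
      rwa [(h.locAC t).h1NormSq_sub_eq (hU.locAC_multiKink _)])
  refine ⟨fun k t => a t k, fun k => (continuous_apply k).comp ha, ?_⟩
  have t1 : Tendsto (fun t => l2NormSq (ψ t)) atTop (𝓝 0) := by
    have : ∀ t, l2NormSq (ψ t) = ENNReal.ofReal (∫ x, ψ t x ^ 2) := fun t =>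
      l2NormSq_eq_ofReal ((h.inSector t).memLp_snd hU)
    simp only [this]
    simpa using ENNReal.tendsto_ofReal hkin
  have t2 : Tendsto (fun t => h1NormSq fun x => φ t x - multiKink U (a t) x) atTop (𝓝 0) := by
    refine ENNReal.tendsto_nhds_zero.2 fun ε hε => ?_
    obtain ⟨δ, hδ, hδε⟩ : ∃ δ : ℝ, 0 < δ ∧ ENNReal.ofReal δ ≤ ε := by
      refine ⟨(min ε 1).toReal, ENNReal.toReal_pos (lt_min hε one_pos).ne'
        (min_lt_of_right_lt ENNReal.one_lt_top).ne, ?_⟩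
      rw [ENNReal.ofReal_toReal (min_lt_of_right_lt ENNReal.one_lt_top).ne]
      exact min_le_left _ _
    exact (hah δ hδ).mono fun t ht => ht.trans hδε
  have t3 : Tendsto (fun t => ENNReal.ofReal (gapWeight (a t))) atTop (𝓝 0) := by
    have h0 : Tendsto (fun L : ℝ => (n : ℝ) * Real.exp (-(2 * L))) atTop (𝓝 0) := by
      have := (Real.tendsto_exp_neg_atTop_nhds_zero.comp
        (tendsto_id.const_mul_atTop (two_pos (α := ℝ)))).const_mul (n : ℝ)
      simpa [Function.comp_def] using this
    rw [← ENNReal.ofReal_zero]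
    refine ENNReal.tendsto_ofReal (Metric.tendsto_nhds.2 fun ε hε => ?_)
    obtain ⟨L, hL⟩ := (h0.eventually (gt_mem_nhds hε)).exists
    filter_upwards [hasep L] with t ht
    rw [Real.dist_eq, sub_zero, abs_of_nonneg (gapWeight_nonneg _)]
    exact ht.gapWeight_le.trans_lt hL
  simpa using (t1.add t2).add t3

include hm hp in
-- Points interlacing with the kinks see the alternating vacua, and `exists_integral_density_le`
-- bounds the conserved energy in the limit.
theorem isKinkCluster_of_tendsto {n : ℕ} {a : Fin n → ℝ → ℝ}
    (ha : Tendsto (fun t => l2NormSq (ψ t) +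
      h1NormSq (fun x => φ t x - multiKink U (fun k => a k t) x) +
        ENNReal.ofReal (gapWeight fun k => a k t)) atTop (𝓝 0)) : IsKinkCluster U n φ ψ := by
  have t1 : Tendsto (fun t => l2NormSq (ψ t)) atTop (𝓝 0) :=
    tendsto_of_tendsto_of_tendsto_of_le_of_le tendsto_const_nhds ha (fun _ => zero_le)
      fun _ => le_self_add.trans le_self_add
  have t2 : Tendsto (fun t => h1NormSq fun x => φ t x - multiKink U (fun k => a k t) x)
      atTop (𝓝 0) :=
    tendsto_of_tendsto_of_tendsto_of_le_of_le tendsto_const_nhds ha (fun _ => zero_le)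
      fun _ => le_add_self.trans le_self_add
  have t3 : Tendsto (fun t => gapWeight fun k => a k t) atTop (𝓝 0) := by
    have h1 : Tendsto (fun t => ENNReal.ofReal (gapWeight fun k => a k t)) atTop (𝓝 0) :=
      tendsto_of_tendsto_of_tendsto_of_le_of_le tendsto_const_nhds ha (fun _ => zero_le)
        fun _ => le_add_self
    have h2 := (ENNReal.tendsto_toReal ENNReal.zero_ne_top).comp h1
    simpa only [Function.comp_def, ENNReal.toReal_ofReal (gapWeight_nonneg _),
      ENNReal.toReal_zero] using h2
  have hkin : Tendsto (fun t => ∫ x, ψ t x ^ 2) atTop (𝓝 0) := by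
    have h2 := (ENNReal.tendsto_toReal ENNReal.zero_ne_top).comp t1
    have h3 : ∀ t, (l2NormSq (ψ t)).toReal = ∫ x, ψ t x ^ 2 := fun t => by
      rw [l2NormSq_eq_ofReal ((h.inSector t).memLp_snd hU),
        ENNReal.toReal_ofReal (integral_sq_nonneg (ψ t))]
    simpa only [Function.comp_def, h3, ENNReal.toReal_zero] using h2
  have hh1 : ∀ ε, 0 < ε → ∀ᶠ t in atTop,
      h1NormSq (fun x => φ t x - multiKink U (fun k => a k t) x) ≤ ENNReal.ofReal ε := fun ε hε =>
    t2.eventually (ge_mem_nhds (ENNReal.ofReal_pos.2 hε))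
  -- Chosen so that `exp (-2 L)` equals the gap weight plus `exp (-t)`. The extra term keeps the
  -- logarithm meaningful when the sum is empty, for `n ≤ 1`, and still lets `L` tend to infinity.
  set L : ℝ → ℝ := fun t => -(Real.log ((gapWeight fun k => a k t) + Real.exp (-t))) / 2 with hLdef
  have hpos : ∀ t, 0 < (gapWeight fun k => a k t) + Real.exp (-t) := fun t =>
    add_pos_of_nonneg_of_pos (gapWeight_nonneg _) (Real.exp_pos _)
  have hLt : Tendsto L atTop atTop := by
    have h1 : Tendsto (fun t => (gapWeight fun k => a k t) + Real.exp (-t)) atTop (𝓝[>] 0) := by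
      refine tendsto_nhdsWithin_iff.2 ⟨?_, Eventually.of_forall hpos⟩
      simpa using t3.add Real.tendsto_exp_neg_atTop_nhds_zero
    exact (tendsto_neg_atBot_atTop.comp (Real.tendsto_log_nhdsGT_zero.comp h1)).atTop_div_const
      two_pos
  have hsepL : ∀ t, 0 ≤ L t → Separated (L t) fun k => a k t := fun t ht => by
    refine Separated.of_gapWeight ht ?_
    rw [show -(2 * L t) = Real.log ((gapWeight fun k => a k t) + Real.exp (-t)) by
      rw [hLdef]; ring, Real.exp_log (hpos t)]
    linarith [Real.exp_pos (-t)]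
  have hLH : Tendsto (fun t => (n : ℝ) * (1 - H (L t))) atTop (𝓝 0) := by
    simpa using ((hU.tendsto_kink_atTop.comp hLt).const_sub 1).const_mul (n : ℝ)
  refine ⟨?_, (h.energy_le_iff hU n).2 ?_⟩
  · have hx : ∀ t, ∃ x : Fin (n + 1) → ℝ, Monotone x ∧ (0 ≤ L t → ∀ k : Fin (n + 1),
        (∀ j : Fin n, (j : ℕ) < k → a j t + L t ≤ x k) ∧
          ∀ j : Fin n, (k : ℕ) ≤ j → x k ≤ a j t - L t) := by
      intro t
      by_cases ht : 0 ≤ L t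
      · obtain ⟨x, h1, h2⟩ := (hsepL t ht).exists_interlacing ht
        exact ⟨x, h1, fun _ => h2⟩
      · exact ⟨fun _ => 0, fun _ _ _ => le_rfl, fun hL => absurd hL ht⟩
    choose x hx1 hx2 using hx
    refine ⟨fun k t => x t k, hx1, fun k => Metric.tendsto_nhds.2 fun ε hε => ?_⟩
    filter_upwards [hLt.eventually (eventually_ge_atTop 0), hh1 ((ε / 2) ^ 2 / 2) (by positivity),
      hLH.eventually (gt_mem_nhds (half_pos hε))] with t ht1 ht2 ht3
    obtain ⟨h1, h2⟩ := hx2 t ht1 k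
    have h3 := hU.abs_multiKink_sub_sign_le_of_away (a := fun k => a k t) ht1
      (Nat.lt_succ_iff.1 k.isLt) h1 h2
    have h4 := ((h.locAC t).sub (hU.locAC_multiKink fun k => a k t)).sq_le_of_h1NormSq_le
      (by positivity) ht2 (x t k)
    have h5 : |φ t (x t k) - multiKink U (fun k => a k t) (x t k)| ≤ ε / 2 :=
      abs_le_of_sq_le_sq (by linarith) (by positivity)
    rw [Real.dist_eq]
    linarith [abs_sub_le (φ t (x t k)) (multiKink U (fun k => a k t) (x t k)) ((-1) ^ (k : ℕ))]
  · obtain ⟨C, hC, hbound⟩ := hU.exists_integral_density_le n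
    have hbal := h.integral_energy_eq hU hm hp
    set e := 1 / 2 * (∫ x, ψ 0 x ^ 2) + ∫ x, density U (φ 0) x with he
    have hWL : Tendsto (fun t => W 1 - W (H (L t))) atTop (𝓝 0) := by
      simpa using (hU.tendsto_superpotential_kink_atTop.comp hLt).const_sub (W 1)
    -- The limits are taken in the order `t → ∞`, `ε → 0`, `θ → 0`, because the error term carries
    -- the factor `1 + 1/θ`.
    have hθ : ∀ θ : ℝ, 0 < θ → e ≤ (1 + θ) * (n * (2 * W 1)) := by
      intro θ hθ
      have hε : ∀ ε : ℝ, 0 < ε ∧ ε ≤ 1 / 2 →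
          e ≤ (1 + θ) * (n * (2 * W 1)) + (1 + 1 / θ) * (C * ε) := by
        intro ε hε
        have hr : Tendsto (fun t => 1 / 2 * (∫ x, ψ t x ^ 2) + ((1 + θ) * (n * (2 * W 1)) +
            (1 + 1 / θ) * (C * (ε + n * (W 1 - W (H (L t))))))) atTop
            (𝓝 (1 / 2 * 0 + ((1 + θ) * (n * (2 * W 1)) +
              (1 + 1 / θ) * (C * (ε + n * 0))))) :=
          (hkin.const_mul _).add ((((hWL.const_mul _).const_add ε).const_mul C).const_mul _
            |>.const_add _)
        rw [mul_zero, mul_zero, add_zero, zero_add] at hr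
        refine ge_of_tendsto hr ?_
        filter_upwards [hLt.eventually (eventually_ge_atTop 0), hh1 ε hε.1] with t ht1 ht2
        have := hbound (φ t) (fun k => a k t) (L t) θ ε (h.locAC t) ht1 hθ hε.1.le hε.2
          (hsepL t ht1) ht2
        linarith [hbal t]
      have ht : Tendsto (fun ε : ℝ => (1 + θ) * (n * (2 * W 1)) + (1 + 1 / θ) * (C * ε))
          (𝓝[>] 0) (𝓝 ((1 + θ) * (n * (2 * W 1)) + (1 + 1 / θ) * (C * 0))) :=
        (Continuous.tendsto (by fun_prop) 0).mono_left nhdsWithin_le_nhds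
      rw [mul_zero, mul_zero, add_zero] at ht
      exact ge_of_tendsto ht (Filter.mem_of_superset (Ioc_mem_nhdsGT one_half_pos) hε)
    have ht : Tendsto (fun θ : ℝ => (1 + θ) * (n * (2 * W 1))) (𝓝[>] 0)
        (𝓝 ((1 + 0) * (n * (2 * W 1)))) :=
      (Continuous.tendsto (by fun_prop) 0).mono_left nhdsWithin_le_nhds
    rw [add_zero, one_mul] at ht
    exact ge_of_tendsto ht (eventually_mem_nhdsWithin.mono hθ)

end IsSolutionInSector

end ScalarField

theorem proposition1p2 (U : ℝ → ℝ) (hU : ScalarField.IsPotential U) (n : ℕ)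
    (φ ψ : ℝ → ℝ → ℝ) (hφ : ScalarField.IsSolution U φ ψ) :
    (ScalarField.IsKinkCluster U n φ ψ ↔
      ∃ a : Fin n → ℝ → ℝ, (∀ k, Continuous (a k)) ∧
        Tendsto
          (fun t => ScalarField.l2NormSq (ψ t) +
            ScalarField.h1NormSq
              (fun x => φ t x - ScalarField.multiKink U (fun k => a k t) x) +
            ENNReal.ofReal (ScalarField.gapWeight fun k => a k t))
          atTop (𝓝 0)) ∧
    (ScalarField.IsKinkCluster U n φ ψ →
      ∀ t, ScalarField.energy U (φ t) (ψ t) =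
        n * ScalarField.potentialEnergy U (ScalarField.kink U)) := by
  obtain ⟨ιm, ιp, hm, hp, h⟩ := hφ
  exact ⟨⟨fun hc => (h.exists_parameters_of_isKinkCluster hU hm hp hc).2,
    fun ⟨_, _, ha⟩ => h.isKinkCluster_of_tendsto hU hm hp ha⟩,
    fun hc => (h.exists_parameters_of_isKinkCluster hU hm hp hc).1⟩
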